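/- Let $n\ge 2$, let $\Omega\subset\mathbb{R}^n$ be a bounded convex domain (open set) with $O\in\partial\Omega$, where $O$ is the origin, and let $u\in C^4(\overline\Omega)$ be real-valued with $u=0$ and $\nabla u=0$ on $\partial\Omega$. Let $\varkappa(x)=(t,\omega)=(\log|x|^{-1},\,x/|x|)$ for $x\ne 0$, so that $\varkappa^{-1}(t,\omega)=e^{-t}\omega$ for $t\in\mathbb{R}$, $\omega\in S^{n-1}$, and put $$v=e^{2t}(u\circ\varkappa^{-1}),\qquad\text{i.e.}\qquad v(t,\omega)=e^{2t}u(e^{-t}\omega).$$ Define $$g(t)=-\frac{1}{2n\sqrt{n^2+8}}\begin{cases} n\,e^{-\frac12(n-\sqrt{n^2+8})t}-\sqrt{n^2+8}, & t<0,\\[2pt] n\,e^{-\frac12(n+\sqrt{n^2+8})t}-\sqrt{n^2+8}\,e^{-nt}, & t\ge 0.\end{cases}$$ Then for every $\xi\in\Omega$, with $\tau=\log|\xi|^{-1}$, all three integrals below converge absolutely and $$\frac12\int_{\{\omega\in S^{n-1}:\,(\tau,\omega)\in\varkappa(\Omega)\}}v^2(\tau,\omega)\,d\omega\;\le\;\frac{n^2+n-2}{n}\int_\Omega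 \Delta u(x)\,\Delta\!\left(\frac{u(x)\,g(\log(|\xi|/|x|))}{|x|^n}\right)dx\;-\;\frac{n^2-2}{2n}\int_\Omega \Delta^2u(x)\,\frac{(x\cdot\nabla u(x))\,g(\log(|\xi|/|x|))}{|x|^n}\,dx,$$ where $d\omega$ is the surface measure on the unit sphere $S^{n-1}$. -/

import Mathlib

open MeasureTheory

noncomputable section

/-- `ℝⁿ` with its Euclidean norm. -/
abbrev RSpace (n : ℕ) : Type := EuclideanSpace ℝ (Fin n)

/-- The map `ϰ : x ↦ (t, ω) = (log |x|⁻¹, x / |x|)`, a bijection of `ℝⁿ ∖ {0}` onto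
`ℝ × Sⁿ⁻¹` with inverse `(t, ω) ↦ e⁻ᵗ ω`. -/
def logPolar (n : ℕ) : PartialEquiv (RSpace n) (ℝ × RSpace n) where
  toFun x := (Real.log ‖x‖⁻¹, ‖x‖⁻¹ • x)
  invFun p := Real.exp (-p.1) • p.2
  source := {x | x ≠ 0}
  target := {p | ‖p.2‖ = 1}
  map_source' := by
    intro x hx
    have h : ‖x‖ ≠ 0 := norm_ne_zero_iff.mpr hx
    simp [norm_smul, h]
  map_target' := by
    intro p hp h
    have h2 : p.2 = 0 := by simpa [Real.exp_ne_zero] using h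
    have h1 : ‖p.2‖ = 1 := hp
    simp [h2] at h1
  left_inv' := by
    intro x hx
    have h : 0 < ‖x‖ := norm_pos_iff.mpr hx
    simp [Real.log_inv, Real.exp_log h, smul_smul, h.ne']
  right_inv' := by
    intro p hp
    have h1 : ‖p.2‖ = 1 := hp
    have hn : ‖Real.exp (-p.1) • p.2‖ = Real.exp (-p.1) := by
      rw [norm_smul, h1, mul_one, Real.norm_eq_abs, abs_of_pos (Real.exp_pos _)]
    ext1
    · simp [hn, Real.log_inv]
    · simp [hn, smul_smul, ← Real.exp_neg, ← Real.exp_add]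

/-- `v = e^{2t} (u ∘ ϰ⁻¹)`, as a function of `(t, ω)`. -/
def logPolarTransform {n : ℕ} (u : RSpace n → ℝ) (p : ℝ × RSpace n) : ℝ :=
  Real.exp (2 * p.1) * u ((logPolar n).symm p)

/-- The set `Sⁿ⁻¹ ∩ ϰ(Ω)` at the level `t = τ`: all `ω ∈ Sⁿ⁻¹` with `(τ, ω) ∈ ϰ(Ω)`. -/
def sphereSlice {n : ℕ} (Ω : Set (RSpace n)) (τ : ℝ) : Set (Metric.sphere (0 : RSpace n) 1) :=
  {ω | (τ, (ω : RSpace n)) ∈ logPolar n '' Ω}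

/-- The function `g`, the explicit bounded solution, vanishing at `+∞`, of
`g'''' + 2n g''' + (n² - 2) g'' - 2n g' = δ`. The two branches agree at `t = 0`
up to their second derivatives. -/
def greenG (n : ℕ) (t : ℝ) : ℝ :=
  -(1 / (2 * n * √((n : ℝ) ^ 2 + 8))) *
    if t < 0 then
      n * Real.exp (-(1 / 2) * (n - √((n : ℝ) ^ 2 + 8)) * t) - √((n : ℝ) ^ 2 + 8)
    else
      n * Real.exp (-(1 / 2) * (n + √((n : ℝ) ^ 2 + 8)) * t)
        - √((n : ℝ) ^ 2 + 8) * Real.exp (-n * t)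

/-- The weight `x ↦ g(log(|ξ| / |x|)) / |x|ⁿ`. -/
def greenWeight {n : ℕ} (ξ x : RSpace n) : ℝ :=
  greenG n (Real.log (‖ξ‖ / ‖x‖)) / ‖x‖ ^ n

end

open scoped Laplacian Gradient

/-!
Write `r = |x|`, `t = log (1 / r)`, `E = x · ∇`, `R = |ξ|` and `γₖ = g⁽ᵏ⁾(log (R / r)) r⁻ⁿ`. The
function `g` is a Green function, `g'''' + 2n g''' + (n² - 2) g'' - 2n g' = δ`: away from `0` it
solves the homogeneous equation, `g`, `g'`, `g''` are continuous, and `g'''` jumps by one at `0`.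
Integration by parts in `t` against `γ₃` therefore produces the integral of `v²` over the sphere of
radius `R`, where `v = u / r²`; this is the left-hand side.

*Test functions.* For `u` smooth with compact support in an open half-space `{x | 0 < ⟨α, x⟩}`,
integration by parts in `t` and on the sphere turns the right-hand side into `½ ∫ v² dω` plus five
terms. They are nonnegative by the sign properties of `g` and by two inequalities for functions
vanishing near the boundary of the half-sphere: the first Dirichlet eigenvalue of the half-sphere is
`n - 1` (`PolarCalculus.IsRadialWeight.mul_sq_le_gamma`), and the clamped inequality `∫ (δv)² ≥ 2n ∫
|∇v|²` (`PolarCalculus.IsRadialWeight.gamma_le_lap_sq`). Both follow from substitutions `v = φ z`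
and `v = φ² z`, where `φ` is the height function `⟨α, x⟩ / r`. These computations use only the
Leibniz rule and the commutators of the tangential and radial derivatives, so they are carried out
in a commutative algebra with derivations, `PolarCalculus`, with integration replaced by linear
functionals (`PolarCalculus.half_sphere_integral_le`).

*Vanishing Cauchy data.* Since `0 ∈ ∂Ω` and `Ω` is convex, `Ω` lies in such a half-space. As `u` and
`∇u` vanish on `∂Ω`, extension by zero gives a function `U` of class `C¹` with Lipschitz gradient
(`exists_extension_of_cauchy_data_eq_zero`). Shrinking and mollifying `U` gives test functions in
`Ω` that converge to it, with second derivatives, at every point of `Ω`, and whose second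
derivatives are uniformly bounded (`nonempty_testApproximation`). Because `0 ∉ Ω` their values are
`O(r²)` and their gradients `O(r)` uniformly, while the `γₖ` with `k ≤ 2` are bounded
(`exists_bound_radialWeight_greenDeriv`). So the integrals of densities built from the `γₖ`, `Δu`,
`u / r²`, `x · ∇u / r²` and `∇²u(x, x) / r²` pass to the limit by dominated convergence. In
particular the inequality for test functions, whose density is `jetDensity`, holds for `U`.

*The fourth-order term.* It remains to replace `∫ Δ²u (x · ∇u) γ₀` by an integral quadratic in
second derivatives. Green's second identity for `Δu` and `(x · ∇V) γ₀`, with test functions `V`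
tending to `u`, moves the Laplacian onto `(x · ∇V) γ₀`; the third derivatives of `V`, which have no
limit, are removed by a further integration by parts along `x` (`setIntegral_eulerDensity_eq_zero`).
In the limit this leaves the term `Δu (x · ∇Δu) γ₀`, half the divergence of `x (Δu)² γ₀` up to `½
(Δu)² γ₁`. That divergence has a nonnegative integral because `Ω` is star-shaped about `0 ∈ ∂Ω`
(`setIntegral_euler_divergence_nonneg`). The result is an upper bound for the fourth-order integral
(`TestApproximation.setIntegral_laplacian_laplacian_le`). Its coefficient `-(n² - 2) / (2n)` in the
theorem is negative, so the bound goes in the right direction, and by `jetDensity_eq` it turns the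
right-hand side into `∫ jetDensity`.
-/


/-! ### Polar calculus in a commutative algebra -/

/-- An algebraic model of polar coordinates on an open subset of `ℝⁿ ∖ {0}`. The ring `A` stands for
the smooth functions, `D i` for the tangential derivative `r ∂ᵢ - ωᵢ E`, `E` for the Euler
derivation `x · ∇` and `ω i` for the `i`-th coordinate `xᵢ / r` of the unit vector `x / r`. -/
structure PolarCalculus (A : Type*) [CommRing A] [Algebra ℝ A] (n : ℕ) where
  D : Fin n → Derivation ℝ A A
  E : Derivation ℝ A A
  ω : Fin n → A
  sum_ω_sq : ∑ i, ω i * ω i = 1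
  D_ω : ∀ i j, D i (ω j) = (if i = j then 1 else 0) - ω i * ω j
  E_ω : ∀ i, E (ω i) = 0
  sum_ω_D : ∀ f, ∑ i, ω i * D i f = 0
  D_comm : ∀ i j f, D i (D j f) = D j (D i f) + ω i * D j f - ω j * D i f
  E_comm : ∀ i f, E (D i f) = D i (E f)

namespace PolarCalculus

variable {A : Type*} [CommRing A] [Algebra ℝ A] {n : ℕ} (P : PolarCalculus A n)

/-- The product of the angular gradients of `a` and `b`. -/
def gamma (a b : A) : A := ∑ i, P.D i a * P.D i b

/-- The Laplace–Beltrami operator of the unit sphere. -/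
def lap (a : A) : A := ∑ i, P.D i (P.D i a)

lemma sum_D_mul_D (a b : A) : ∑ i, P.D i a * P.D i b = P.gamma a b := rfl

lemma gamma_comm (a b : A) : P.gamma a b = P.gamma b a := by
  simp [gamma, mul_comm]

lemma gamma_mul_right (a b c : A) :
    P.gamma a (b * c) = b * P.gamma a c + c * P.gamma a b := by
  simp only [gamma, Derivation.leibniz, smul_eq_mul, Finset.mul_sum, ← Finset.sum_add_distrib]
  exact Finset.sum_congr rfl fun i _ => by ring

lemma gamma_mul_left (a b c : A) :
    P.gamma (a * b) c = a * P.gamma b c + b * P.gamma a c := by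
  rw [gamma_comm, gamma_mul_right, P.gamma_comm c, P.gamma_comm c]

lemma gamma_sum_right {κ : Type*} (s : Finset κ) (a : A) (b : κ → A) :
    P.gamma a (∑ k ∈ s, b k) = ∑ k ∈ s, P.gamma a (b k) := by
  simp only [gamma, map_sum, Finset.mul_sum]
  exact Finset.sum_comm

lemma lap_add (a b : A) : P.lap (a + b) = P.lap a + P.lap b := by
  simp [lap, Finset.sum_add_distrib]

lemma lap_mul (a b : A) : P.lap (a * b) = a * P.lap b + b * P.lap a + 2 * P.gamma a b := by
  simp only [lap, gamma, Derivation.leibniz, smul_eq_mul, Finset.mul_sum, map_add,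
    ← Finset.sum_add_distrib]
  exact Finset.sum_congr rfl fun i _ => by ring

lemma E_gamma (a b : A) : P.E (P.gamma a b) = P.gamma (P.E a) b + P.gamma a (P.E b) := by
  simp only [gamma, map_sum, Derivation.leibniz, smul_eq_mul, ← Finset.sum_add_distrib, P.E_comm]
  exact Finset.sum_congr rfl fun i _ => by ring

lemma gamma_algebraMap (a : A) (c : ℝ) : P.gamma a (algebraMap ℝ A c) = 0 := by
  simp [gamma]

lemma gamma_algebraMap_mul (a b : A) (c : ℝ) :
    P.gamma a (algebraMap ℝ A c * b) = algebraMap ℝ A c * P.gamma a b := by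
  rw [gamma_mul_right, gamma_algebraMap]; ring

lemma lap_algebraMap_mul (b : A) (c : ℝ) :
    P.lap (algebraMap ℝ A c * b) = algebraMap ℝ A c * P.lap b := by
  simp [lap, Finset.mul_sum]

/-- The commutator of the Laplace–Beltrami operator with a tangential derivative. -/
lemma lap_D (i : Fin n) (f : A) :
    P.lap (P.D i f) = P.D i (P.lap f) - 2 * P.ω i * P.lap f + ((n : A) - 3) * P.D i f := by
  have h1 : ∀ j, P.D j (P.D j (P.D i f)) =
      P.D i (P.D j (P.D j f)) + P.ω j * P.D i (P.D j f) - 2 * (P.ω i * P.D j (P.D j f))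
        + (P.D i f - P.ω j * P.ω j * P.D i f) + P.ω j * P.D j (P.D i f)
        - (if j = i then 1 else 0) * P.D j f + P.ω i * (P.ω j * P.D j f) := by
    intro j
    have h := congrArg (P.D j) (P.D_comm j i f)
    simp only [map_add, map_sub, Derivation.leibniz, smul_eq_mul, P.D_ω, if_true] at h
    rw [h, P.D_comm j i (P.D j f)]
    ring
  have h2 : ∑ j, P.ω j * P.D i (P.D j f) = - P.D i f := by
    have h := congrArg (P.D i) (P.sum_ω_D f)
    simp only [map_sum, Derivation.leibniz, smul_eq_mul, P.D_ω, map_zero,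
      Finset.sum_add_distrib] at h
    have h3 : ∑ j, P.D j f * ((if i = j then 1 else 0) - P.ω i * P.ω j)
        = P.D i f - P.ω i * ∑ j, P.ω j * P.D j f := by
      simp only [mul_sub, Finset.sum_sub_distrib, mul_ite, mul_one, mul_zero, Finset.sum_ite_eq,
        Finset.mem_univ, if_true, Finset.mul_sum]
      congr 1
      exact Finset.sum_congr rfl fun j _ => by ring
    rw [h3, P.sum_ω_D] at h
    linear_combination h
  have h4 : ∑ j, (if j = i then (1 : A) else 0) * P.D j f = P.D i f := by simp
  simp only [lap, h1, Finset.sum_add_distrib, Finset.sum_sub_distrib, ← Finset.mul_sum,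
    ← Finset.sum_mul, P.sum_ω_D, h2, h4, P.sum_ω_sq, map_sum]
  simp only [Finset.sum_const, Finset.card_univ, Fintype.card_fin, nsmul_eq_mul]
  ring

/-- The height function `ω ↦ ⟨α, ω⟩`. -/
def height (α : Fin n → ℝ) : A := ∑ i, algebraMap ℝ A (α i) * P.ω i

section height

variable (α : Fin n → ℝ)

lemma D_height (j : Fin n) :
    P.D j (P.height α) = algebraMap ℝ A (α j) - P.height α * P.ω j := by
  simp only [height, map_sum, Derivation.leibniz, smul_eq_mul, P.D_ω,
    Derivation.map_algebraMap, mul_zero, add_zero, mul_sub, Finset.sum_sub_distrib, Finset.sum_mul]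
  congr 1
  · simp
  · exact Finset.sum_congr rfl fun i _ => by ring

lemma gamma_height (f : A) :
    P.gamma (P.height α) f = ∑ i, algebraMap ℝ A (α i) * P.D i f := by
  simp only [gamma, D_height, sub_mul, Finset.sum_sub_distrib, mul_assoc, ← Finset.mul_sum,
    P.sum_ω_D, mul_zero, sub_zero]

lemma gamma_height_self (hα : ∑ i, α i ^ 2 = 1) :
    P.gamma (P.height α) (P.height α) = 1 - P.height α ^ 2 := by
  rw [gamma_height]
  have : ∀ i, algebraMap ℝ A (α i) * P.D i (P.height α) =
      algebraMap ℝ A (α i ^ 2) - P.height α * (algebraMap ℝ A (α i) * P.ω i) := by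
    intro i; rw [D_height, map_pow]; ring
  simp only [this, Finset.sum_sub_distrib, ← Finset.mul_sum, ← map_sum, hα, map_one]
  rw [← height]; ring

lemma lap_height : P.lap (P.height α) = -((n : A) - 1) * P.height α := by
  have h : ∀ i, P.D i (P.D i (P.height α)) =
      -(P.ω i * P.D i (P.height α)) - (P.height α - P.ω i * P.ω i * P.height α) := by
    intro i
    rw [D_height, map_sub, Derivation.map_algebraMap, Derivation.leibniz, P.D_ω, D_height]
    simp only [smul_eq_mul, if_true]
    ring
  simp only [lap, h, Finset.sum_sub_distrib, Finset.sum_neg_distrib, P.sum_ω_D, ← Finset.sum_mul,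
    P.sum_ω_sq]
  simp
  ring

end height

/-- `W` behaves like integration against `ρ(|x|) |x|⁻ⁿ dx`: it integrates by parts against the
tangential derivatives, on the ideal `T` of compactly supported functions. -/
structure IsRadialWeight (T : Ideal A) (W : A →ₗ[ℝ] ℝ) : Prop where
  D_eq : ∀ F ∈ T, ∀ i, W (P.D i F) = ((n : ℝ) - 1) * W (P.ω i * F)

variable {P} {T : Ideal A} {W : A →ₗ[ℝ] ℝ}

lemma IsRadialWeight.lap_mul_left (hW : P.IsRadialWeight T W) {b : A} (hb : b ∈ T) (a : A) :
    W (b * P.lap a) = - W (P.gamma b a) := by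
  have h : ∑ i, W (P.D i (b * P.D i a)) = 0 := by
    simp only [fun i => hW.D_eq (b * P.D i a) (T.mul_mem_right _ hb) i, ← Finset.mul_sum, ← map_sum]
    have : ∑ i, P.ω i * (b * P.D i a) = b * ∑ i, P.ω i * P.D i a := by
      rw [Finset.mul_sum]; exact Finset.sum_congr rfl fun i _ => by ring
    rw [this, P.sum_ω_D]; simp
  rw [← map_sum] at h
  simp only [Derivation.leibniz, smul_eq_mul, Finset.sum_add_distrib, ← Finset.mul_sum] at h
  rw [map_add] at h
  rw [gamma, lap, eq_neg_iff_add_eq_zero, ← h]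
  congr 2
  exact Finset.sum_congr rfl fun i _ => by ring

end PolarCalculus


/-! ### Tangential inequalities on a hemisphere -/

namespace PolarCalculus

variable {A : Type*} [CommRing A] [Algebra ℝ A] {n : ℕ} {P : PolarCalculus A n}
  {T : Ideal A} {W : A →ₗ[ℝ] ℝ}

/-- The spectral gap of a domain in the half-sphere `{φ > 0}`: the height `φ` is the first Dirichlet
eigenfunction, with eigenvalue `n - 1`. The proof is the ground state substitution `v = φ z`. -/
lemma IsRadialWeight.mul_sq_le_gamma (hW : P.IsRadialWeight T W)
    (hpos : ∀ f, 0 ≤ W (f * f)) (α : Fin n → ℝ) {v ψ : A} (hv : v ∈ T)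
    (hψ : P.height α * ψ = 1) :
    ((n : ℝ) - 1) * W (v * v) ≤ W (P.gamma v v) := by
  set φ := P.height α with hφ
  set z := ψ * v with hz
  have hzT : z ∈ T := T.mul_mem_left _ hv
  have hvz : v = φ * z := by rw [hz, ← mul_assoc, hψ, one_mul]
  have h1 : P.gamma v v = (∑ i, (φ * P.D i z) * (φ * P.D i z)) + P.gamma (φ * (z * z)) φ := by
    have : ∑ i, (φ * P.D i z) * (φ * P.D i z) = φ * φ * P.gamma z z := by
      rw [gamma, Finset.mul_sum]; exact Finset.sum_congr rfl fun i _ => by ring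
    rw [this, hvz]
    simp only [gamma_mul_left, gamma_mul_right, P.gamma_comm φ z]
    ring
  have h2 : φ * (z * z) ∈ T := T.mul_mem_left _ (T.mul_mem_left _ hzT)
  have h3 := hW.lap_mul_left h2 φ
  rw [hφ, lap_height, ← hφ] at h3
  have h4 : φ * (z * z) * (-((n : A) - 1) * φ) = (-((n : ℝ) - 1)) • (v * v) := by
    rw [hvz, Algebra.smul_def, map_neg, map_sub, map_natCast, map_one]; ring
  rw [h4, map_smul, smul_eq_mul] at h3
  have h5 : 0 ≤ W (∑ i, (φ * P.D i z) * (φ * P.D i z)) := by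
    rw [map_sum]; exact Finset.sum_nonneg fun i _ => hpos _
  rw [h1, map_add]
  linarith

lemma sum_height_D_sq (α : Fin n → ℝ) (hα : ∑ i, α i ^ 2 = 1) (z : A) :
    ∑ i, (P.height α * P.D i z + algebraMap ℝ A (α i) * z) *
        (P.height α * P.D i z + algebraMap ℝ A (α i) * z)
      = P.height α ^ 2 * P.gamma z z + 2 * P.height α * z * P.gamma (P.height α) z + z ^ 2 := by
  have h : ∀ i, (P.height α * P.D i z + algebraMap ℝ A (α i) * z) *
        (P.height α * P.D i z + algebraMap ℝ A (α i) * z) =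
        P.height α ^ 2 * (P.D i z * P.D i z)
          + 2 * P.height α * z * (algebraMap ℝ A (α i) * P.D i z)
          + algebraMap ℝ A (α i ^ 2) * z ^ 2 := by
    intro i; rw [map_pow]; ring
  simp only [h, Finset.sum_add_distrib, ← Finset.mul_sum, ← Finset.sum_mul, ← map_sum, hα, map_one,
    ← gamma_height, sum_D_mul_D, one_mul]

lemma lap_height_D (α : Fin n → ℝ) (z : A) (i : Fin n) :
    P.lap (P.height α * P.D i z + algebraMap ℝ A (α i) * z) =
      P.height α * (P.D i (P.lap z) - 2 * P.ω i * P.lap z - 2 * P.D i z)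
        + 2 * P.gamma (P.height α) (P.D i z) + algebraMap ℝ A (α i) * P.lap z := by
  rw [lap_add, lap_algebraMap_mul, lap_mul, lap_height, lap_D]
  ring

/-- The pairing of the vector `(φ Dᵢ z + αᵢ z)ᵢ` with its Laplace–Beltrami image. -/
lemma sum_height_D_mul_lap (α : Fin n → ℝ) (hα : ∑ i, α i ^ 2 = 1) (z : A) :
    ∑ i, (P.height α * P.D i z + algebraMap ℝ A (α i) * z) *
        P.lap (P.height α * P.D i z + algebraMap ℝ A (α i) * z)
      = P.height α ^ 2 * P.gamma z (P.lap z) - 2 * P.height α ^ 2 * P.gamma z z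
        + P.height α * P.gamma (P.height α) (P.gamma z z)
        + P.height α * P.gamma (P.height α) z * P.lap z
        + z * (P.height α * P.gamma (P.height α) (P.lap z) - 2 * P.height α ^ 2 * P.lap z
          - 2 * P.height α * P.gamma (P.height α) z
          + 2 * P.gamma (P.height α) (P.gamma (P.height α) z) + P.lap z) := by
  set φ := P.height α with hφ
  have h : ∀ i, (φ * P.D i z + algebraMap ℝ A (α i) * z) *
        P.lap (φ * P.D i z + algebraMap ℝ A (α i) * z) =
      φ ^ 2 * (P.D i z * P.D i (P.lap z)) - 2 * φ ^ 2 * P.lap z * (P.ω i * P.D i z)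
      - 2 * φ ^ 2 * (P.D i z * P.D i z)
      + φ * P.gamma φ (P.D i z * P.D i z)
      + φ * P.lap z * (algebraMap ℝ A (α i) * P.D i z)
      + z * φ * (algebraMap ℝ A (α i) * P.D i (P.lap z))
      - 2 * z * φ * P.lap z * (algebraMap ℝ A (α i) * P.ω i)
      - 2 * z * φ * (algebraMap ℝ A (α i) * P.D i z)
      + 2 * z * P.gamma φ (algebraMap ℝ A (α i) * P.D i z)
      + algebraMap ℝ A (α i ^ 2) * (z * P.lap z) := by
    intro i
    rw [hφ, lap_height_D, ← hφ, gamma_algebraMap_mul, gamma_mul_right, map_pow]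
    ring
  simp only [h, Finset.sum_add_distrib, Finset.sum_sub_distrib, ← Finset.mul_sum, ← Finset.sum_mul,
    ← map_sum, hα, map_one, P.sum_ω_D, ← gamma_sum_right]
  have h1 : ∀ f, ∑ i, algebraMap ℝ A (α i) * P.D i f = P.gamma φ f := fun f =>
    (P.gamma_height α f).symm
  have h2 : ∑ i, algebraMap ℝ A (α i) * P.ω i = φ := rfl
  rw [h1, h1, h2]
  simp only [gamma]
  ring

/-- The angular gradient of `z` paired with that of `⟨∇φ, ∇z⟩`. -/
lemma two_mul_gamma_gamma_height (α : Fin n → ℝ) (z : A) :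
    2 * P.gamma z (P.gamma (P.height α) z)
      = P.gamma (P.height α) (P.gamma z z) - 2 * P.height α * P.gamma z z := by
  have h1 : ∀ i, P.D i (P.gamma (P.height α) z) =
      P.gamma (P.height α) (P.D i z) + P.ω i * P.gamma (P.height α) z
        - P.height α * P.D i z := by
    intro i
    simp only [gamma_height, map_sum, Derivation.leibniz, smul_eq_mul, Derivation.map_algebraMap,
      mul_zero, add_zero]
    rw [height, Finset.mul_sum, Finset.sum_mul, ← Finset.sum_add_distrib, ← Finset.sum_sub_distrib]
    refine Finset.sum_congr rfl fun j _ => ?_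
    rw [P.D_comm i j z]; ring
  have h2 : P.gamma z (P.gamma (P.height α) z) =
      ∑ i, (P.D i z * P.gamma (P.height α) (P.D i z)
        + P.gamma (P.height α) z * (P.ω i * P.D i z) - P.height α * (P.D i z * P.D i z)) := by
    rw [gamma]
    refine Finset.sum_congr rfl fun i _ => ?_
    rw [h1]; ring
  have h3 : P.gamma (P.height α) (P.gamma z z) =
      ∑ i, 2 * (P.D i z * P.gamma (P.height α) (P.D i z)) := by
    rw [← P.sum_D_mul_D z z, gamma_sum_right]
    refine Finset.sum_congr rfl fun i _ => ?_
    rw [gamma_mul_right]; ring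
  rw [h2, h3, Finset.sum_sub_distrib, Finset.sum_add_distrib, ← Finset.mul_sum, ← Finset.mul_sum,
    ← Finset.mul_sum, P.sum_ω_D, sum_D_mul_D]
  ring

/-- The clamped inequality `∫ (δv)² ≥ 2n ∫ |∇v|²` on the half-sphere `{φ > 0}`, an equality for
`v = φ²`. With `v = φ² z`, the difference of the two sides is
`∫ φ² ∑ᵢ |∇yᵢ|² + ∫ (n φ⁴ |∇z|² + 2 φ² ⟨∇φ, ∇z⟩²)`, where `yᵢ = φ Dᵢ z + αᵢ z`. -/
lemma IsRadialWeight.gamma_le_lap_sq (hW : P.IsRadialWeight T W)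
    (hpos : ∀ f, 0 ≤ W (f * f)) (hTD : ∀ f ∈ T, ∀ i, P.D i f ∈ T)
    (α : Fin n → ℝ) (hα : ∑ i, α i ^ 2 = 1) {v ψ : A} (hv : v ∈ T)
    (hψ : P.height α * ψ = 1) :
    2 * (n : ℝ) * W (P.gamma v v) ≤ W (P.lap v * P.lap v) := by
  set φ := P.height α with hφ
  obtain ⟨z, hzT, hvz⟩ : ∃ z ∈ T, v = φ ^ 2 * z :=
    ⟨ψ * (ψ * v), T.mul_mem_left _ (T.mul_mem_left _ hv),
      by linear_combination (-(φ * ψ) - 1) * v * hψ⟩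
  have hδφ : P.lap φ = -((n : A) - 1) * φ := P.lap_height α
  have hφφ : P.gamma φ φ = 1 - φ ^ 2 := P.gamma_height_self α hα
  have hTlap : ∀ f ∈ T, P.lap f ∈ T := fun f hf => T.sum_mem fun i _ => hTD _ (hTD f hf i) i
  have hTgam : ∀ f ∈ T, ∀ g, P.gamma g f ∈ T := fun f hf g =>
    T.sum_mem fun i _ => T.mul_mem_left _ (hTD f hf i)
  -- integration by parts against `∇φ`, with a weight `φᵏ`
  have ibp : ∀ (k : ℕ) (b : A), b ∈ T → W (φ ^ (k + 1) * P.gamma φ b)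
      = - W (b * (((k : A) + 1) * φ ^ k * (1 - φ ^ 2) - ((n : A) - 1) * φ ^ (k + 2))) := by
    intro k b hb
    have hg : ∀ m : ℕ, P.gamma φ (φ ^ (m + 1)) = ((m : A) + 1) * φ ^ m * (1 - φ ^ 2) := by
      intro m
      induction m with
      | zero => simp [hφφ]
      | succ m ih => rw [pow_succ, gamma_mul_right, ih, hφφ]; push_cast; ring
    have h := hW.lap_mul_left (b := b * φ ^ (k + 1)) (T.mul_mem_right _ hb) φ
    rw [hδφ, P.gamma_comm _ φ, gamma_mul_right, hg, map_add] at h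
    have e : b * (((k : A) + 1) * φ ^ k * (1 - φ ^ 2) - ((n : A) - 1) * φ ^ (k + 2))
      = b * (((k : A) + 1) * φ ^ k * (1 - φ ^ 2)) + b * φ ^ (k + 1) * (-((n : A) - 1) * φ) := by
      ring
    rw [e, map_add]; linarith
  set N := P.gamma φ z with hN
  set G := P.gamma z z with hG
  set Z := P.lap z with hZ
  have hNT : N ∈ T := hTgam z hzT φ
  have hGT : G ∈ T := hTgam z hzT z
  have hZT : Z ∈ T := hTlap z hzT
  have hlapv : P.lap v = φ ^ 2 * Z + 4 * φ * N + (2 - 2 * (n : A) * φ ^ 2) * z := by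
    rw [hvz, pow_two, lap_mul, lap_mul, gamma_mul_left, hδφ, hφφ]; ring
  have hS : 0 ≤ ∑ i, W ((φ ^ 2) * P.gamma (φ * P.D i z + algebraMap ℝ A (α i) * z)
      (φ * P.D i z + algebraMap ℝ A (α i) * z)) := by
    refine Finset.sum_nonneg fun i _ => ?_
    rw [gamma, Finset.mul_sum, map_sum]
    refine Finset.sum_nonneg fun j _ => ?_
    refine le_of_le_of_eq (hpos (φ * P.D j (φ * P.D i z + algebraMap ℝ A (α i) * z))) ?_
    congr 1; ring
  have hSi : ∀ i, W ((φ ^ 2) * P.gamma (φ * P.D i z + algebraMap ℝ A (α i) * z)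
      (φ * P.D i z + algebraMap ℝ A (α i) * z)) =
      W ((1 - (n : A) * φ ^ 2) * ((φ * P.D i z + algebraMap ℝ A (α i) * z) *
        (φ * P.D i z + algebraMap ℝ A (α i) * z))) - W (φ ^ 2 * (
        (φ * P.D i z + algebraMap ℝ A (α i) * z) *
        P.lap (φ * P.D i z + algebraMap ℝ A (α i) * z))) := by
    intro i
    set y := φ * P.D i z + algebraMap ℝ A (α i) * z with hy
    have hyT : y ∈ T := T.add_mem (T.mul_mem_left _ (hTD z hzT i)) (T.mul_mem_left _ hzT)
    have h1 := hW.lap_mul_left (b := φ ^ 2 * y) (T.mul_mem_left _ hyT) y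
    have h2 := ibp 0 (y * y) (T.mul_mem_left _ hyT)
    rw [pow_two, gamma_mul_left, gamma_mul_left] at h1
    rw [gamma_mul_right] at h2
    have e1 : φ * φ * P.gamma y y + y * (φ * P.gamma φ y + φ * P.gamma φ y) =
      φ ^ 2 * P.gamma y y + φ ^ (0 + 1) * (y * P.gamma φ y + y * P.gamma φ y) := by ring
    have e2 : y * y * (((0 : ℕ) + 1 : A) * φ ^ 0 * (1 - φ ^ 2) - ((n : A) - 1) * φ ^ (0 + 2)) =
      (1 - (n : A) * φ ^ 2) * (y * y) := by push_cast; ring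
    have e3 : φ * φ * y * P.lap y = φ ^ 2 * (y * P.lap y) := by ring
    rw [e1, map_add, e3] at h1
    rw [e2] at h2
    linarith
  simp only [hSi, ← map_sum, Finset.sum_sub_distrib, ← Finset.mul_sum] at hS
  rw [sum_height_D_sq α hα, sum_height_D_mul_lap α hα, ← hφ, ← hN, ← hG, ← hZ] at hS
  have hR1 := hpos (φ * N)
  have hR2 : 0 ≤ W (φ ^ 4 * G) := by
    rw [hG, gamma, Finset.mul_sum, map_sum]
    refine Finset.sum_nonneg fun j _ => le_of_le_of_eq (hpos (φ ^ 2 * P.D j z)) ?_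
    congr 1; ring
  -- the integrations by parts that reduce everything to undifferentiated products
  have a1 := hW.lap_mul_left (b := φ ^ 4 * Z) (T.mul_mem_left _ hZT) z
  have b1 := ibp 2 G hGT
  have c1 := ibp 2 (z * Z) (T.mul_mem_left _ hZT)
  have d1 := ibp 1 (z * N) (T.mul_mem_left _ hNT)
  have e1 := hW.lap_mul_left (b := φ ^ 3 * N) (T.mul_mem_left _ hNT) z
  have f1 := hW.lap_mul_left (b := φ ^ 2 * z) (T.mul_mem_left _ hzT) z
  have f2 := hW.lap_mul_left (b := φ ^ 4 * z) (T.mul_mem_left _ hzT) z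
  have g1 := ibp 0 (z * z) (T.mul_mem_left _ hzT)
  have v1 := hW.lap_mul_left hv v
  have hcomm : 2 * P.gamma z N = P.gamma φ G - 2 * φ * G := P.two_mul_gamma_gamma_height α z
  have hn : ∀ f : A, W ((n : A) * f) = n * W f := fun f => by
    rw [← nsmul_eq_mul, map_nsmul, nsmul_eq_mul]
  have h2 : ∀ f : A, W (2 * f) = 2 * W f := fun f => by
    rw [two_mul, map_add, two_mul]
  have key : P.lap v * P.lap v = ((1 - (n : A) * φ ^ 2) * (φ ^ 2 * G + 2 * φ * z * N + z ^ 2)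
      - φ ^ 2 * (φ ^ 2 * P.gamma z Z - 2 * φ ^ 2 * G + φ * P.gamma φ G + φ * N * Z
        + z * (φ * P.gamma φ Z - 2 * φ ^ 2 * Z - 2 * φ * N + 2 * P.gamma φ N + Z)))
      + (n : A) * (φ ^ 4 * G) + 2 * (φ * N * (φ * N))
      + (φ ^ 4 * Z * P.lap z + P.gamma (φ ^ 4 * Z) z)
      - (φ ^ (2 + 1) * P.gamma φ G
        + G * (((2 : ℕ) + 1 : A) * φ ^ 2 * (1 - φ ^ 2) - ((n : A) - 1) * φ ^ (2 + 2)))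
      + (φ ^ (2 + 1) * P.gamma φ (z * Z)
        + z * Z * (((2 : ℕ) + 1 : A) * φ ^ 2 * (1 - φ ^ 2) - ((n : A) - 1) * φ ^ (2 + 2)))
      + 2 * (φ ^ (1 + 1) * P.gamma φ (z * N)
        + z * N * (((1 : ℕ) + 1 : A) * φ ^ 1 * (1 - φ ^ 2) - ((n : A) - 1) * φ ^ (1 + 2)))
      + 2 * (2 * (φ ^ 3 * N * P.lap z + P.gamma (φ ^ 3 * N) z))
      + 2 * (φ ^ 2 * z * P.lap z + P.gamma (φ ^ 2 * z) z)
      - (n : A) * (φ ^ 4 * z * P.lap z + P.gamma (φ ^ 4 * z) z)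
      + (2 * (φ ^ (0 + 1) * P.gamma φ (z * z)
          + z * z * (((0 : ℕ) + 1 : A) * φ ^ 0 * (1 - φ ^ 2) - ((n : A) - 1) * φ ^ (0 + 2)))
        + (φ ^ (0 + 1) * P.gamma φ (z * z)
          + z * z * (((0 : ℕ) + 1 : A) * φ ^ 0 * (1 - φ ^ 2) - ((n : A) - 1) * φ ^ (0 + 2))))
      + 2 * (n : A) * P.gamma v v - 2 * ((n : A) * (v * P.lap v + P.gamma v v)) := by
    rw [hlapv, hvz]
    simp only [pow_succ, pow_zero, one_mul, gamma_mul_left, gamma_mul_right, ← hZ, ← hN, ← hG,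
      P.gamma_comm Z z, P.gamma_comm N z, zero_add, P.gamma_comm z φ]
    push_cast
    linear_combination (-2 * φ ^ 3) * hcomm
  have e2n : (2 : A) * n * P.gamma v v = 2 * (n * P.gamma v v) := by ring
  rw [key, e2n]
  simp only [map_add, map_sub, hn, h2] at hS a1 b1 c1 d1 e1 f1 f2 g1 v1 ⊢
  rw [a1, b1, c1, d1, e1, f1, f2, g1, v1]
  have hn0 : (0 : ℝ) ≤ n := n.cast_nonneg
  have := mul_nonneg hn0 hR2
  linarith

end PolarCalculus


/-! ### The polar quadratic form -/

namespace PolarCalculus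

variable {A : Type*} [CommRing A] [Algebra ℝ A] {n : ℕ} {P : PolarCalculus A n} {T : Ideal A}

lemma IsRadialWeight.linearComb {W W' : A →ₗ[ℝ] ℝ} (hW : P.IsRadialWeight T W)
    (hW' : P.IsRadialWeight T W') (a b : ℝ) : P.IsRadialWeight T (a • W + b • W') where
  D_eq F hF i := by
    simp only [LinearMap.add_apply, LinearMap.smul_apply, hW.D_eq F hF i, hW'.D_eq F hF i,
      smul_eq_mul]
    ring

/-- The integral inequality in polar coordinates. Here `W k` is integration against
`g⁽ᵏ⁾(t) dt dω`, so that `W 3 (E f)` picks up, besides the terms of the differential equation of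
`g`, the mean `Φ f` of `f` over the sphere on which `g'''` jumps; `L` is the Laplacian of
`e^{-2t} v`. After integration by parts the right-hand side becomes a sum of five terms, one for
each positivity hypothesis, and `½ Φ (v²)`. -/
theorem half_sphere_integral_le (hn : 0 < n) {W : Fin 4 → A →ₗ[ℝ] ℝ} {Φ : A → ℝ}
    (hTD : ∀ f ∈ T, ∀ i, P.D i f ∈ T) (hTE : ∀ f ∈ T, P.E f ∈ T)
    (hrad : ∀ k : Fin 4, k ≠ 3 → P.IsRadialWeight T (W k))
    (hE0 : ∀ f ∈ T, W 0 (P.E f) = W 1 f) (hE1 : ∀ f ∈ T, W 1 (P.E f) = W 2 f)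
    (hE2 : ∀ f ∈ T, W 2 (P.E f) = W 3 f)
    (hE3 : ∀ f ∈ T, W 3 (P.E f) =
      Φ f - 2 * n * W 3 f - ((n : ℝ) ^ 2 - 2) * W 2 f + 2 * n * W 1 f)
    {c : ℝ} (hc : c = ((n : ℝ) ^ 2 - 2) / (2 * n))
    (hpos_lap : ∀ f, 0 ≤ W 0 (f * f) - c / 2 * W 1 (f * f))
    (hpos_grad : ∀ f, 0 ≤ -(W 2 (f * f) + n * W 1 (f * f)))
    (hpos_grad' : ∀ f, 0 ≤ (n : ℝ) ^ 2 * W 0 (f * f) + c * W 1 (f * f))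
    (hpos_snd : ∀ f, 0 ≤ ((n : ℝ) ^ 2 - 1) * W 0 (f * f)
      + 3 * ((n : ℝ) ^ 2 - 2) / (4 * n) * W 1 (f * f))
    (hpos_fst : ∀ f, 0 ≤ -(c / 2) * W 3 (f * f) - ((n : ℝ) ^ 2 + 2) / 2 * W 2 (f * f)
      - (3 * n + ((n : ℝ) ^ 2 - 2) ^ 2 / (4 * n)) * W 1 (f * f))
    (α : Fin n → ℝ) (hα : ∑ i, α i ^ 2 = 1) {ψ : A} (hψ : P.height α * ψ = 1)
    {v : A} (hv : v ∈ T) {L : A}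
    (hL : L = P.E (P.E v) + ((n : ℝ) + 2) • P.E v + (2 * (n : ℝ)) • v + P.lap v) :
    1 / 2 * Φ (v * v) ≤
      W 0 (L * (L + (-2 * (n : ℝ)) • P.E v + (-2 * (n : ℝ)) • v))
      + W 1 (L * ((-2 : ℝ) • P.E v + ((n : ℝ) - 2) • v)) + W 2 (L * v)
      + c * (-(1 / 2) * W 1 (L * L)
        + W 0 (L * ((2 * (n : ℝ)) • P.E (P.E v) + (2 * (n : ℝ)) • P.E v))
        + W 1 (L * ((2 : ℝ) • P.E (P.E v) + (-((n : ℝ) - 2)) • P.E v)) - W 2 (L * P.E v)) := by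
  have hn0 : (n : ℝ) ≠ 0 := by positivity
  have r0 := hrad 0 (by decide)
  have r1 := hrad 1 (by decide)
  have r2 := hrad 2 (by decide)
  set v1 := P.E v with hv1
  set v2 := P.E v1 with hv2
  set d := P.lap v with hd
  set p := P.gamma v v with hp
  set q := P.gamma v1 v1 with hq
  have hv1T : v1 ∈ T := hTE v hv
  have hv2T : v2 ∈ T := hTE v1 hv1T
  have hpT : p ∈ T := T.sum_mem fun i _ => T.mul_mem_left _ (hTD v hv i)
  -- spectral inequalities on the half-sphere
  have P2 := ((r0.linearComb r1 1 (-(c / 2))).gamma_le_lap_sq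
    (fun f => by simpa [sub_eq_add_neg] using hpos_lap f) hTD α hα hv hψ)
  have P1 := (r2.linearComb r1 (-1) (-(n : ℝ))).mul_sq_le_gamma
    (fun f => by have := hpos_grad f; simp; linarith) α hv hψ
  have P1' := (r0.linearComb r1 ((n : ℝ) ^ 2) c).mul_sq_le_gamma
    (fun f => by simpa using hpos_grad' f) α hv1T hψ
  have N4 := hpos_snd v2
  have N5 := hpos_fst v1
  simp only [LinearMap.add_apply, LinearMap.smul_apply, smul_eq_mul, ← hd, ← hp, ← hq]
    at P2 P1 P1'
  -- derivatives along the rays of the quadratic quantities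
  have Ep : P.E p = (2 : ℝ) • P.gamma v1 v := by
    rw [hp, E_gamma, P.gamma_comm v, ← hv1, two_smul]
  have Egv1 : P.gamma v2 v = P.E (P.gamma v1 v) - q := by
    rw [E_gamma, ← hv2, ← hv1]; ring
  have hg1T : P.gamma v1 v ∈ T := T.sum_mem fun i _ => T.mul_mem_left _ (hTD v hv i)
  have Evv : P.E (v * v) = (2 : ℝ) • (v1 * v) := by
    rw [Derivation.leibniz, ← hv1, two_smul]; simp only [smul_eq_mul]; ring
  have Ev1v : P.E (v1 * v) = v2 * v + v1 * v1 := by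
    rw [Derivation.leibniz, ← hv1, ← hv2]; simp only [smul_eq_mul]; ring
  have Ev1v1 : P.E (v1 * v1) = (2 : ℝ) • (v2 * v1) := by
    rw [Derivation.leibniz, ← hv2, two_smul]; simp only [smul_eq_mul]; ring
  have hvvT : v * v ∈ T := T.mul_mem_left _ hv
  have hv1vT : v1 * v ∈ T := T.mul_mem_left _ hv
  have hv1v1T : v1 * v1 ∈ T := T.mul_mem_left _ hv1T
  have p0 := hE0 p hpT
  have p1 := hE1 p hpT
  have p2 := hE2 p hpT
  have g0 := hE0 _ hg1T
  have g1 := hE1 _ hg1T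
  have s0 := hE0 _ hvvT
  have s1 := hE1 _ hvvT
  have s2 := hE2 _ hvvT
  have s3 := hE3 _ hvvT
  have t0 := hE0 _ hv1vT
  have t1 := hE1 _ hv1vT
  have t2 := hE2 _ hv1vT
  have u0 := hE0 _ hv1v1T
  have u1 := hE1 _ hv1v1T
  have u2 := hE2 _ hv1v1T
  have a0 := r0.lap_mul_left hv v
  have a1 := r1.lap_mul_left hv v
  have a2 := r2.lap_mul_left hv v
  have b0 := r0.lap_mul_left hv1T v
  have b1 := r1.lap_mul_left hv1T v
  have b2 := r2.lap_mul_left hv1T v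
  have c0 := r0.lap_mul_left hv2T v
  have c1 := r1.lap_mul_left hv2T v
  rw [Egv1] at c0 c1
  simp only [Ep, Evv, Ev1v, Ev1v1, map_add, map_sub, map_smul, smul_eq_mul, ← hd, ← hp, ← hq]
    at p0 p1 p2 g0 g1 s0 s1 s2 s3 t0 t1 t2 u0 u1 u2 a0 a1 a2 b0 b1 b2 c0 c1
  rw [hL]
  simp only [mul_add, add_mul, smul_mul_assoc, mul_smul_comm, map_add, map_smul, smul_eq_mul,
    mul_comm d v, mul_comm d v1, mul_comm d v2, mul_comm v v1, mul_comm v v2, mul_comm v1 v2]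
  have hcn : c * n = ((n : ℝ) ^ 2 - 2) / 2 := by rw [hc]; field_simp
  have h34 : 3 * ((n : ℝ) ^ 2 - 2) / (4 * n) = 3 / 2 * c := by rw [hc]; field_simp; ring
  have h45 : ((n : ℝ) ^ 2 - 2) ^ 2 / (4 * n) = c * ((n : ℝ) ^ 2 - 2) / 2 := by
    rw [hc]; field_simp; ring
  rw [h34] at N4
  rw [h45] at N5
  clear_value v1 v2 d p q
  generalize P.gamma v1 v = g at *
  clear hc h34 h45 hpos_lap hpos_grad hpos_grad' hpos_snd hpos_fst hE0 hE1 hE2 hE3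
  have M : ∀ x : ℝ, c * n * x = ((n : ℝ) ^ 2 - 2) / 2 * x := fun x => by rw [hcn]
  have f1 : W 0 (v1 * v) = W 1 (v * v) / 2 := by linarith
  have f2 : W 1 (v1 * v) = W 2 (v * v) / 2 := by linarith
  have f3 : W 2 (v1 * v) = W 3 (v * v) / 2 := by linarith
  have f4 : W 0 (v2 * v) = W 2 (v * v) / 2 - W 0 (v1 * v1) := by linarith
  have f5 : W 1 (v2 * v) = W 3 (v * v) / 2 - W 1 (v1 * v1) := by linarith
  have f6 : W 2 (v2 * v) = W 3 (v1 * v) - W 2 (v1 * v1) := by linarith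
  have f6' : W 3 (v1 * v) = (Φ (v * v) - 2 * n * W 3 (v * v) - ((n : ℝ) ^ 2 - 2) * W 2 (v * v)
      + 2 * n * W 1 (v * v)) / 2 := by linarith
  have f7 : W 0 (v2 * v1) = W 1 (v1 * v1) / 2 := by linarith
  have f8 : W 1 (v2 * v1) = W 2 (v1 * v1) / 2 := by linarith
  have f9 : W 2 (v2 * v1) = W 3 (v1 * v1) / 2 := by linarith
  have k1 : W 0 (v1 * d) = - (W 1 p / 2) := by linarith
  have k2 : W 1 (v1 * d) = - (W 2 p / 2) := by linarith
  have k3 : W 2 (v1 * d) = - (W 3 p / 2) := by linarith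
  have k4 : W 0 (v2 * d) = - (W 2 p / 2) + W 0 q := by linarith
  have k5 : W 1 (v2 * d) = - (W 3 p / 2) + W 1 q := by linarith
  rw [f6'] at f6
  simp only [f1, f2, f3, f4, f5, f6, f7, f8, f9, k1, k2, k3, k4, k5, a0, a1, a2]
  clear f1 f2 f3 f4 f5 f6 f6' f7 f8 f9 k1 k2 k3 k4 k5 a0 a1 a2 b0 b1 b2 c0 c1 p0 p1 p2 g0 g1 s0 s1 s2
    s3 t0 t1 t2 u0 u1 u2
  linarith only [P2, P1, P1', N4, N5, M (W 0 (v1 * v1)), M (W 1 (v1 * v1)), M (W 2 (v1 * v1)),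
    M (W 1 p), M (W 0 q), M (W 1 q), M (W 0 (v2 * v2)), M (W 1 (v2 * v2)), M (W 2 (v * v)),
    M (W 3 (v * v)), M (W 1 (v * v)), M (n * W 0 (v1 * v1)), M (n * W 1 (v1 * v1)),
    M (n * W 2 (v1 * v1)), M (n * W 1 (v * v)), M (n * W 2 (v * v)), M (W 2 p), M (W 0 p)]

end PolarCalculus


/-! ### The Green function and its derivatives -/

/-- The positive root `a = (√(n² + 8) - n) / 2` of `λ² + n λ - 2`; the other root is `-(n + a)`. -/
noncomputable def greenRoot (n : ℕ) : ℝ := (√((n : ℝ) ^ 2 + 8) - n) / 2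

/-- The `k`-th derivative of the branch of `greenG` on `t < 0`. -/
noncomputable def greenNeg (n k : ℕ) (t : ℝ) : ℝ :=
  -(1 / (2 * n * √((n : ℝ) ^ 2 + 8))) *
    (n * greenRoot n ^ k * Real.exp (greenRoot n * t) - √((n : ℝ) ^ 2 + 8) * 0 ^ k)

/-- The `k`-th derivative of the branch of `greenG` on `0 ≤ t`. -/
noncomputable def greenPos (n k : ℕ) (t : ℝ) : ℝ :=
  -(1 / (2 * n * √((n : ℝ) ^ 2 + 8))) *
    (n * (-(n + greenRoot n)) ^ k * Real.exp (-(n + greenRoot n) * t)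
      - √((n : ℝ) ^ 2 + 8) * (-n) ^ k * Real.exp (-n * t))

/-- The `k`-th derivative of `greenG` away from `t = 0`. -/
noncomputable def greenDeriv (n k : ℕ) (t : ℝ) : ℝ :=
  if t < 0 then greenNeg n k t else greenPos n k t

lemma greenRoot_pos {n : ℕ} : 0 < greenRoot n := by
  have : (n : ℝ) < √((n : ℝ) ^ 2 + 8) := Real.lt_sqrt_of_sq_lt (by linarith)
  unfold greenRoot; linarith

lemma sqrt_eq_greenRoot (n : ℕ) : √((n : ℝ) ^ 2 + 8) = n + 2 * greenRoot n := by
  unfold greenRoot; ring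

lemma greenRoot_sq (n : ℕ) : greenRoot n ^ 2 = 2 - n * greenRoot n := by
  have h : √((n : ℝ) ^ 2 + 8) ^ 2 = (n : ℝ) ^ 2 + 8 := Real.sq_sqrt (by positivity)
  unfold greenRoot; nlinarith

lemma greenDeriv_zero (n : ℕ) : greenDeriv n 0 = greenG n := by
  funext t
  unfold greenDeriv greenG greenNeg greenPos
  have h1 : -(1 / 2) * ((n : ℝ) - √((n : ℝ) ^ 2 + 8)) * t = greenRoot n * t := by
    rw [sqrt_eq_greenRoot]; ring
  have h2 : -(1 / 2) * ((n : ℝ) + √((n : ℝ) ^ 2 + 8)) * t = -(n + greenRoot n) * t := by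
    rw [sqrt_eq_greenRoot]; ring
  rw [h1, h2]
  split_ifs <;> simp

lemma hasDerivAt_greenNeg (n k : ℕ) (t : ℝ) :
    HasDerivAt (greenNeg n k) (greenNeg n (k + 1) t) t := by
  have h := ((((hasDerivAt_id t).const_mul (greenRoot n)).exp.const_mul
    ((n : ℝ) * greenRoot n ^ k)).sub_const (√((n : ℝ) ^ 2 + 8) * 0 ^ k)).const_mul
      (-(1 / (2 * n * √((n : ℝ) ^ 2 + 8))))
  refine h.congr_deriv ?_
  simp only [greenNeg, id]
  ring

lemma hasDerivAt_greenPos (n k : ℕ) (t : ℝ) :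
    HasDerivAt (greenPos n k) (greenPos n (k + 1) t) t := by
  have h := ((((hasDerivAt_id t).const_mul (-((n : ℝ) + greenRoot n))).exp.const_mul
    ((n : ℝ) * (-(n + greenRoot n)) ^ k)).sub (((hasDerivAt_id t).const_mul (-(n : ℝ))).exp.const_mul
      (√((n : ℝ) ^ 2 + 8) * (-n) ^ k))).const_mul (-(1 / (2 * n * √((n : ℝ) ^ 2 + 8))))
  refine h.congr_deriv ?_
  simp only [greenPos, id]
  ring

lemma greenNeg_zero_eq {n k : ℕ} (hk : k < 3) : greenNeg n k 0 = greenPos n k 0 := by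
  have h := greenRoot_sq n
  unfold greenNeg greenPos
  rw [sqrt_eq_greenRoot]
  congr 1
  interval_cases k <;> simp
  · ring
  · linear_combination 0 * h

lemma greenPos_sub_greenNeg_three {n : ℕ} (hn : 0 < n) : greenPos n 3 0 - greenNeg n 3 0 = 1 := by
  have h := greenRoot_sq n
  have h0 : (0 : ℝ) < n := by positivity
  have h1 := greenRoot_pos (n := n)
  unfold greenNeg greenPos
  rw [sqrt_eq_greenRoot]
  have : (n : ℝ) + 2 * greenRoot n ≠ 0 := by positivity
  simp
  field_simp
  linear_combination (2 * greenRoot n + n) * h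

lemma greenNeg_four (n : ℕ) (t : ℝ) : greenNeg n 4 t =
    -2 * n * greenNeg n 3 t - ((n : ℝ) ^ 2 - 2) * greenNeg n 2 t + 2 * n * greenNeg n 1 t := by
  have h := greenRoot_sq n
  unfold greenNeg
  generalize √((n : ℝ) ^ 2 + 8) = s
  generalize greenRoot n = a at *
  linear_combination -(1 / (2 * n * s)) * n * Real.exp (a * t) * (a ^ 2 + n * a) * h

lemma greenPos_four (n : ℕ) (t : ℝ) : greenPos n 4 t =
    -2 * n * greenPos n 3 t - ((n : ℝ) ^ 2 - 2) * greenPos n 2 t + 2 * n * greenPos n 1 t := by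
  have h := greenRoot_sq n
  unfold greenPos
  generalize √((n : ℝ) ^ 2 + 8) = s
  generalize greenRoot n = a at *
  linear_combination -(1 / (2 * n * s)) * n * Real.exp (-(n + a) * t) * (a ^ 2 + n * a) * h

lemma greenDeriv_four (n : ℕ) (t : ℝ) : greenDeriv n 4 t =
    -2 * n * greenDeriv n 3 t - ((n : ℝ) ^ 2 - 2) * greenDeriv n 2 t
      + 2 * n * greenDeriv n 1 t := by
  unfold greenDeriv
  split_ifs
  exacts [greenNeg_four n t, greenPos_four n t]

/-- Explicit values of the derivatives of `greenG` at `t < 0`, with `X = e^{a t}`, and at `0 ≤ t`,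
with `X = e^{-(n + a) t}` and `Y = e^{-n t}`. -/
lemma greenDeriv_cases {n : ℕ} (hn : 0 < n) (t : ℝ) : ∃ κ > 0,
    (∃ X, 0 < X ∧ X ≤ 1 ∧ greenDeriv n 0 t = κ * (n + 2 * greenRoot n - n * X) ∧
      ∀ k ≠ 0, greenDeriv n k t = -κ * (n * greenRoot n ^ k * X)) ∨
    (∃ X Y, 0 < X ∧ X ≤ Y ∧ ∀ k, greenDeriv n k t =
      κ * ((n + 2 * greenRoot n) * (-n) ^ k * Y - n * (-(n + greenRoot n)) ^ k * X)) := by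
  have h1 := greenRoot_pos (n := n)
  refine ⟨1 / (2 * n * (n + 2 * greenRoot n)), by positivity, ?_⟩
  unfold greenDeriv
  rcases lt_or_ge t 0 with ht | ht
  · refine Or.inl ⟨Real.exp (greenRoot n * t), Real.exp_pos _, Real.exp_le_one_iff.2
      (mul_nonpos_of_nonneg_of_nonpos h1.le ht.le), ?_, fun k hk => ?_⟩ <;>
    simp only [ht, if_true, greenNeg, sqrt_eq_greenRoot]
    · ring
    · simp only [zero_pow hk]; ring
  · refine Or.inr ⟨Real.exp (-(n + greenRoot n) * t), Real.exp (-n * t), Real.exp_pos _,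
      Real.exp_le_exp.2 ?_, fun k => ?_⟩
    · nlinarith
    · simp only [ht.not_gt, if_false, greenPos, sqrt_eq_greenRoot]
      ring

section inequalities

variable {n : ℕ} (hn : 0 < n) (t : ℝ)

include hn in
lemma greenDeriv_zero_nonneg : 0 ≤ greenDeriv n 0 t := by
  have h1 := greenRoot_pos (n := n)
  obtain ⟨κ, hκ, ⟨X, hX, hX1, h0, -⟩ | ⟨X, Y, hX, hXY, h⟩⟩ := greenDeriv_cases hn t
  · rw [h0]
    refine mul_nonneg hκ.le ?_
    nlinarith [(Nat.cast_nonneg n : (0 : ℝ) ≤ n)]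
  · rw [h]
    refine mul_nonneg hκ.le ?_
    simp only [pow_zero]
    nlinarith [(Nat.cast_nonneg n : (0 : ℝ) ≤ n)]

include hn in
lemma greenDeriv_one_nonpos : greenDeriv n 1 t ≤ 0 := by
  have h1 := greenRoot_pos (n := n)
  have hn' : (0 : ℝ) ≤ n := n.cast_nonneg
  obtain ⟨κ, hκ, ⟨X, hX, hX1, -, h⟩ | ⟨X, Y, hX, hXY, h⟩⟩ := greenDeriv_cases hn t
  · rw [h 1 one_ne_zero, neg_mul, neg_nonpos]
    positivity
  · rw [h]
    refine mul_nonpos_of_nonneg_of_nonpos hκ.le ?_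
    have : 0 ≤ n * ((n + 2 * greenRoot n) * (Y - X) + greenRoot n * X) := by
      have := sub_nonneg.2 hXY; positivity
    linarith

include hn in
lemma greenDeriv_one_ge : -n * greenDeriv n 0 t ≤ greenDeriv n 1 t := by
  have h1 := greenRoot_pos (n := n)
  have hn' : (0 : ℝ) ≤ n := n.cast_nonneg
  obtain ⟨κ, hκ, ⟨X, hX, hX1, h0, h⟩ | ⟨X, Y, hX, hXY, h⟩⟩ := greenDeriv_cases hn t
  · rw [h0, h 1 one_ne_zero]
    have : 0 ≤ κ * n * ((n + 2 * greenRoot n) * (1 - X) + greenRoot n * X) := by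
      have := sub_nonneg.2 hX1; positivity
    linarith
  · rw [h, h]
    have : 0 ≤ κ * n * (greenRoot n * X) := by positivity
    linarith

include hn in
lemma greenDeriv_two_add_nonpos : greenDeriv n 2 t + n * greenDeriv n 1 t ≤ 0 := by
  have h1 := greenRoot_pos (n := n)
  have hn' : (0 : ℝ) ≤ n := n.cast_nonneg
  obtain ⟨κ, hκ, ⟨X, hX, hX1, h0, h⟩ | ⟨X, Y, hX, hXY, h⟩⟩ := greenDeriv_cases hn t
  · rw [h 1 one_ne_zero, h 2 two_ne_zero]
    have : 0 ≤ κ * n * greenRoot n * (n + greenRoot n) * X := by positivity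
    linarith
  · rw [h, h]
    have : 0 ≤ κ * n * greenRoot n * (n + greenRoot n) * X := by positivity
    linarith

/-- The weight of `(∂ₜ v)²` in the polar form of the inequality is nonnegative. -/
lemma greenDeriv_three_combination (hn : 2 ≤ n) :
    ((n : ℝ) ^ 2 - 2) * greenDeriv n 3 t + 2 * n * ((n : ℝ) ^ 2 + 2) * greenDeriv n 2 t
      + (12 * (n : ℝ) ^ 2 + ((n : ℝ) ^ 2 - 2) ^ 2) * greenDeriv n 1 t ≤ 0 := by
  have h1 := greenRoot_pos (n := n)
  have h2 := greenRoot_sq n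
  have hn' : (2 : ℝ) ≤ n := by exact_mod_cast hn
  have hn2 : 0 ≤ (n : ℝ) ^ 2 - 2 := by nlinarith
  obtain ⟨κ, hκ, ⟨X, hX, hX1, h0, h⟩ | ⟨X, Y, hX, hXY, h⟩⟩ := greenDeriv_cases (n := n) (by omega) t
  · rw [h 1 one_ne_zero, h 2 two_ne_zero, h 3 three_ne_zero]
    have : 0 ≤ κ * n * greenRoot n * X * (((n : ℝ) ^ 2 - 2) * greenRoot n ^ 2
      + 2 * n * ((n : ℝ) ^ 2 + 2) * greenRoot n + (12 * (n : ℝ) ^ 2 + ((n : ℝ) ^ 2 - 2) ^ 2)) := by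
      positivity
    linarith
  · rw [h, h, h]
    generalize greenRoot n = a at *
    have h3 : a ^ 3 = (n ^ 2 + 2) * a - 2 * n := by linear_combination (a - n) * h2
    have : 0 ≤ κ * n * ((n + 2 * a) * (2 * (n : ℝ) ^ 2 + 4) * (Y - X) + (16 * n + 8 * a) * X) := by
      have := sub_nonneg.2 hXY; positivity
    refine le_of_eq_of_le ?_ (neg_nonpos.2 this)
    ring_nf
    simp only [h3, h2]
    ring

end inequalities

lemma continuous_ite_of_eq {f g : ℝ → ℝ} (hf : Continuous f) (hg : Continuous g) (h : f 0 = g 0) :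
    Continuous fun t => if t < 0 then f t else g t := by
  have : (fun t => if t < 0 then f t else g t) = fun t => if 0 ≤ t then g t else f t := by
    funext t; by_cases ht : t < 0 <;> simp [ht, not_le.2, not_lt.1]
  rw [this]
  refine hg.if_le hf continuous_const continuous_id ?_
  rintro x hx; rw [← hx, h]

lemma continuous_greenNeg (n k : ℕ) : Continuous (greenNeg n k) :=
  continuous_iff_continuousAt.2 fun t => (hasDerivAt_greenNeg n k t).continuousAt

lemma continuous_greenPos (n k : ℕ) : Continuous (greenPos n k) :=
  continuous_iff_continuousAt.2 fun t => (hasDerivAt_greenPos n k t).continuousAt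

lemma continuous_greenDeriv {n k : ℕ} (hk : k < 3) : Continuous (greenDeriv n k) :=
  continuous_ite_of_eq (continuous_greenNeg n k) (continuous_greenPos n k)
    (greenNeg_zero_eq hk)

lemma measurable_greenDeriv (n k : ℕ) : Measurable (greenDeriv n k) :=
  Measurable.ite measurableSet_Iio (continuous_greenNeg n k).measurable
    (continuous_greenPos n k).measurable

lemma hasDerivAt_greenDeriv_of_ne {n k : ℕ} {t : ℝ} (ht : t ≠ 0) :
    HasDerivAt (greenDeriv n k) (greenDeriv n (k + 1) t) t := by
  rcases lt_or_gt_of_ne ht with h | h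
  · have e : greenDeriv n (k + 1) t = greenNeg n (k + 1) t := if_pos h
    rw [e]
    refine (hasDerivAt_greenNeg n k t).congr_of_eventuallyEq ?_
    filter_upwards [Iio_mem_nhds h] with x hx using if_pos hx
  · have e : greenDeriv n (k + 1) t = greenPos n (k + 1) t := if_neg h.not_gt
    rw [e]
    refine (hasDerivAt_greenPos n k t).congr_of_eventuallyEq ?_
    filter_upwards [Ioi_mem_nhds h] with x hx using if_neg (not_lt.2 (le_of_lt hx))

lemma hasDerivAt_greenDeriv {n k : ℕ} (hk : k < 2) (t : ℝ) :
    HasDerivAt (greenDeriv n k) (greenDeriv n (k + 1) t) t := by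
  rcases eq_or_ne t 0 with rfl | ht
  · exact hasDerivAt_of_hasDerivAt_of_ne (fun y hy => hasDerivAt_greenDeriv_of_ne hy)
      (continuous_greenDeriv (by omega)).continuousAt
      (continuous_greenDeriv (by omega)).continuousAt
  · exact hasDerivAt_greenDeriv_of_ne ht


/-! ### Polar calculus from Cartesian coordinates -/

namespace PolarCalculus

variable {A : Type*} [CommRing A] [Algebra ℝ A] {n : ℕ}

/-- Commuting derivations `∂ᵢ` with coordinate functions `xᵢ`, and an invertible `r = |x|`. -/
structure CartesianData (A : Type*) [CommRing A] [Algebra ℝ A] (n : ℕ) where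
  d : Fin n → Derivation ℝ A A
  x : Fin n → A
  r : A
  rinv : A
  d_comm : ∀ i j f, d i (d j f) = d j (d i f)
  d_x : ∀ i j, d i (x j) = if i = j then 1 else 0
  r_sq : r * r = ∑ i, x i * x i
  r_mul_rinv : r * rinv = 1

namespace CartesianData

variable (C : CartesianData A n)

/-- The Euler derivation `x · ∇`. -/
def euler : Derivation ℝ A A := ∑ i, C.x i • C.d i

lemma euler_apply (f : A) : C.euler f = ∑ i, C.x i * C.d i f := by
  have h := congrFun (map_sum (Derivation.coeFnAddMonoidHom (R := ℝ) (A := A) (M := A))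
    (fun i => C.x i • C.d i) Finset.univ) f
  rw [Finset.sum_apply] at h
  exact h

lemma d_r (i : Fin n) : C.d i C.r = C.rinv * C.x i := by
  have h := congrArg (C.d i) C.r_sq
  simp only [map_sum, Derivation.leibniz, smul_eq_mul, C.d_x, mul_ite, mul_one,
    mul_zero, Finset.sum_ite_eq, Finset.mem_univ, if_true, ← two_mul] at h
  have h2 : (2 : A) * (C.r * C.d i C.r - C.x i) = 0 := by linear_combination h
  have h3 : C.r * C.d i C.r - C.x i = 0 := by
    have := congrArg (fun y => (1 / 2 : ℝ) • y) h2
    simp only [smul_zero] at this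
    rw [← this, ← map_ofNat (algebraMap ℝ A) 2, ← Algebra.smul_def, smul_smul]
    norm_num
  linear_combination C.rinv * h3 - C.d i C.r * C.r_mul_rinv

lemma d_rinv (i : Fin n) : C.d i C.rinv = -(C.rinv * C.rinv * (C.rinv * C.x i)) := by
  have h := congrArg (C.d i) C.r_mul_rinv
  simp only [Derivation.leibniz, smul_eq_mul, C.d_r, Derivation.map_one_eq_zero] at h
  linear_combination C.rinv * h - C.d i C.rinv * C.r_mul_rinv

lemma sum_rinv_x_sq : ∑ i, C.rinv * C.x i * (C.rinv * C.x i) = 1 := by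
  have : ∑ i, C.rinv * C.x i * (C.rinv * C.x i) = C.rinv * C.rinv * ∑ i, C.x i * C.x i := by
    rw [Finset.mul_sum]; exact Finset.sum_congr rfl fun i _ => by ring
  rw [this, ← C.r_sq]
  linear_combination (C.r * C.rinv + 1) * C.r_mul_rinv

lemma euler_x (j : Fin n) : C.euler (C.x j) = C.x j := by
  simp [euler_apply, C.d_x]

lemma euler_r : C.euler C.r = C.r := by
  rw [euler_apply]
  have : ∑ i, C.x i * C.d i C.r = C.rinv * ∑ i, C.x i * C.x i := by
    rw [Finset.mul_sum]; exact Finset.sum_congr rfl fun i _ => by rw [C.d_r]; ring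
  rw [this, ← C.r_sq]
  linear_combination C.r * C.r_mul_rinv

lemma euler_rinv : C.euler C.rinv = -C.rinv := by
  have h := congrArg C.euler C.r_mul_rinv
  simp only [Derivation.leibniz, smul_eq_mul, C.euler_r, Derivation.map_one_eq_zero] at h
  linear_combination C.rinv * h - (C.euler C.rinv + C.rinv) * C.r_mul_rinv

lemma euler_d (i : Fin n) (f : A) : C.euler (C.d i f) = C.d i (C.euler f) - C.d i f := by
  simp only [euler_apply, map_sum, Derivation.leibniz, smul_eq_mul, C.d_x, Finset.sum_add_distrib,
    mul_ite, mul_one, mul_zero, Finset.sum_ite_eq, Finset.mem_univ, if_true, add_sub_cancel_right]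
  exact Finset.sum_congr rfl fun j _ => by rw [C.d_comm]

/-- The tangential derivative `r ∂ᵢ - (xᵢ / r) x · ∇`. -/
def tangential (i : Fin n) : Derivation ℝ A A :=
  C.r • C.d i - (C.rinv * C.x i) • C.euler

lemma tangential_apply (i : Fin n) (f : A) :
    C.tangential i f = C.r * C.d i f - C.rinv * C.x i * C.euler f := rfl

lemma euler_rinv_mul_x (i : Fin n) : C.euler (C.rinv * C.x i) = 0 := by
  simp only [Derivation.leibniz, smul_eq_mul, C.euler_x, C.euler_rinv]; ring

lemma tangential_rinv_mul_x (i j : Fin n) : C.tangential i (C.rinv * C.x j) =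
    (if i = j then 1 else 0) - C.rinv * C.x i * (C.rinv * C.x j) := by
  rw [tangential_apply, C.euler_rinv_mul_x]
  simp only [Derivation.leibniz, smul_eq_mul, C.d_x, C.d_rinv]
  linear_combination
    (-(C.rinv * C.x i * (C.rinv * C.x j)) + (if i = j then 1 else 0)) * C.r_mul_rinv

lemma tangential_tangential (i j : Fin n) (f : A) :
    C.tangential i (C.tangential j f) =
      C.r * C.r * C.d i (C.d j f)
      - ((if i = j then 1 else 0) - C.rinv * C.x i * (C.rinv * C.x j)) * C.euler f
      - C.x j * C.d i (C.euler f) - C.x i * C.d j (C.euler f) + C.x i * C.d j f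
      + C.rinv * C.x i * (C.rinv * C.x j) * C.euler (C.euler f) := by
  rw [C.tangential_apply j, map_sub, Derivation.leibniz, Derivation.leibniz,
    C.tangential_rinv_mul_x]
  simp only [tangential_apply, smul_eq_mul, C.euler_r, C.d_r, C.euler_d]
  linear_combination (-(C.x j * C.d i (C.euler f)) - C.x i * C.d j (C.euler f)
    + C.x i * C.d j f) * C.r_mul_rinv

/-- Polar coordinates from Cartesian ones. -/
def toPolar : PolarCalculus A n where
  D := C.tangential
  E := C.euler
  ω i := C.rinv * C.x i
  sum_ω_sq := C.sum_rinv_x_sq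
  D_ω := C.tangential_rinv_mul_x
  E_ω := C.euler_rinv_mul_x
  sum_ω_D f := by
    simp only [tangential_apply, mul_sub, Finset.sum_sub_distrib, ← mul_assoc, ← Finset.sum_mul]
    rw [show ∑ i, C.rinv * C.x i * C.rinv * C.x i = 1 by
      rw [← C.sum_rinv_x_sq]; exact Finset.sum_congr rfl fun i _ => by ring]
    rw [one_mul, sub_eq_zero, euler_apply]
    exact Finset.sum_congr rfl fun i _ => by linear_combination C.x i * C.d i f * C.r_mul_rinv
  D_comm i j f := by
    rw [tangential_tangential, tangential_tangential, tangential_apply, tangential_apply, C.d_comm]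
    simp only [eq_comm (a := j)]
    linear_combination (C.x j * C.d i f - C.x i * C.d j f) * C.r_mul_rinv
  E_comm i f := by
    rw [tangential_apply, tangential_apply, map_sub, Derivation.leibniz, Derivation.leibniz,
      C.euler_rinv_mul_x, C.euler_r, C.euler_d]
    simp only [smul_eq_mul]
    ring

/-- The Laplacian in polar coordinates. -/
lemma sum_d_d (f : A) : C.r * C.r * ∑ i, C.d i (C.d i f) =
    C.euler (C.euler f) + ((n : A) - 2) * C.euler f + C.toPolar.lap f := by
  have h : C.toPolar.lap f = ∑ i, C.tangential i (C.tangential i f) := rfl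
  have h1 : ∀ i, C.tangential i (C.tangential i f) =
      C.r * C.r * C.d i (C.d i f) - C.euler f
      + C.rinv * C.x i * (C.rinv * C.x i) * (C.euler f + C.euler (C.euler f))
      - 2 * (C.x i * C.d i (C.euler f)) + C.x i * C.d i f := by
    intro i; rw [C.tangential_tangential, if_pos rfl]; ring
  simp only [h, h1, Finset.sum_add_distrib, Finset.sum_sub_distrib, ← Finset.sum_mul,
    ← Finset.mul_sum, C.sum_rinv_x_sq, ← euler_apply]
  simp only [Finset.sum_const, Finset.card_univ, Fintype.card_fin, nsmul_eq_mul]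
  ring

/-- The Laplacian of `r² v` in polar coordinates. -/
lemma sum_d_d_sq_mul (v : A) : ∑ i, C.d i (C.d i (C.r * C.r * v)) =
    C.euler (C.euler v) + ((n : ℝ) + 2) • C.euler v + (2 * (n : ℝ)) • v + C.toPolar.lap v := by
  have h0 : ∀ i, C.toPolar.D i C.r = 0 := fun i => by
    change C.tangential i C.r = 0
    rw [tangential_apply, C.d_r, C.euler_r]; ring
  have h1 : C.toPolar.lap (C.r * C.r * v) = C.r * C.r * C.toPolar.lap v := by
    simp only [lap, Derivation.leibniz, smul_eq_mul, h0, mul_zero, add_zero, Finset.mul_sum]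
  have h := C.sum_d_d (C.r * C.r * v)
  rw [h1] at h
  generalize ∑ i, C.d i (C.d i (C.r * C.r * v)) = S at *
  simp only [Derivation.leibniz, smul_eq_mul, C.euler_r, map_add] at h
  simp only [Algebra.smul_def, map_add, map_mul, map_natCast, map_ofNat]
  have h2 : C.rinv * C.rinv * (C.r * C.r) = 1 := by
    linear_combination (C.r * C.rinv + 1) * C.r_mul_rinv
  linear_combination C.rinv * C.rinv * h - (S - (C.euler (C.euler v) + ((n : A) + 2) * C.euler v + (2 * (n : A)) * v + C.toPolar.lap v)) * h2

end CartesianData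

end PolarCalculus


/-! ### Smooth functions on an open set -/

section

open scoped ContDiff Topology

section SmoothFunctions

section

variable {V : Type*} {H : Set V}

/-- Extension of a function on `H` by zero. -/
noncomputable def zeroExtend (f : H → ℝ) : V → ℝ := Function.extend Subtype.val f 0

lemma zeroExtend_apply (f : H → ℝ) {x : V} (hx : x ∈ H) : zeroExtend f x = f ⟨x, hx⟩ :=
  Subtype.val_injective.extend_apply f 0 ⟨x, hx⟩

lemma zeroExtend_of_notMem (f : H → ℝ) {x : V} (hx : x ∉ H) : zeroExtend f x = 0 :=
  Function.extend_apply' (f := Subtype.val) f 0 x (by rintro ⟨y, rfl⟩; exact hx y.2)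

end

variable {V : Type*} [NormedAddCommGroup V] [NormedSpace ℝ V] {H : Set V}

/-- The algebra of smooth real functions on an open set `H`, as functions on the subtype. -/
noncomputable def smoothFunctions (H : Set V) : Subalgebra ℝ (H → ℝ) where
  carrier := {f | ContDiffOn ℝ ∞ (zeroExtend f) H}
  mul_mem' {f g} hf hg := (ContDiffOn.mul hf hg).congr fun x hx => by
    simp [zeroExtend_apply _ hx]
  add_mem' {f g} hf hg := (ContDiffOn.add hf hg).congr fun x hx => by
    simp [zeroExtend_apply _ hx]
  algebraMap_mem' c := (contDiffOn_const (c := c)).congr fun x hx => by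
    simp [zeroExtend_apply _ hx]

namespace smoothFunctions

/-- The underlying function, extended by zero. -/
noncomputable def toFun (f : smoothFunctions H) : V → ℝ := zeroExtend f.1

lemma contDiffOn (f : smoothFunctions H) : ContDiffOn ℝ ∞ (toFun f) H := f.2

lemma ext_toFun {f g : smoothFunctions H} (h : ∀ x ∈ H, (toFun f) x = (toFun g) x) : f = g := by
  ext ⟨x, hx⟩
  have := h x hx
  simpa only [toFun, zeroExtend_apply _ hx] using this

/-- The restriction to `H` of a function that is smooth there. -/
noncomputable def ofFun (F : V → ℝ) (hF : ContDiffOn ℝ ∞ F H) : smoothFunctions H :=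
  ⟨fun x => F x, hF.congr fun x hx => by simp [zeroExtend_apply _ hx]⟩

lemma toFun_ofFun (F : V → ℝ) (hF : ContDiffOn ℝ ∞ F H) {x : V} (hx : x ∈ H) :
    (toFun (ofFun F hF)) x = F x := by
  simp [toFun, ofFun, zeroExtend_apply _ hx]

lemma toFun_add (f g : smoothFunctions H) : (toFun (f + g)) = (toFun f) + (toFun g) := by
  funext x
  by_cases hx : x ∈ H
  · simp [toFun, zeroExtend_apply _ hx]
  · simp [toFun, zeroExtend_of_notMem _ hx]

lemma toFun_sub (f g : smoothFunctions H) : (toFun (f - g)) = (toFun f) - (toFun g) := by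
  funext x
  by_cases hx : x ∈ H
  · simp [toFun, zeroExtend_apply _ hx]
  · simp [toFun, zeroExtend_of_notMem _ hx]

lemma toFun_mul (f g : smoothFunctions H) : (toFun (f * g)) = (toFun f) * (toFun g) := by
  funext x
  by_cases hx : x ∈ H
  · simp [toFun, zeroExtend_apply _ hx]
  · simp [toFun, zeroExtend_of_notMem _ hx]

lemma toFun_smul (c : ℝ) (f : smoothFunctions H) : (toFun (c • f)) = c • (toFun f) := by
  funext x
  by_cases hx : x ∈ H
  · simp [toFun, zeroExtend_apply _ hx]
  · simp [toFun, zeroExtend_of_notMem _ hx]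

lemma toFun_zero : (toFun (0 : smoothFunctions H)) = 0 := by
  simpa using toFun_smul 0 (0 : smoothFunctions H)

lemma toFun_sum {ι : Type*} (s : Finset ι) (f : ι → smoothFunctions H) :
    (toFun (∑ i ∈ s, f i)) = ∑ i ∈ s, (toFun (f i)) := by
  classical
  induction s using Finset.induction_on with
  | empty => simp [toFun_zero]
  | insert i s hi ih => rw [Finset.sum_insert hi, Finset.sum_insert hi, toFun_add, ih]

lemma toFun_one {x : V} (hx : x ∈ H) : (toFun (1 : smoothFunctions H)) x = 1 := by
  simp [toFun, zeroExtend_apply _ hx]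

lemma contDiffAt (hH : IsOpen H) (f : smoothFunctions H) {x : V} (hx : x ∈ H) :
    ContDiffAt ℝ ∞ (toFun f) x :=
  (contDiffOn f).contDiffAt (hH.mem_nhds hx)

lemma differentiableAt (hH : IsOpen H) (f : smoothFunctions H) {x : V} (hx : x ∈ H) :
    DifferentiableAt ℝ (toFun f) x :=
  (contDiffAt hH f hx).differentiableAt (by simp)

/-- The derivative in the direction of a fixed vector. -/
noncomputable def dirDeriv (hH : IsOpen H) (e : V) :
    Derivation ℝ (smoothFunctions H) (smoothFunctions H) :=
  Derivation.mk'
    { toFun := fun f => ofFun (fun x => fderiv ℝ (toFun f) x e)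
        (((contDiffOn f).fderiv_of_isOpen hH (by simp)).clm_apply contDiffOn_const)
      map_add' := fun f g => ext_toFun fun x hx => by
        rw [toFun_ofFun _ _ hx, toFun_add, toFun_add, Pi.add_apply, toFun_ofFun _ _ hx,
          toFun_ofFun _ _ hx, fderiv_add (differentiableAt hH f hx) (differentiableAt hH g hx)]
        rfl
      map_smul' := fun c f => ext_toFun fun x hx => by
        rw [toFun_ofFun _ _ hx, toFun_smul, RingHom.id_apply, toFun_smul, Pi.smul_apply,
          toFun_ofFun _ _ hx, fderiv_const_smul (differentiableAt hH f hx)]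
        rfl }
    fun f g => ext_toFun fun x hx => by
      change (toFun (ofFun _ _)) x = _
      rw [toFun_ofFun _ _ hx, toFun_mul, toFun_add, Pi.add_apply, smul_eq_mul, smul_eq_mul,
        toFun_mul, toFun_mul, Pi.mul_apply, Pi.mul_apply]
      change _ = (toFun f) x * (toFun (ofFun _ _)) x + (toFun g) x * (toFun (ofFun _ _)) x
      rw [toFun_ofFun _ _ hx, toFun_ofFun _ _ hx,
        fderiv_mul (differentiableAt hH f hx) (differentiableAt hH g hx)]
      rfl

lemma toFun_dirDeriv (hH : IsOpen H) (e : V) (f : smoothFunctions H) {x : V} (hx : x ∈ H) :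
    (toFun (dirDeriv hH e f)) x = fderiv ℝ (toFun f) x e :=
  toFun_ofFun _ _ hx

lemma fderiv_toFun_ofFun (hH : IsOpen H) (F : V → ℝ) (hF : ContDiffOn ℝ ∞ F H) {x : V}
    (hx : x ∈ H) : fderiv ℝ (toFun (ofFun F hF)) x = fderiv ℝ F x :=
  Filter.EventuallyEq.fderiv_eq <| by
    filter_upwards [hH.mem_nhds hx] with y hy using toFun_ofFun _ _ hy

lemma dirDeriv_comm (hH : IsOpen H) (e e' : V) (f : smoothFunctions H) :
    dirDeriv hH e (dirDeriv hH e' f) = dirDeriv hH e' (dirDeriv hH e f) := by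
  refine ext_toFun fun x hx => ?_
  have key : ∀ a b : V, (toFun (dirDeriv hH a (dirDeriv hH b f))) x =
      fderiv ℝ (fderiv ℝ (toFun f)) x a b := by
    intro a b
    rw [toFun_dirDeriv hH _ _ hx]
    have h1 : (toFun (dirDeriv hH b f)) =ᶠ[𝓝 x] fun y => fderiv ℝ (toFun f) y b := by
      filter_upwards [hH.mem_nhds hx] with y hy using toFun_dirDeriv hH b f hy
    rw [h1.fderiv_eq, fderiv_clm_apply _ (differentiableAt_const b)]
    · simp
    · exact ((contDiffAt hH f hx).fderiv_right (m := 1) (by norm_cast)).differentiableAt one_ne_zero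
  rw [key, key]
  exact ((contDiffAt hH f hx).isSymmSndFDerivAt
    (by rw [minSmoothness_of_isRCLikeNormedField]; exact ENat.LEInfty.out)) e e'

/-- The ideal of the functions that vanish outside `C`. -/
noncomputable def supportedIn (C : Set V) : Ideal (smoothFunctions H) where
  carrier := {f | ∀ x ∉ C, (toFun f) x = 0}
  add_mem' {f g} hf hg x hx := by rw [toFun_add, Pi.add_apply, hf x hx, hg x hx, add_zero]
  zero_mem' x _ := by rw [toFun_zero]; rfl
  smul_mem' f g hg x hx := by
    rw [smul_eq_mul, toFun_mul, Pi.mul_apply, hg x hx, mul_zero]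

lemma dirDeriv_mem_supportedIn (hH : IsOpen H) {C : Set V} (hC : IsClosed C) (e : V)
    {f : smoothFunctions H} (hf : f ∈ supportedIn C) : dirDeriv hH e f ∈ supportedIn C := by
  intro x hx
  by_cases hxH : x ∈ H
  · rw [toFun_dirDeriv hH e f hxH]
    have : (toFun f) =ᶠ[𝓝 x] fun _ => 0 := by
      filter_upwards [hC.isOpen_compl.mem_nhds hx] with y hy using hf y hy
    rw [this.fderiv_eq]; simp
  · exact zeroExtend_of_notMem _ hxH

lemma contDiff_of_mem_supportedIn (hH : IsOpen H) {C : Set V} (hC : IsClosed C) (hCH : C ⊆ H)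
    {f : smoothFunctions H} (hf : f ∈ supportedIn C) : ContDiff ℝ ∞ (toFun f) := by
  rw [contDiff_iff_contDiffAt]
  intro x
  by_cases hx : x ∈ C
  · exact contDiffAt hH f (hCH hx)
  · refine (contDiffAt_const (c := (0 : ℝ))).congr_of_eventuallyEq ?_
    filter_upwards [hC.isOpen_compl.mem_nhds hx] with y hy using hf y hy

end smoothFunctions

end SmoothFunctions

section Cartesian

variable {n : ℕ} {H : Set (RSpace n)}

open smoothFunctions PolarCalculus

lemma contDiffOn_norm_of_zero_notMem (h0 : (0 : RSpace n) ∉ H) :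
    ContDiffOn ℝ ∞ (fun x : RSpace n => ‖x‖) H := fun _ hx =>
  (contDiffAt_norm ℝ (by rintro rfl; exact h0 hx)).contDiffWithinAt

lemma sum_apply_single_mul (L : RSpace n →L[ℝ] ℝ) (x : RSpace n) :
    ∑ i, x i * L (EuclideanSpace.single i 1) = L x := by
  conv_rhs => rw [← (EuclideanSpace.basisFun (Fin n) ℝ).sum_repr x]
  simp [map_sum]

/-- The standard coordinates on an open subset of `ℝⁿ ∖ {0}`. -/
noncomputable def cartesianData (hH : IsOpen H) (h0 : (0 : RSpace n) ∉ H) :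
    CartesianData (smoothFunctions H) n where
  d i := dirDeriv hH (EuclideanSpace.single i 1)
  x i := ofFun (fun x => x i) (by fun_prop)
  r := ofFun (fun x => ‖x‖) (contDiffOn_norm_of_zero_notMem h0)
  rinv := ofFun (fun x => ‖x‖⁻¹) ((contDiffOn_norm_of_zero_notMem h0).inv
    fun _ hx => norm_ne_zero_iff.2 (by rintro rfl; exact h0 hx))
  d_comm i j f := dirDeriv_comm hH _ _ f
  d_x i j := ext_toFun fun x hx => by
    rw [toFun_dirDeriv hH _ _ hx, fderiv_toFun_ofFun hH _ _ hx]
    have : (fun x : RSpace n => x j) = EuclideanSpace.proj (𝕜 := ℝ) j := rfl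
    rw [this, ContinuousLinearMap.fderiv]
    split_ifs with h
    · rw [toFun_one hx]; simp [h]
    · rw [toFun_zero]; simp [Ne.symm h]
  r_sq := ext_toFun fun x hx => by
    simp only [toFun_mul, toFun_sum, Finset.sum_apply, Pi.mul_apply, toFun_ofFun _ _ hx]
    rw [← pow_two, EuclideanSpace.real_norm_sq_eq]
    simp [pow_two]
  r_mul_rinv := ext_toFun fun x hx => by
    rw [toFun_mul, Pi.mul_apply, toFun_ofFun _ _ hx, toFun_ofFun _ _ hx, toFun_one hx]
    exact mul_inv_cancel₀ (norm_ne_zero_iff.2 (by rintro rfl; exact h0 hx))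

lemma toFun_euler (hH : IsOpen H) (h0 : (0 : RSpace n) ∉ H) (f : smoothFunctions H) {x : RSpace n}
    (hx : x ∈ H) : (toFun ((cartesianData hH h0).euler f)) x = fderiv ℝ (toFun f) x x := by
  rw [CartesianData.euler_apply, toFun_sum, Finset.sum_apply]
  rw [← sum_apply_single_mul]
  refine Finset.sum_congr rfl fun i _ => ?_
  rw [toFun_mul, Pi.mul_apply,
    show (toFun ((cartesianData hH h0).d i f)) x = _ from toFun_dirDeriv hH _ _ hx,
    show (toFun ((cartesianData hH h0).x i)) x = x i from toFun_ofFun _ _ hx]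

end Cartesian

end


/-! ### Integration by parts -/

section

open scoped ContDiff Topology

section DirectionalDerivative

variable {V : Type*} [NormedAddCommGroup V] [NormedSpace ℝ V] [FiniteDimensional ℝ V]
  [MeasurableSpace V] [BorelSpace V] {μ : Measure V} [μ.IsAddHaarMeasure]

lemma integral_fderiv_apply_eq_zero {G : V → ℝ} (hG : ContDiff ℝ 1 G) (hc : HasCompactSupport G)
    (e : V) : ∫ x, fderiv ℝ G x e ∂μ = 0 := by
  have hcont : Continuous fun x => fderiv ℝ G x e :=
    (hG.continuous_fderiv one_ne_zero).clm_apply continuous_const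
  have hcs : HasCompactSupport fun x => fderiv ℝ G x e :=
    (hc.fderiv ℝ).comp_left (g := fun L : V →L[ℝ] ℝ => L e) rfl
  have h := integral_mul_fderiv_eq_neg_fderiv_mul_of_integrable (μ := μ) (𝕜 := ℝ)
    (f := fun _ : V => (1 : ℝ)) (g := G) (v := e) (by simp)
    (by simpa using hcont.integrable_of_hasCompactSupport hcs)
    (by simpa using hG.continuous.integrable_of_hasCompactSupport hc)
    (fun x _ => differentiableAt_const _) (fun x _ => hG.differentiable one_ne_zero x)
  simpa using h

end DirectionalDerivative

section Rotation

variable {n : ℕ}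

/-- The rotation field in the plane of `a` and `b` is divergence free and tangent to spheres. -/
lemma integral_rotation_eq_zero {σ : ℝ → ℝ} {C : Set (RSpace n)} (hσ : ContinuousOn σ (Set.Ioi 0))
    (hC : IsCompact C) (h0 : (0 : RSpace n) ∉ C) {G : RSpace n → ℝ} (hG : ContDiff ℝ 1 G)
    (hGC : ∀ x ∉ C, G x = 0) (a b : RSpace n) :
    ∫ x, σ ‖x‖ * (inner ℝ x a * fderiv ℝ G x b - inner ℝ x b * fderiv ℝ G x a) = 0 := by
  have hcs : HasCompactSupport G := HasCompactSupport.intro hC hGC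
  -- the case of a weight that is a smooth function on the whole space
  have smooth : ∀ P : Polynomial ℝ, ∫ x, P.eval (‖x‖ ^ 2) *
      (inner ℝ x a * fderiv ℝ G x b - inner ℝ x b * fderiv ℝ G x a) = 0 := by
    intro P
    set K : RSpace n → ℝ := fun x => P.eval (‖x‖ ^ 2) * G x with hK
    have hPc : ContDiff ℝ 1 fun x : RSpace n => P.eval (‖x‖ ^ 2) := by
      simp only [← Polynomial.coe_aeval_eq_eval]
      exact (P.contDiff_aeval 1).comp (contDiff_norm_sq ℝ)
    have hK1 : ContDiff ℝ 1 K := hPc.mul hG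
    have hKc : HasCompactSupport K := hcs.mul_left
    have hd : ∀ x e, fderiv ℝ K x e = P.eval (‖x‖ ^ 2) * fderiv ℝ G x e
        + G x * (P.derivative.eval (‖x‖ ^ 2) * (2 * inner ℝ x e)) := by
      intro x e
      have h1 : HasFDerivAt (fun x : RSpace n => P.eval (‖x‖ ^ 2))
          (P.derivative.eval (‖x‖ ^ 2) • (2 • innerSL ℝ x)) x :=
        HasDerivAt.comp_hasFDerivAt (h₂ := fun s => P.eval s) x (P.hasDerivAt (‖x‖ ^ 2))
          (hasStrictFDerivAt_norm_sq x).hasFDerivAt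
      have h2 : HasFDerivAt K _ x := h1.mul (hG.differentiable one_ne_zero x).hasFDerivAt
      rw [h2.fderiv]
      simp
    have key : ∀ c e : RSpace n, ∫ x, (inner ℝ c e * K x + inner ℝ x c * fderiv ℝ K x e) = 0 := by
      intro c e
      have hL : ContDiff ℝ 1 fun x : RSpace n => inner ℝ x c * K x :=
        (contDiff_id.inner ℝ contDiff_const).mul hK1
      rw [← integral_fderiv_apply_eq_zero (μ := volume) hL (hKc.mul_left) e]
      refine integral_congr_ae (.of_forall fun x => ?_)
      have h1 : HasFDerivAt (fun x : RSpace n => inner ℝ x c) (innerSL ℝ c) x := by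
        simpa [real_inner_comm] using (innerSL ℝ c).hasFDerivAt (x := x)
      have h2 : HasFDerivAt (fun x : RSpace n => inner ℝ x c * K x) _ x :=
        h1.mul (hK1.differentiable one_ne_zero x).hasFDerivAt
      simp only [h2.fderiv]
      simp
      ring
    have hi : ∀ c e : RSpace n,
        Integrable fun x => inner ℝ c e * K x + inner ℝ x c * fderiv ℝ K x e := by
      intro c e
      refine Continuous.integrable_of_hasCompactSupport ?_ ?_
      · have := (hK1.continuous_fderiv one_ne_zero).clm_apply (continuous_const (y := e))
        have := hK1.continuous
        fun_prop
      · exact hKc.mul_left.add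
          (((hKc.fderiv ℝ).comp_left (g := fun L : RSpace n →L[ℝ] ℝ => L e) rfl).mul_left)
    have h3 := integral_sub (hi a b) (hi b a)
    rw [key, key, sub_zero] at h3
    rw [← h3]
    refine integral_congr_ae (.of_forall fun x => ?_)
    simp only [hd, real_inner_comm a b]
    ring
  -- the general case, by uniform approximation on the annulus that contains `C`
  rcases C.eq_empty_or_nonempty with rfl | hne
  · have : G = fun _ => 0 := funext fun x => hGC x (Set.notMem_empty x)
    simp [this]
  set w : RSpace n → ℝ := fun x => inner ℝ x a * fderiv ℝ G x b - inner ℝ x b * fderiv ℝ G x a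
    with hw
  have hwc : Continuous w := by
    have h1 := (hG.continuous_fderiv one_ne_zero).clm_apply (continuous_const (y := a))
    have h2 := (hG.continuous_fderiv one_ne_zero).clm_apply (continuous_const (y := b))
    fun_prop
  have hwC : ∀ x ∉ C, w x = 0 := by
    intro x hx
    have : fderiv ℝ G x = 0 := by
      have h : G =ᶠ[𝓝 x] fun _ => 0 := by
        filter_upwards [hC.isClosed.isOpen_compl.mem_nhds hx] with y hy using hGC y hy
      rw [h.fderiv_eq]; simp
    simp [hw, this]
  have hwi : Integrable w :=
    hwc.integrable_of_hasCompactSupport (HasCompactSupport.intro hC hwC)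
  obtain ⟨p, hp, hpmin⟩ := hC.exists_isMinOn hne continuous_norm.continuousOn
  obtain ⟨q, hq, hqmax⟩ := hC.exists_isMaxOn hne continuous_norm.continuousOn
  have hp0 : 0 < ‖p‖ := norm_pos_iff.2 (by rintro rfl; exact h0 hp)
  by_contra hne0
  set I := ∫ x, σ ‖x‖ * w x with hI
  set M := ∫ x, ‖w x‖ with hM
  have hM0 : 0 ≤ M := integral_nonneg fun _ => norm_nonneg _
  have hIpos : 0 < |I| := abs_pos.2 hne0
  obtain ⟨P, hP⟩ := exists_polynomial_near_of_continuousOn (‖p‖ ^ 2) (‖q‖ ^ 2)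
    (fun s => σ (√s)) (hσ.comp Real.continuous_sqrt.continuousOn fun s hs =>
      Real.sqrt_pos.2 (lt_of_lt_of_le (by positivity) hs.1)) (|I| / (M + 1)) (by positivity)
  have hbound : ∀ x, ‖σ ‖x‖ * w x - P.eval (‖x‖ ^ 2) * w x‖ ≤ |I| / (M + 1) * ‖w x‖ := by
    intro x
    by_cases hx : x ∈ C
    · rw [← sub_mul, norm_mul]
      refine mul_le_mul_of_nonneg_right ?_ (norm_nonneg _)
      have h1 : ‖p‖ ≤ ‖x‖ := hpmin hx
      have h2 : ‖x‖ ≤ ‖q‖ := hqmax hx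
      have := hP (‖x‖ ^ 2) ⟨by gcongr, by gcongr⟩
      simp only [Real.sqrt_sq (norm_nonneg x)] at this
      rw [Real.norm_eq_abs, abs_sub_comm]
      exact this.le
    · simp [hwC x hx]
  have hPi : Integrable fun x => P.eval (‖x‖ ^ 2) * w x := by
    refine Continuous.integrable_of_hasCompactSupport ?_
      (HasCompactSupport.intro hC fun x hx => by simp [hwC x hx])
    have := P.continuous
    fun_prop
  have hdiff : Integrable fun x => σ ‖x‖ * w x - P.eval (‖x‖ ^ 2) * w x := by
    refine Integrable.mono' (hwi.norm.const_mul (|I| / (M + 1))) ?_ (.of_forall hbound)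
    have hσC : ContinuousOn (fun x : RSpace n => σ ‖x‖) C :=
      hσ.comp continuous_norm.continuousOn fun x hx => lt_of_lt_of_le hp0 (hpmin hx)
    have h1 : (fun x => σ ‖x‖ * w x) = C.indicator fun x => σ ‖x‖ * w x := by
      funext x
      by_cases hx : x ∈ C <;> simp [hx, hwC]
    refine AEStronglyMeasurable.sub ?_ hPi.aestronglyMeasurable
    rw [h1, aestronglyMeasurable_indicator_iff hC.measurableSet]
    exact (hσC.mul hwc.continuousOn).aestronglyMeasurable hC.measurableSet
  have hfin : I = ∫ x, (σ ‖x‖ * w x - P.eval (‖x‖ ^ 2) * w x) := by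
    have := integral_add hdiff hPi
    rw [smooth P, add_zero] at this
    rw [← this]
    simp [hI]
  have h5 : |I| ≤ |I| / (M + 1) * M := by
    conv_lhs => rw [hfin]
    rw [← Real.norm_eq_abs]
    refine (norm_integral_le_integral_norm _).trans ?_
    rw [hM, ← integral_const_mul]
    exact integral_mono hdiff.norm (hwi.norm.const_mul _) hbound
  have h6 : |I| / (M + 1) * M < |I| := by
    rw [div_mul_eq_mul_div, div_lt_iff₀ (by positivity)]
    nlinarith
  linarith

end Rotation

end


/-! ### Radial weights in polar coordinates -/

section

open scoped ContDiff Topology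

section Polar

variable {n : ℕ}

/-- Integration in polar coordinates. -/
lemma integral_eq_integral_sphere_integral (hn : 0 < n) {h : RSpace n → ℝ} (hh : Integrable h) :
    ∫ x, h x = ∫ y : Metric.sphere (0 : RSpace n) 1, (∫ r in Set.Ioi (0 : ℝ),
      r ^ (n - 1) * h (r • (y : RSpace n))) ∂(volume : Measure (RSpace n)).toSphere := by
  have : Nonempty (Fin n) := ⟨⟨0, hn⟩⟩
  have hmp := (volume : Measure (RSpace n)).measurePreserving_homeomorphUnitSphereProd
  have hemb := (homeomorphUnitSphereProd (RSpace n)).measurableEmbedding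
  set H : Metric.sphere (0 : RSpace n) 1 × Set.Ioi (0 : ℝ) → ℝ :=
    fun p => h ((p.2 : ℝ) • (p.1 : RSpace n)) with hH
  have hcomp : ∀ x : ({0}ᶜ : Set (RSpace n)), H (homeomorphUnitSphereProd (RSpace n) x) = h x := by
    intro x
    have := congrArg Subtype.val ((homeomorphUnitSphereProd (RSpace n)).symm_apply_apply x)
    rw [homeomorphUnitSphereProd_symm_apply_coe] at this
    rw [hH]
    exact congrArg h this
  have hint : Integrable H ((volume : Measure (RSpace n)).toSphere.prod
      (Measure.volumeIoiPow (Module.finrank ℝ (RSpace n) - 1))) := by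
    rw [← hmp.integrable_comp_emb hemb]
    have : H ∘ homeomorphUnitSphereProd (RSpace n) = h ∘ Subtype.val := funext hcomp
    rw [this, ← integrableOn_iff_comap_subtypeVal (by measurability)]
    exact hh.integrableOn
  calc ∫ x, h x = ∫ x : ({0}ᶜ : Set (RSpace n)), h x ∂(volume.comap Subtype.val) := by
        rw [integral_subtype_comap (measurableSet_singleton _).compl h,
          restrict_compl_singleton]
    _ = ∫ p, H p ∂((volume : Measure (RSpace n)).toSphere.prod
      (Measure.volumeIoiPow (Module.finrank ℝ (RSpace n) - 1))) := by
        rw [← hmp.integral_comp hemb]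
        exact integral_congr_ae (.of_forall fun x => (hcomp x).symm)
    _ = _ := by
        rw [integral_prod _ hint]
        refine integral_congr_ae (.of_forall fun y => ?_)
        simp only [Measure.volumeIoiPow, ENNReal.ofReal, finrank_euclideanSpace, Fintype.card_fin]
        rw [integral_withDensity_eq_integral_smul
          ((measurable_subtype_coe.pow_const _).real_toNNReal),
          integral_subtype_comap measurableSet_Ioi
            fun r : ℝ => Real.toNNReal (r ^ (n - 1)) • h (r • (y : RSpace n))]
        refine setIntegral_congr_fun measurableSet_Ioi fun r hr => ?_
        simp only [NNReal.smul_def, smul_eq_mul, Real.coe_toNNReal _ (pow_nonneg hr.out.le _)]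

lemma hasDerivAt_log_div {R r : ℝ} (hR : 0 < R) (hr : 0 < r) :
    HasDerivAt (fun r => Real.log (R / r)) (-r⁻¹) r := by
  have h := ((hasDerivAt_inv hr.ne').const_mul R).log (by positivity)
  simp only [← div_eq_mul_inv] at h
  refine h.congr_deriv ?_
  field_simp

/-- Integration by parts on a ray, for a weight with a jump at `r = R`. -/
lemma integral_ray_of_jump {ρ ρ' η η' : ℝ → ℝ} (hρ : ∀ t, HasDerivAt ρ (ρ' t) t)
    (hη : ∀ t, HasDerivAt η (η' t) t) (hρ'c : Continuous ρ') (hη'c : Continuous η')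
    {φ φ' : ℝ → ℝ} (hφ : ∀ r, HasDerivAt φ (φ' r) r) (hφ'c : Continuous φ')
    {a b R : ℝ} (ha : 0 < a) (haR : a < R) (hRb : R < b)
    (hφa : ∀ r, 0 < r → r ≤ a → φ r = 0) (hφb : ∀ r, b ≤ r → φ r = 0)
    (hφ'a : ∀ r, 0 < r → r ≤ a → φ' r = 0) (hφ'b : ∀ r, b ≤ r → φ' r = 0) :
    ∫ r in Set.Ioi (0 : ℝ), ((if Real.log (R / r) < 0 then ρ (Real.log (R / r))
        else η (Real.log (R / r))) * φ' r
      - (if Real.log (R / r) < 0 then ρ' (Real.log (R / r))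
        else η' (Real.log (R / r))) * (r⁻¹ * φ r)) = (η 0 - ρ 0) * φ R := by
  have hR : 0 < R := ha.trans haR
  set F : ℝ → ℝ := fun r => (if Real.log (R / r) < 0 then ρ (Real.log (R / r))
        else η (Real.log (R / r))) * φ' r
      - (if Real.log (R / r) < 0 then ρ' (Real.log (R / r))
        else η' (Real.log (R / r))) * (r⁻¹ * φ r) with hF
  have hφc : Continuous φ := continuous_iff_continuousAt.2 fun r => (hφ r).continuousAt
  have smooth : ∀ {p p' : ℝ → ℝ}, (∀ t, HasDerivAt p (p' t) t) → Continuous p' →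
      ∀ {c d : ℝ}, 0 < c → c ≤ d →
      IntervalIntegrable (fun r => p (Real.log (R / r)) * φ' r
        - p' (Real.log (R / r)) * (r⁻¹ * φ r)) volume c d ∧
      ∫ r in c..d, (p (Real.log (R / r)) * φ' r - p' (Real.log (R / r)) * (r⁻¹ * φ r))
        = p (Real.log (R / d)) * φ d - p (Real.log (R / c)) * φ c := by
    intro p p' hp hp' c d hc hcd
    have hpc : Continuous p := continuous_iff_continuousAt.2 fun r => (hp r).continuousAt
    have hpos : ∀ r ∈ Set.uIcc c d, 0 < r := fun r hr => by
      rw [Set.uIcc_of_le hcd] at hr; exact hc.trans_le hr.1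
    have hlog : ContinuousOn (fun r => Real.log (R / r)) (Set.uIcc c d) := fun r hr =>
      (hasDerivAt_log_div hR (hpos r hr)).continuousAt.continuousWithinAt
    have hint : IntervalIntegrable (fun r => p (Real.log (R / r)) * φ' r
        - p' (Real.log (R / r)) * (r⁻¹ * φ r)) volume c d := by
      refine ContinuousOn.intervalIntegrable ?_
      refine ((hpc.comp_continuousOn hlog).mul hφ'c.continuousOn).sub
        ((hp'.comp_continuousOn hlog).mul (ContinuousOn.mul ?_ hφc.continuousOn))
      exact continuousOn_id.inv₀ fun r hr => (hpos r hr).ne'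
    refine ⟨hint, ?_⟩
    refine intervalIntegral.integral_eq_sub_of_hasDerivAt
      (f := fun r => p (Real.log (R / r)) * φ r) (fun r hr => ?_) hint
    have h1 : HasDerivAt (fun r => p (Real.log (R / r))) (p' (Real.log (R / r)) * -r⁻¹) r :=
      (hp _).comp r (hasDerivAt_log_div hR (hpos r hr))
    refine (h1.mul (hφ r)).congr_deriv ?_
    ring
  have hbR : 0 < b := hR.trans hRb
  have hzero : ∀ r, 0 < r → r ∉ Set.Ioc a b → F r = 0 := by
    intro r hr0 hr
    rw [Set.mem_Ioc, not_and_or, not_lt, not_le] at hr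
    rcases hr with hr | hr
    · simp [hF, hφa r hr0 hr, hφ'a r hr0 hr]
    · simp [hF, hφb r hr.le, hφ'b r hr.le]
  have h1 : ∫ r in Set.Ioi (0 : ℝ), F r = ∫ r in Set.Ioc a b, F r := by
    refine (setIntegral_eq_of_subset_of_forall_sdiff_eq_zero measurableSet_Ioi
      (fun r hr => ha.trans hr.1) fun r hr => hzero r hr.1 hr.2)
  obtain ⟨i1, e1⟩ := smooth hη hη'c ha haR.le
  obtain ⟨i2, e2⟩ := smooth hρ hρ'c hR hRb.le
  have c1 : Set.EqOn (fun r => η (Real.log (R / r)) * φ' r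
        - η' (Real.log (R / r)) * (r⁻¹ * φ r)) F (Set.Ioc a R) := by
    intro r hr
    have : ¬ Real.log (R / r) < 0 :=
      not_lt.2 (Real.log_nonneg ((one_le_div (ha.trans hr.1)).2 hr.2))
    simp [hF, this]
  have c2 : Set.EqOn (fun r => ρ (Real.log (R / r)) * φ' r
        - ρ' (Real.log (R / r)) * (r⁻¹ * φ r)) F (Set.Ioc R b) := by
    intro r hr
    have : Real.log (R / r) < 0 :=
      Real.log_neg (div_pos hR (hR.trans hr.1)) ((div_lt_one (hR.trans hr.1)).2 hr.1)
    simp [hF, this]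
  rw [h1, ← intervalIntegral.integral_of_le (haR.trans hRb).le,
    ← intervalIntegral.integral_add_adjacent_intervals (b := R)]
  · rw [← Set.uIoc_of_le haR.le] at c1
    rw [← Set.uIoc_of_le hRb.le] at c2
    rw [← intervalIntegral.integral_congr_ae (.of_forall c1),
      ← intervalIntegral.integral_congr_ae (.of_forall c2), e1, e2, div_self hR.ne', Real.log_one, hφa a ha le_rfl, hφb b le_rfl]
    ring
  · exact i1.congr (by rw [Set.uIoc_of_le haR.le]; exact c1)
  · exact i2.congr (by rw [Set.uIoc_of_le hRb.le]; exact c2)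

/-- The weight `ρ(log(R / |x|)) / |x|ⁿ`, whose integral is that of `ρ(t) dt dω`. -/
noncomputable def radialWeight (n : ℕ) (R : ℝ) (ρ : ℝ → ℝ) (x : RSpace n) : ℝ :=
  ρ (Real.log (R / ‖x‖)) / ‖x‖ ^ n

lemma measurable_radialWeight {R : ℝ} {ρ : ℝ → ℝ} (hρ : Measurable ρ) :
    Measurable (radialWeight n R ρ) := by
  unfold radialWeight
  fun_prop

lemma continuousOn_radialWeight {R : ℝ} (hR : 0 < R) {ρ : ℝ → ℝ} (hρ : Continuous ρ) :
    ContinuousOn (radialWeight n R ρ) {0}ᶜ := by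
  intro x hx
  have hx' : ‖x‖ ≠ 0 := norm_ne_zero_iff.2 hx
  refine ContinuousAt.continuousWithinAt ?_
  refine ContinuousAt.div (hρ.continuousAt.comp (ContinuousAt.log ?_ (by positivity)))
    (by fun_prop) (pow_ne_zero _ hx')
  exact continuousAt_const.div continuous_norm.continuousAt hx'

lemma integrableOn_radialWeight_mul {R : ℝ} (hR : 0 < R) {ρ κ : ℝ → ℝ} (hρ : Measurable ρ)
    (hκ : Continuous κ) (hρκ : ∀ t, |ρ t| ≤ κ t) {C : Set (RSpace n)} (hC : IsCompact C)
    (h0 : (0 : RSpace n) ∉ C) {h : RSpace n → ℝ} (hh : ContinuousOn h C) :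
    IntegrableOn (fun x => radialWeight n R ρ x * h x) C := by
  have hsub : C ⊆ {0}ᶜ := fun x hx hx0 => h0 (by rwa [← Set.mem_singleton_iff.1 hx0])
  have hdom : IntegrableOn (fun x => radialWeight n R κ x * |h x|) C :=
    (((continuousOn_radialWeight hR hκ).mono hsub).mul hh.abs).integrableOn_compact hC
  refine Integrable.mono' hdom ((measurable_radialWeight hρ).aestronglyMeasurable.mul
    (hh.aestronglyMeasurable hC.measurableSet)) (.of_forall fun x => ?_)
  rw [norm_mul, Real.norm_eq_abs, Real.norm_eq_abs]
  refine mul_le_mul_of_nonneg_right ?_ (abs_nonneg _)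
  rw [radialWeight, radialWeight, abs_div, abs_of_nonneg (pow_nonneg (norm_nonneg x) n)]
  gcongr
  exact hρκ _

/-- Integration by parts against the Euler field, for a weight that is smooth on either side of the
sphere of radius `R` and has a jump there. -/
lemma integral_radialWeight_mul_euler (hn : 0 < n) {ρ ρ' η η' : ℝ → ℝ}
    (hρ : ∀ t, HasDerivAt ρ (ρ' t) t) (hη : ∀ t, HasDerivAt η (η' t) t) (hρ'c : Continuous ρ')
    (hη'c : Continuous η') {R : ℝ} (hR : 0 < R) {C : Set (RSpace n)} (hC : IsCompact C)
    (h0 : (0 : RSpace n) ∉ C) {f : RSpace n → ℝ} (hf : ContDiff ℝ 1 f)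
    (hfC : ∀ x ∉ C, f x = 0) :
    ∫ x in C, radialWeight n R (fun t => if t < 0 then ρ t else η t) x * fderiv ℝ f x x =
      (∫ x in C, radialWeight n R (fun t => if t < 0 then ρ' t else η' t) x * f x)
        + (η 0 - ρ 0) * ∫ y : Metric.sphere (0 : RSpace n) 1, f (R • (y : RSpace n))
          ∂(volume : Measure (RSpace n)).toSphere := by
  have cont : ∀ {p p' : ℝ → ℝ}, (∀ t, HasDerivAt p (p' t) t) → Continuous p := fun hp =>
    continuous_iff_continuousAt.2 fun t => (hp t).continuousAt
  have intg : ∀ {p q : ℝ → ℝ}, Continuous p → Continuous q → ∀ {h : RSpace n → ℝ},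
      Continuous h → IntegrableOn (fun x => radialWeight n R (fun t => if t < 0 then p t else q t) x
        * h x) C := by
    intro p q hp hq h hh
    refine integrableOn_radialWeight_mul hR
      (Measurable.ite measurableSet_Iio hp.measurable hq.measurable) (hp.abs.add hq.abs)
      (fun t => ?_) hC h0 hh.continuousOn
    split_ifs
    · exact le_add_of_nonneg_right (abs_nonneg _)
    · exact le_add_of_nonneg_left (abs_nonneg _)
  have hf'0 : ∀ x ∉ C, fderiv ℝ f x = 0 := by
    intro x hx
    have h : f =ᶠ[𝓝 x] fun _ => 0 := by
      filter_upwards [hC.isClosed.isOpen_compl.mem_nhds hx] with y hy using hfC y hy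
    rw [h.fderiv_eq]; simp
  have hEc : Continuous fun x => fderiv ℝ f x x :=
    (hf.continuous_fderiv one_ne_zero).clm_apply continuous_id
  have I1 := intg (cont hρ) (cont hη) hEc
  have I2 := intg hρ'c hη'c hf.continuous
  rw [← sub_eq_iff_eq_add', ← integral_sub I1 I2]
  have I3 := I1.sub I2
  rw [setIntegral_eq_integral_of_forall_compl_eq_zero (fun x hx => by simp [hf'0 x hx, hfC x hx])]
  have I4 : Integrable fun x => radialWeight n R (fun t => if t < 0 then ρ t else η t) x
      * fderiv ℝ f x x - radialWeight n R (fun t => if t < 0 then ρ' t else η' t) x * f x :=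
    (integrableOn_iff_integrable_of_support_subset (fun x hx => by
      by_contra hxC; exact hx (by simp [hf'0 x hxC, hfC x hxC]))).1 I3
  rw [integral_eq_integral_sphere_integral hn I4, ← integral_const_mul]
  refine integral_congr_ae (.of_forall fun y => ?_)
  obtain ⟨a, ha, haR, haC⟩ : ∃ a, 0 < a ∧ a < R ∧ ∀ x ∈ C, a < ‖x‖ := by
    obtain ⟨ε, hε, hb⟩ := Metric.isOpen_iff.1 hC.isClosed.isOpen_compl 0 h0
    refine ⟨min ε R / 2, by positivity, ?_, fun x hx => ?_⟩
    · have := min_le_right ε R; have : 0 < min ε R := by positivity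
      linarith
    · by_contra hlt
      have h1 := min_le_left ε R
      refine hb (mem_ball_zero_iff.2 ?_) hx
      linarith
  obtain ⟨b, hRb, hbC⟩ : ∃ b, R < b ∧ ∀ x ∈ C, ‖x‖ < b := by
    obtain ⟨M, hM⟩ := hC.isBounded.exists_norm_le
    refine ⟨max M R + 1, by linarith [le_max_right M R], fun x hx => ?_⟩
    linarith [hM x hx, le_max_left M R]
  have hy : ‖(y : RSpace n)‖ = 1 := by simp
  have hnorm : ∀ r, 0 < r → ‖r • (y : RSpace n)‖ = r := fun r hr => by
    rw [norm_smul, hy, mul_one, Real.norm_of_nonneg hr.le]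
  have hout : ∀ r, 0 < r → r ≤ a ∨ b ≤ r → r • (y : RSpace n) ∉ C := by
    intro r hr0 hr hrC
    have h1 := haC _ hrC
    have h2 := hbC _ hrC
    rw [hnorm r hr0] at h1 h2
    rcases hr with hr | hr <;> linarith
  have hb0 : 0 < b := hR.trans hRb
  have hray := integral_ray_of_jump hρ hη hρ'c hη'c (φ := fun r => f (r • (y : RSpace n)))
    (φ' := fun r => fderiv ℝ f (r • (y : RSpace n)) y)
    (fun r => by
      have h1 : HasDerivAt (fun r : ℝ => r • (y : RSpace n)) (y : RSpace n) r := by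
        simpa using (hasDerivAt_id r).smul_const (y : RSpace n)
      exact (hf.differentiable one_ne_zero _).hasFDerivAt.comp_hasDerivAt r h1)
    ((hf.continuous_fderiv one_ne_zero).comp (by fun_prop) |>.clm_apply continuous_const)
    ha haR hRb (fun r h0 hr => hfC _ (hout r h0 (.inl hr)))
    (fun r hr => hfC _ (hout r (hb0.trans_le hr) (.inr hr)))
    (fun r h0 hr => by simp [hf'0 _ (hout r h0 (.inl hr))])
    (fun r hr => by simp [hf'0 _ (hout r (hb0.trans_le hr) (.inr hr))])
  refine Eq.trans ?_ hray
  refine setIntegral_congr_fun measurableSet_Ioi fun r hr => ?_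
  have hr0 : 0 < r := hr
  simp only [radialWeight, hnorm r hr0, map_smul, smul_eq_mul]
  obtain ⟨m, rfl⟩ : ∃ m, n = m + 1 := ⟨n - 1, by omega⟩
  rw [Nat.add_sub_cancel, pow_succ]
  field_simp

end Polar

end


/-! ### Integration against the Green weights -/

section

open scoped ContDiff Topology

section GreenFunctional

variable {n : ℕ} {H C : Set (RSpace n)} {R : ℝ}

open smoothFunctions PolarCalculus

lemma integrableOn_green_mul (k : ℕ) (hR : 0 < R) (hC : IsCompact C) (h0 : (0 : RSpace n) ∉ C)
    {h : RSpace n → ℝ} (hh : ContinuousOn h C) :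
    IntegrableOn (fun x => radialWeight n R (greenDeriv n k) x * h x) C := by
  refine integrableOn_radialWeight_mul hR (measurable_greenDeriv n k)
    ((continuous_greenNeg n k).abs.add (continuous_greenPos n k).abs) (fun t => ?_) hC h0 hh
  unfold greenDeriv
  split_ifs
  · exact le_add_of_nonneg_right (abs_nonneg _)
  · exact le_add_of_nonneg_left (abs_nonneg _)

lemma integrableOn_green_mul_toFun (k : ℕ) (hR : 0 < R) (hC : IsCompact C)
    (h0 : (0 : RSpace n) ∉ C) (hCH : C ⊆ H) (f : smoothFunctions H) :
    IntegrableOn (fun x => radialWeight n R (greenDeriv n k) x * toFun f x) C :=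
  integrableOn_green_mul k hR hC h0 ((contDiffOn f).continuousOn.mono hCH)

/-- Integration over `C` against `g⁽ᵏ⁾(log(R / |x|)) |x|⁻ⁿ dx`. -/
noncomputable def greenFunctional (k : ℕ) (hR : 0 < R) (hC : IsCompact C)
    (h0 : (0 : RSpace n) ∉ C) (hCH : C ⊆ H) : smoothFunctions H →ₗ[ℝ] ℝ where
  toFun f := ∫ x in C, radialWeight n R (greenDeriv n k) x * smoothFunctions.toFun f x
  map_add' f g := by
    rw [← integral_add (integrableOn_green_mul_toFun k hR hC h0 hCH f)
      (integrableOn_green_mul_toFun k hR hC h0 hCH g)]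
    simp only [toFun_add, Pi.add_apply, mul_add]
  map_smul' c f := by
    simp only [toFun_smul, Pi.smul_apply, smul_eq_mul, RingHom.id_apply]
    rw [← integral_const_mul]
    exact integral_congr_ae (.of_forall fun x => by ring)

variable (hR : 0 < R) (hC : IsCompact C) (h0 : (0 : RSpace n) ∉ C) (hCH : C ⊆ H)

lemma greenFunctional_apply (k : ℕ) (f : smoothFunctions H) : greenFunctional k hR hC h0 hCH f =
    ∫ x in C, radialWeight n R (greenDeriv n k) x * smoothFunctions.toFun f x := rfl

lemma fderiv_toFun_of_notMem (hC' : IsClosed C) {f : smoothFunctions H} (hf : f ∈ supportedIn C)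
    {x : RSpace n} (hx : x ∉ C) : fderiv ℝ (toFun f) x = 0 := by
  have h : toFun f =ᶠ[𝓝 x] fun _ => 0 := by
    filter_upwards [hC'.isOpen_compl.mem_nhds hx] with y hy using hf y hy
  rw [h.fderiv_eq]; simp

lemma euler_mem_supportedIn (hH : IsOpen H) (h0H : (0 : RSpace n) ∉ H) (hC' : IsClosed C)
    {f : smoothFunctions H} (hf : f ∈ supportedIn C) :
    (cartesianData hH h0H).euler f ∈ supportedIn C := by
  rw [CartesianData.euler_apply]
  exact Ideal.sum_mem _ fun i _ => Ideal.mul_mem_left _ _ (dirDeriv_mem_supportedIn hH hC' _ hf)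

/-- The tangential derivatives integrate by parts against every continuous radial weight. -/
lemma isRadialWeight_greenFunctional {k : ℕ} (hk : k < 3) (hH : IsOpen H)
    (h0H : (0 : RSpace n) ∉ H) :
    (cartesianData hH h0H).toPolar.IsRadialWeight (supportedIn C)
      (greenFunctional k hR hC h0 hCH) where
  D_eq F hF i := by
    set P := (cartesianData hH h0H).toPolar with hP
    set Cd := cartesianData hH h0H with hCd
    have hsum : P.D i F - ((n : ℝ) - 1) • (P.ω i * F) =
        ∑ j, (Cd.x j * Cd.d i (P.ω j * F) - Cd.x i * Cd.d j (P.ω j * F)) := by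
      have e1 : ∀ j, Cd.x j * Cd.d i (P.ω j * F) - Cd.x i * Cd.d j (P.ω j * F) =
          Cd.r * (P.ω j * P.ω j) * Cd.d i F - P.ω i * (Cd.x j * Cd.d j F)
          + (if i = j then 1 else 0) * (P.ω j * F)
          - P.ω i * F := by
        intro j
        change Cd.x j * Cd.d i (Cd.rinv * Cd.x j * F) - Cd.x i * Cd.d j (Cd.rinv * Cd.x j * F) =
          Cd.r * (Cd.rinv * Cd.x j * (Cd.rinv * Cd.x j)) * Cd.d i F
            - Cd.rinv * Cd.x i * (Cd.x j * Cd.d j F)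
          + (if i = j then 1 else 0) * (Cd.rinv * Cd.x j * F) - Cd.rinv * Cd.x i * F
        simp only [Derivation.leibniz, smul_eq_mul, Cd.d_x, Cd.d_rinv, if_true]
        linear_combination -Cd.rinv * Cd.x j * Cd.x j * Cd.d i F * Cd.r_mul_rinv
      simp only [e1, Finset.sum_add_distrib, Finset.sum_sub_distrib, ← Finset.sum_mul,
        ← Finset.mul_sum, P.sum_ω_sq, ← CartesianData.euler_apply]
      simp only [ite_mul, one_mul, zero_mul, Finset.sum_ite_eq, Finset.mem_univ, if_true,
        Finset.sum_const, Finset.card_univ, Fintype.card_fin, nsmul_eq_mul]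
      change Cd.r * Cd.d i F - P.ω i * Cd.euler F - _ = _
      rw [Algebra.smul_def, map_sub, map_natCast, map_one]
      ring
    have hzero : ∀ j, greenFunctional k hR hC h0 hCH
        (Cd.x j * Cd.d i (P.ω j * F) - Cd.x i * Cd.d j (P.ω j * F)) = 0 := by
      intro j
      have hG : P.ω j * F ∈ supportedIn C := Ideal.mul_mem_left _ _ hF
      generalize P.ω j * F = G at hG ⊢
      rw [greenFunctional_apply]
      rw [← integral_rotation_eq_zero
        (σ := fun r => greenDeriv n k (Real.log (R / r)) / r ^ n) (C := C) ?_ hC h0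
        ((contDiff_of_mem_supportedIn hH hC.isClosed hCH hG).of_le (by norm_cast))
        hG (EuclideanSpace.single j 1) (EuclideanSpace.single i 1)]
      · refine Eq.trans ?_ (setIntegral_eq_integral_of_forall_compl_eq_zero (s := C) fun x hx => by
          simp only [fderiv_toFun_of_notMem hC.isClosed hG hx, zero_apply,
            mul_zero, sub_zero])
        refine setIntegral_congr_fun hC.measurableSet fun x hx => ?_
        have hxH := hCH hx
        simp only [toFun_sub, toFun_mul, Pi.sub_apply, Pi.mul_apply]
        have hd : ∀ l f, toFun (Cd.d l f) x = fderiv ℝ (toFun f) x (EuclideanSpace.single l 1) :=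
          fun l f => toFun_dirDeriv hH _ _ hxH
        have hx' : ∀ l, toFun (Cd.x l) x = x l := fun l => toFun_ofFun _ _ hxH
        simp only [hd, hx']
        simp [radialWeight, EuclideanSpace.inner_single_right]
      · intro r hr
        have hr0 : r ≠ 0 := ne_of_gt hr
        refine ContinuousAt.continuousWithinAt (ContinuousAt.div
          ((continuous_greenDeriv hk).continuousAt.comp (ContinuousAt.log ?_ ?_)) (by fun_prop)
          (pow_ne_zero _ hr0))
        · exact continuousAt_const.div continuousAt_id hr0
        · exact div_ne_zero hR.ne' hr0
    have h := congrArg (greenFunctional k hR hC h0 hCH) hsum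
    rw [map_sum, Finset.sum_eq_zero fun j _ => hzero j, map_sub, map_smul, smul_eq_mul] at h
    linarith

lemma greenFunctional_euler (hn : 0 < n) (k : ℕ) (hH : IsOpen H) (h0H : (0 : RSpace n) ∉ H)
    {f : smoothFunctions H} (hf : f ∈ supportedIn C) :
    greenFunctional k hR hC h0 hCH ((cartesianData hH h0H).euler f) =
      greenFunctional (k + 1) hR hC h0 hCH f + (greenPos n k 0 - greenNeg n k 0) *
        ∫ y : Metric.sphere (0 : RSpace n) 1, toFun f (R • (y : RSpace n))
          ∂(volume : Measure (RSpace n)).toSphere := by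
  rw [greenFunctional_apply, greenFunctional_apply]
  have h := integral_radialWeight_mul_euler hn (hasDerivAt_greenNeg n k) (hasDerivAt_greenPos n k)
    (continuous_greenNeg n (k + 1)) (continuous_greenPos n (k + 1)) hR hC h0
    ((contDiff_of_mem_supportedIn hH hC.isClosed hCH hf).of_le (by norm_cast)) hf
  refine Eq.trans ?_ h
  exact setIntegral_congr_fun hC.measurableSet fun x hx => by
    simp only [toFun_euler hH h0H f (hCH hx)]; rfl

lemma greenFunctional_nonneg {f : smoothFunctions H} {c₀ c₁ c₂ c₃ : ℝ}
    (h : ∀ t, 0 ≤ c₀ * greenDeriv n 0 t + c₁ * greenDeriv n 1 t + c₂ * greenDeriv n 2 t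
      + c₃ * greenDeriv n 3 t) :
    0 ≤ c₀ * greenFunctional 0 hR hC h0 hCH (f * f) + c₁ * greenFunctional 1 hR hC h0 hCH (f * f)
      + c₂ * greenFunctional 2 hR hC h0 hCH (f * f)
      + c₃ * greenFunctional 3 hR hC h0 hCH (f * f) := by
  have I := fun k => integrableOn_green_mul_toFun k hR hC h0 hCH (f * f)
  simp only [greenFunctional_apply]
  set G : ℕ → RSpace n → ℝ := fun k x => radialWeight n R (greenDeriv n k) x * toFun (f * f) x
    with hG
  have e : ∫ x in C, (c₀ * G 0 x + c₁ * G 1 x + c₂ * G 2 x + c₃ * G 3 x) =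
      c₀ * (∫ x in C, G 0 x) + c₁ * (∫ x in C, G 1 x) + c₂ * (∫ x in C, G 2 x)
        + c₃ * ∫ x in C, G 3 x := by
    have J : ∀ (c : ℝ) k, IntegrableOn (fun x => c * G k x) C := fun c k => (I k).const_mul c
    rw [integral_add, integral_add, integral_add]
    · simp only [integral_const_mul]
    exacts [J c₀ 0, J c₁ 1, (J c₀ 0).add (J c₁ 1), J c₂ 2, ((J c₀ 0).add (J c₁ 1)).add (J c₂ 2),
      J c₃ 3]
  rw [← e]
  refine integral_nonneg fun x => ?_
  have h1 := mul_nonneg (h (Real.log (R / ‖x‖))) (div_nonneg (mul_self_nonneg (toFun f x))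
    (pow_nonneg (norm_nonneg x) n))
  refine h1.trans_eq ?_
  simp only [hG, radialWeight, toFun_mul, Pi.mul_apply]
  ring

end GreenFunctional

end


/-! ### The polar inequality for test functions -/

section

open scoped ContDiff Topology

section GreenDensity

variable {n : ℕ}

/-- The trace of a bilinear form; `bilinTrace (D²u(x))` is the Laplacian of `u` at `x`. -/
noncomputable def bilinTrace (M : RSpace n →L[ℝ] RSpace n →L[ℝ] ℝ) : ℝ :=
  ∑ i, M (EuclideanSpace.single i 1) (EuclideanSpace.single i 1)

/-- The quadratic integrand of the polar inequality, with `γₖ = g⁽ᵏ⁾(log(R / |x|)) |x|⁻ⁿ`; the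
arguments are the Laplacian `L` of `u` and the values of `v = u / |x|²`, `x · ∇v`,
`(x · ∇)² v`. -/
noncomputable def polarDensity (n : ℕ) (γ₀ γ₁ γ₂ L v v₁ v₂ : ℝ) : ℝ :=
  γ₀ * (L * (L + (-2 * (n : ℝ)) * v₁ + (-2 * (n : ℝ)) * v))
    + γ₁ * (L * ((-2 : ℝ) * v₁ + ((n : ℝ) - 2) * v)) + γ₂ * (L * v)
    + ((n : ℝ) ^ 2 - 2) / (2 * n) * (-(1 / 2) * (γ₁ * (L * L))
      + γ₀ * (L * ((2 * (n : ℝ)) * v₂ + (2 * (n : ℝ)) * v₁))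
      + γ₁ * (L * ((2 : ℝ) * v₂ + (-((n : ℝ) - 2)) * v₁)) - γ₂ * (L * v₁))

/-- `polarDensity` at `x`, for a function with value `a`, derivative `p` and second derivative `M`
there. -/
noncomputable def jetDensity (R : ℝ) (x : RSpace n) (a : ℝ) (p : RSpace n →L[ℝ] ℝ)
    (M : RSpace n →L[ℝ] RSpace n →L[ℝ] ℝ) : ℝ :=
  polarDensity n (radialWeight n R (greenDeriv n 0) x) (radialWeight n R (greenDeriv n 1) x)
    (radialWeight n R (greenDeriv n 2) x) (bilinTrace M) (a / ‖x‖ ^ 2) ((p x - 2 * a) / ‖x‖ ^ 2)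
    ((M x x - 3 * p x + 4 * a) / ‖x‖ ^ 2)

open smoothFunctions PolarCalculus

lemma hasFDerivAt_fderiv_apply_self {V : RSpace n → ℝ} {x : RSpace n} (hV : ContDiffAt ℝ 2 V x) :
    HasFDerivAt (fun y => fderiv ℝ V y y) ((fderiv ℝ (fderiv ℝ V) x).flip x + fderiv ℝ V x) x := by
  have h1 : HasFDerivAt (fderiv ℝ V) (fderiv ℝ (fderiv ℝ V) x) x :=
    ((hV.fderiv_right (m := 1) (by norm_num)).differentiableAt one_ne_zero).hasFDerivAt
  have h2 := h1.clm_apply (hasFDerivAt_id x)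
  refine h2.congr_fderiv ?_
  ext y
  simp [add_comm]

/-- The polar inequality for a smooth function with compact support in an open half-space. -/
theorem half_sphere_integral_le_integral_jetDensity (hn : 2 ≤ n) {R : ℝ} (hR : 0 < R)
    {α : RSpace n} (hα : ‖α‖ = 1) {C : Set (RSpace n)} (hC : IsCompact C)
    (hCα : ∀ x ∈ C, 0 < inner ℝ α x) {V : RSpace n → ℝ} (hV : ContDiff ℝ ∞ V)
    (hVC : ∀ x ∉ C, V x = 0) :
    1 / 2 * ∫ y : Metric.sphere (0 : RSpace n) 1, (V (R • (y : RSpace n)) / R ^ 2) ^ 2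
        ∂(volume : Measure (RSpace n)).toSphere
      ≤ ∫ x in C, jetDensity R x (V x) (fderiv ℝ V x) (fderiv ℝ (fderiv ℝ V) x) := by
  set H : Set (RSpace n) := {x | 0 < inner ℝ α x} with hHdef
  have hH : IsOpen H := isOpen_lt continuous_const (by fun_prop)
  have h0H : (0 : RSpace n) ∉ H := by simp [hHdef]
  have hCH : C ⊆ H := hCα
  have h0 : (0 : RSpace n) ∉ C := fun h => h0H (hCH h)
  set Cd := cartesianData hH h0H with hCd
  set P := Cd.toPolar with hP
  set T : Ideal (smoothFunctions H) := supportedIn C with hT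
  set Vv : smoothFunctions H := ofFun V hV.contDiffOn with hVv
  have hVvT : Vv ∈ T := by
    intro x hx
    by_cases hxH : x ∈ H
    · rw [toFun_ofFun _ _ hxH, hVC x hx]
    · exact zeroExtend_of_notMem _ hxH
  set v : smoothFunctions H := Cd.rinv * Cd.rinv * Vv with hv
  have hvT : v ∈ T := Ideal.mul_mem_left _ _ hVvT
  set W : Fin 4 → smoothFunctions H →ₗ[ℝ] ℝ := fun k => greenFunctional k hR hC h0 hCH with hW
  set Φ : smoothFunctions H → ℝ := fun f => ∫ y : Metric.sphere (0 : RSpace n) 1,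
    toFun f (R • (y : RSpace n)) ∂(volume : Measure (RSpace n)).toSphere with hΦ
  have hn0 : 0 < n := by omega
  have hnR : (2 : ℝ) ≤ n := by exact_mod_cast hn
  have hn2 : 0 ≤ (n : ℝ) ^ 2 - 2 := by nlinarith
  have hα' : ∑ i, α i ^ 2 = 1 := by
    rw [← EuclideanSpace.real_norm_sq_eq, hα]; norm_num
  have hTD : ∀ f ∈ T, ∀ i, P.D i f ∈ T := fun f hf i =>
    T.sub_mem (T.mul_mem_left _ (dirDeriv_mem_supportedIn hH hC.isClosed _ hf))
      (T.mul_mem_left _ (euler_mem_supportedIn hH h0H hC.isClosed hf))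
  have hTE : ∀ f ∈ T, P.E f ∈ T := fun f hf => euler_mem_supportedIn hH h0H hC.isClosed hf
  have hEuler : ∀ k : ℕ, ∀ f ∈ T, greenFunctional k hR hC h0 hCH (P.E f) =
      greenFunctional (k + 1) hR hC h0 hCH f + (greenPos n k 0 - greenNeg n k 0) * Φ f :=
    fun k f hf => greenFunctional_euler hR hC h0 hCH hn0 k hH h0H hf
  have hEuler' : ∀ k : ℕ, k < 3 → ∀ f ∈ T, greenFunctional k hR hC h0 hCH (P.E f) =
      greenFunctional (k + 1) hR hC h0 hCH f := fun k hk f hf => by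
    rw [hEuler k f hf, greenNeg_zero_eq hk]; ring
  have hfour : ∀ f, greenFunctional 4 hR hC h0 hCH f = -2 * n * W 3 f
      - ((n : ℝ) ^ 2 - 2) * W 2 f + 2 * n * W 1 f := by
    intro f
    have I := fun k => integrableOn_green_mul_toFun k hR hC h0 hCH f
    simp only [hW, greenFunctional_apply]
    rw [← integral_const_mul, ← integral_const_mul, ← integral_const_mul, ← integral_sub,
      ← integral_add]
    · refine integral_congr_ae (.of_forall fun x => ?_)
      simp only [radialWeight, greenDeriv_four]
      simp
      ring
    exacts [((I 3).const_mul _).sub ((I 2).const_mul _), (I 1).const_mul _, (I 3).const_mul _,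
      (I 2).const_mul _]
  -- the reciprocal of the height function
  have hψ : ∃ ψ, P.height α * ψ = 1 := by
    refine ⟨ofFun (fun x => ‖x‖ * (inner ℝ α x)⁻¹) ((contDiffOn_norm_of_zero_notMem h0H).mul
      (ContDiffOn.inv
      (contDiff_const.inner ℝ contDiff_id).contDiffOn fun x hx => ne_of_gt hx)), ext_toFun fun x hx => ?_⟩
    have hx0 : ‖x‖ ≠ 0 := norm_ne_zero_iff.2 (by rintro rfl; exact h0H hx)
    have hxα : inner ℝ α x ≠ 0 := ne_of_gt hx
    have h1 : toFun (P.height α) x = ‖x‖⁻¹ * inner ℝ α x := by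
      rw [height, toFun_sum, Finset.sum_apply]
      have h2 : ∀ i, toFun (algebraMap ℝ (smoothFunctions H) (α i) * P.ω i) x =
          ‖x‖⁻¹ * (α i * x i) := by
        intro i
        rw [← Algebra.smul_def, toFun_smul, Pi.smul_apply,
          show P.ω i = Cd.rinv * Cd.x i from rfl, toFun_mul, Pi.mul_apply,
          show toFun Cd.rinv x = ‖x‖⁻¹ from toFun_ofFun _ _ hx,
          show toFun (Cd.x i) x = x i from toFun_ofFun _ _ hx, smul_eq_mul]
        ring
      simp only [h2, ← Finset.mul_sum]
      simp [PiLp.inner_apply, mul_comm]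
    rw [toFun_mul, Pi.mul_apply, h1, toFun_ofFun _ _ hx, toFun_one hx]
    field_simp
  obtain ⟨ψ, hψ⟩ := hψ
  set c : ℝ := ((n : ℝ) ^ 2 - 2) / (2 * n) with hc
  have hc0 : 0 ≤ c := by positivity
  have hcn : c * n = ((n : ℝ) ^ 2 - 2) / 2 := by rw [hc]; field_simp
  set L := P.E (P.E v) + ((n : ℝ) + 2) • P.E v + (2 * (n : ℝ)) • v + P.lap v with hL
  have g0 := greenDeriv_zero_nonneg hn0
  have g1 := greenDeriv_one_nonpos hn0
  have g10 := greenDeriv_one_ge hn0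
  have g2 := greenDeriv_two_add_nonpos hn0
  have main := P.half_sphere_integral_le hn0 (W := W) (Φ := Φ) hTD hTE
    (fun k hk => isRadialWeight_greenFunctional hR hC h0 hCH
      (by have := k.isLt; have : (k : ℕ) ≠ 3 := fun h => hk (Fin.ext h); omega) hH h0H)
    (hEuler' 0 (by norm_num)) (hEuler' 1 (by norm_num)) (hEuler' 2 (by norm_num))
    (fun f hf => by
      have h1 := hEuler 3 f hf
      rw [greenPos_sub_greenNeg_three hn0, hfour] at h1
      change greenFunctional 3 hR hC h0 hCH (P.E f) = _
      rw [h1]; ring)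
    hc
    (fun f => by
      have := greenFunctional_nonneg hR hC h0 hCH (f := f) (c₀ := 1) (c₁ := -(c / 2)) (c₂ := 0)
        (c₃ := 0) fun t => by nlinarith [g0 t, g1 t]
      change 0 ≤ greenFunctional 0 hR hC h0 hCH (f * f) - c / 2 * greenFunctional 1 hR hC h0 hCH
        (f * f)
      linarith)
    (fun f => by
      have := greenFunctional_nonneg hR hC h0 hCH (f := f) (c₀ := 0) (c₁ := -n) (c₂ := -1)
        (c₃ := 0) fun t => by linarith [g2 t]
      change 0 ≤ -(greenFunctional 2 hR hC h0 hCH (f * f) + n * greenFunctional 1 hR hC h0 hCH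
        (f * f))
      linarith)
    (fun f => by
      have := greenFunctional_nonneg hR hC h0 hCH (f := f) (c₀ := (n : ℝ) ^ 2) (c₁ := c) (c₂ := 0)
        (c₃ := 0) fun t => by
          have h1 : 0 ≤ ((n : ℝ) ^ 2 - c * n) * greenDeriv n 0 t :=
            mul_nonneg (by rw [hcn]; nlinarith) (g0 t)
          nlinarith [g10 t]
      change 0 ≤ (n : ℝ) ^ 2 * greenFunctional 0 hR hC h0 hCH (f * f)
        + c * greenFunctional 1 hR hC h0 hCH (f * f)
      linarith)
    (fun f => by
      have := greenFunctional_nonneg hR hC h0 hCH (f := f) (c₀ := (n : ℝ) ^ 2 - 1)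
        (c₁ := 3 * ((n : ℝ) ^ 2 - 2) / (4 * n)) (c₂ := 0) (c₃ := 0) fun t => by
          have e : 3 * ((n : ℝ) ^ 2 - 2) / (4 * n) = 3 / 2 * c := by rw [hc]; field_simp; ring
          rw [e]
          have h1 : 0 ≤ ((n : ℝ) ^ 2 - 1 - 3 / 2 * (c * n)) * greenDeriv n 0 t :=
            mul_nonneg (by rw [hcn]; nlinarith) (g0 t)
          nlinarith [g10 t]
      change 0 ≤ ((n : ℝ) ^ 2 - 1) * greenFunctional 0 hR hC h0 hCH (f * f)
        + 3 * ((n : ℝ) ^ 2 - 2) / (4 * n) * greenFunctional 1 hR hC h0 hCH (f * f)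
      linarith)
    (fun f => by
      have := greenFunctional_nonneg hR hC h0 hCH (f := f) (c₀ := 0)
        (c₁ := -(3 * n + ((n : ℝ) ^ 2 - 2) ^ 2 / (4 * n))) (c₂ := -(((n : ℝ) ^ 2 + 2) / 2))
        (c₃ := -(c / 2)) fun t => by
          have h1 := greenDeriv_three_combination t hn
          have h2 : 0 ≤ 1 / (4 * (n : ℝ)) * -(((n : ℝ) ^ 2 - 2) * greenDeriv n 3 t
            + 2 * n * ((n : ℝ) ^ 2 + 2) * greenDeriv n 2 t
            + (12 * (n : ℝ) ^ 2 + ((n : ℝ) ^ 2 - 2) ^ 2) * greenDeriv n 1 t) :=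
            mul_nonneg (by positivity) (by linarith)
          refine h2.trans_eq ?_
          rw [hc]; field_simp; ring
      change 0 ≤ -(c / 2) * greenFunctional 3 hR hC h0 hCH (f * f)
        - ((n : ℝ) ^ 2 + 2) / 2 * greenFunctional 2 hR hC h0 hCH (f * f)
        - (3 * n + ((n : ℝ) ^ 2 - 2) ^ 2 / (4 * n)) * greenFunctional 1 hR hC h0 hCH (f * f)
      linarith)
    α hα' hψ hvT hL
  -- the Euler derivatives of `v` and the Laplacian in Cartesian terms
  have hEr : P.E Cd.rinv = -Cd.rinv := Cd.euler_rinv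
  have hEv : P.E v = Cd.rinv * Cd.rinv * (P.E Vv - (2 : ℝ) • Vv) := by
    rw [hv, Algebra.smul_def, map_ofNat]
    simp only [Derivation.leibniz, smul_eq_mul, hEr]
    ring
  have hEEv : P.E (P.E v) = Cd.rinv * Cd.rinv * (P.E (P.E Vv) - (4 : ℝ) • P.E Vv
      + (4 : ℝ) • Vv) := by
    rw [hEv, Algebra.smul_def, Algebra.smul_def, Algebra.smul_def, map_ofNat, map_ofNat]
    have : P.E (2 : smoothFunctions H) = 0 := by
      rw [← map_ofNat (algebraMap ℝ (smoothFunctions H)) 2, Derivation.map_algebraMap]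
    simp only [Derivation.leibniz, smul_eq_mul, hEr, map_sub, this]
    ring
  have hLV : L = ∑ i, Cd.d i (Cd.d i Vv) := by
    have h1 : Cd.r * Cd.r * v = Vv := by
      rw [hv]; linear_combination (Cd.r * Cd.rinv + 1) * Vv * Cd.r_mul_rinv
    rw [← h1, Cd.sum_d_d_sq_mul, hL]
    rfl
  have hV2 : ∀ x, ContDiffAt ℝ 2 V x := fun x => hV.contDiffAt.of_le ENat.LEInfty.out
  have tr : ∀ x ∈ H, toFun Cd.rinv x = ‖x‖⁻¹ := fun x hx => toFun_ofFun _ _ hx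
  have tV : ∀ x ∈ H, toFun Vv x = V x := fun x hx => toFun_ofFun _ _ hx
  have tE : ∀ x ∈ H, toFun (P.E Vv) x = fderiv ℝ V x x := fun x hx => by
    rw [show P.E Vv = Cd.euler Vv from rfl, toFun_euler hH h0H _ hx, fderiv_toFun_ofFun hH _ _ hx]
  have tEE : ∀ x ∈ H, toFun (P.E (P.E Vv)) x = fderiv ℝ (fderiv ℝ V) x x x + fderiv ℝ V x x := by
    intro x hx
    rw [show P.E (P.E Vv) = Cd.euler (P.E Vv) from rfl, toFun_euler hH h0H _ hx]
    have h1 : toFun (P.E Vv) =ᶠ[𝓝 x] fun y => fderiv ℝ V y y := by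
      filter_upwards [hH.mem_nhds hx] with y hy using tE y hy
    rw [h1.fderiv_eq, (hasFDerivAt_fderiv_apply_self (hV2 x)).fderiv]
    simp
  have tL : ∀ x ∈ H, toFun L x = bilinTrace (fderiv ℝ (fderiv ℝ V) x) := by
    intro x hx
    rw [hLV, toFun_sum, Finset.sum_apply, bilinTrace]
    refine Finset.sum_congr rfl fun i _ => ?_
    rw [show toFun (Cd.d i (Cd.d i Vv)) x = _ from toFun_dirDeriv hH _ _ hx]
    have h1 : toFun (Cd.d i Vv) =ᶠ[𝓝 x] fun y => fderiv ℝ V y (EuclideanSpace.single i 1) := by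
      filter_upwards [hH.mem_nhds hx] with y hy
      rw [show toFun (Cd.d i Vv) y = _ from toFun_dirDeriv hH _ _ hy, fderiv_toFun_ofFun hH _ _ hy]
    rw [h1.fderiv_eq, fderiv_clm_apply
      (((hV2 x).fderiv_right (m := 1) (by norm_num)).differentiableAt one_ne_zero)
      (differentiableAt_const _)]
    simp
  have tv : ∀ x ∈ H, toFun v x = ‖x‖⁻¹ * ‖x‖⁻¹ * V x := fun x hx => by
    rw [hv, toFun_mul, toFun_mul, Pi.mul_apply, Pi.mul_apply, tr x hx, tV x hx]
  have tEv : ∀ x ∈ H, toFun (P.E v) x = ‖x‖⁻¹ * ‖x‖⁻¹ * (fderiv ℝ V x x - 2 * V x) :=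
    fun x hx => by
      simp only [hEv, toFun_sub, toFun_mul, toFun_smul, Pi.sub_apply, Pi.mul_apply, Pi.smul_apply,
        smul_eq_mul, tr x hx, tV x hx, tE x hx]
  have tEEv : ∀ x ∈ H, toFun (P.E (P.E v)) x =
      ‖x‖⁻¹ * ‖x‖⁻¹ * (fderiv ℝ (fderiv ℝ V) x x x - 3 * fderiv ℝ V x x + 4 * V x) :=
    fun x hx => by
      simp only [hEEv, toFun_add, toFun_sub, toFun_mul, toFun_smul, Pi.add_apply, Pi.sub_apply,
        Pi.mul_apply, Pi.smul_apply, smul_eq_mul, tr x hx, tV x hx, tE x hx, tEE x hx]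
      ring
  -- the right-hand side as one integral
  have hrhs : ∫ x in C, jetDensity R x (V x) (fderiv ℝ V x) (fderiv ℝ (fderiv ℝ V) x) =
      W 0 (L * (L + (-2 * (n : ℝ)) • P.E v + (-2 * (n : ℝ)) • v)
          + c • (L * ((2 * (n : ℝ)) • P.E (P.E v) + (2 * (n : ℝ)) • P.E v)))
      + W 1 (L * ((-2 : ℝ) • P.E v + ((n : ℝ) - 2) • v)
          + c • ((-(1 / 2 : ℝ)) • (L * L)
            + L * ((2 : ℝ) • P.E (P.E v) + (-((n : ℝ) - 2)) • P.E v)))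
      + W 2 (L * v - c • (L * P.E v)) := by
    have I := fun k f => integrableOn_green_mul_toFun (H := H) k hR hC h0 hCH f
    change _ = greenFunctional 0 hR hC h0 hCH _ + greenFunctional 1 hR hC h0 hCH _
      + greenFunctional 2 hR hC h0 hCH _
    simp only [greenFunctional_apply]
    rw [← integral_add, ← integral_add]
    · refine setIntegral_congr_fun hC.measurableSet fun x hx => ?_
      have hxH := hCH hx
      simp only [toFun_add, toFun_sub, toFun_mul, toFun_smul, Pi.add_apply,
        Pi.sub_apply, Pi.mul_apply, Pi.smul_apply, smul_eq_mul, tL x hxH, tv x hxH, tEv x hxH,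
        tEEv x hxH, jetDensity, polarDensity, ← hc]
      ring
    exacts [(I 0 _).add (I 1 _), I 2 _, I 0 _, I 1 _]
  have hlhs : ∫ y : Metric.sphere (0 : RSpace n) 1, (V (R • (y : RSpace n)) / R ^ 2) ^ 2
        ∂(volume : Measure (RSpace n)).toSphere = Φ (v * v) := by
    refine integral_congr_ae (.of_forall fun y => ?_)
    simp only [toFun_mul, Pi.mul_apply, hv]
    have hy : ‖R • (y : RSpace n)‖ = R := by simp [norm_smul, abs_of_pos hR]
    by_cases hyH : R • (y : RSpace n) ∈ H
    · rw [tr _ hyH, tV _ hyH, hy]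
      field_simp
    · rw [hVC _ fun h => hyH (hCH h)]
      simp [smoothFunctions.toFun, zeroExtend_of_notMem _ hyH]
  rw [hlhs, hrhs]
  refine main.trans_eq ?_
  simp only [map_add, map_sub, map_smul, smul_eq_mul]
  ring

end GreenDensity

end


/-! ### Laplacians of products with the Green weight -/

section

open scoped ContDiff Topology

section LaplacianOfWeight

open scoped Laplacian

variable {n : ℕ}

lemma laplacian_eq_bilinTrace (f : RSpace n → ℝ) (x : RSpace n) :
    (Δ f) x = bilinTrace (fderiv ℝ (fderiv ℝ f) x) := by
  rw [InnerProductSpace.laplacian_eq_iteratedFDeriv_orthonormalBasis f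
    (EuclideanSpace.basisFun (Fin n) ℝ)]
  simp [bilinTrace, iteratedFDeriv_two_apply]

lemma bilinTrace_add (M N : RSpace n →L[ℝ] RSpace n →L[ℝ] ℝ) :
    bilinTrace (M + N) = bilinTrace M + bilinTrace N := by
  simp [bilinTrace, Finset.sum_add_distrib]

lemma bilinTrace_smul (c : ℝ) (M : RSpace n →L[ℝ] RSpace n →L[ℝ] ℝ) :
    bilinTrace (c • M) = c * bilinTrace M := by
  simp [bilinTrace, Finset.mul_sum]

lemma abs_bilinTrace_le (M : RSpace n →L[ℝ] RSpace n →L[ℝ] ℝ) :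
    |bilinTrace M| ≤ n * ‖M‖ := by
  refine (Finset.abs_sum_le_sum_abs _ _).trans ?_
  refine (Finset.sum_le_sum fun i _ => (M.le_opNorm₂ _ _)).trans ?_
  simp

lemma continuous_bilinTrace : Continuous (bilinTrace (n := n)) := by
  unfold bilinTrace; fun_prop

lemma laplacian_mul {f g : RSpace n → ℝ} {x : RSpace n} (hf : ContDiffAt ℝ 2 f x)
    (hg : ContDiffAt ℝ 2 g x) :
    (Δ (fun y => f y * g y)) x = f x * (Δ g) x
      + 2 * ∑ i, fderiv ℝ f x (EuclideanSpace.single i 1) * fderiv ℝ g x (EuclideanSpace.single i 1)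
      + g x * (Δ f) x := by
  have d1 : ∀ {h : RSpace n → ℝ}, ContDiffAt ℝ 2 h x → ∀ᶠ y in 𝓝 x, DifferentiableAt ℝ h y := by
    intro h hh
    filter_upwards [hh.eventually (by simp)] with y hy using hy.differentiableAt two_ne_zero
  have d2 : ∀ {h : RSpace n → ℝ}, ContDiffAt ℝ 2 h x → DifferentiableAt ℝ (fderiv ℝ h) x :=
    fun hh => (hh.fderiv_right (m := 1) (by norm_num)).differentiableAt one_ne_zero
  have h1 : fderiv ℝ (fun y => f y * g y) =ᶠ[𝓝 x] fun y => f y • fderiv ℝ g y + g y • fderiv ℝ f y := by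
    filter_upwards [d1 hf, d1 hg] with y hfy hgy using fderiv_fun_mul hfy hgy
  have h2 := ((d1 hf).self_of_nhds.hasFDerivAt.smul (d2 hg).hasFDerivAt).add
    ((d1 hg).self_of_nhds.hasFDerivAt.smul (d2 hf).hasFDerivAt)
  simp only [laplacian_eq_bilinTrace]
  rw [h1.fderiv_eq, show fderiv ℝ (fun y => f y • fderiv ℝ g y + g y • fderiv ℝ f y) x = _ from
    HasFDerivAt.fderiv h2]
  simp only [bilinTrace, Finset.mul_sum]
  rw [← Finset.sum_add_distrib, ← Finset.sum_add_distrib]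
  refine Finset.sum_congr rfl fun i _ => ?_
  simp
  ring

/-- The Green weights are bounded, although `|x|⁻ⁿ` is not: `g` decays like `e^{-nt}`. -/
lemma exists_bound_radialWeight_greenDeriv (hn : 0 < n) {R : ℝ} (hR : 0 < R) (k : ℕ) :
    ∃ G, ∀ x : RSpace n, |radialWeight n R (greenDeriv n k) x| ≤ G := by
  set s := √((n : ℝ) ^ 2 + 8)
  set a := greenRoot n
  have ha : 0 < a := greenRoot_pos
  set κ := 1 / (2 * n * s)
  set A := κ * (n * a ^ k + s) + κ * (n * (n + a) ^ k + s * n ^ k)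
  have hκ : 0 ≤ κ := by positivity
  have hs : 0 ≤ s := Real.sqrt_nonneg _
  have hA : ∀ t, |greenDeriv n k t| ≤ A * Real.exp (-n * t) := by
    intro t
    unfold greenDeriv
    split_ifs with ht
    · have e1 : Real.exp (a * t) ≤ 1 := Real.exp_le_one_iff.2 (by nlinarith)
      have e2 : 1 ≤ Real.exp (-n * t) := Real.one_le_exp (by
        have : (0 : ℝ) ≤ n := n.cast_nonneg
        nlinarith)
      have e3 : |(0 : ℝ) ^ k| ≤ 1 := by
        rcases Nat.eq_zero_or_pos k with h | h
        · simp [h]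
        · simp [zero_pow h.ne']
      calc |greenNeg n k t| ≤ κ * (n * a ^ k * 1 + s * 1) := by
            unfold greenNeg
            rw [abs_mul, abs_neg, abs_of_nonneg hκ]
            gcongr
            refine (abs_sub _ _).trans ?_
            rw [abs_mul, abs_mul s, abs_of_nonneg hs, abs_of_nonneg (by positivity :
              (0 : ℝ) ≤ n * greenRoot n ^ k), Real.abs_exp]
            gcongr
        _ ≤ A * 1 := by
            have : 0 ≤ κ * (n * (n + a) ^ k + s * n ^ k) := by positivity
            simp only [A]; linarith
        _ ≤ _ := by gcongr
    · have e1 : Real.exp (-(n + a) * t) ≤ Real.exp (-n * t) := Real.exp_le_exp.2 (by nlinarith)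
      calc |greenPos n k t| ≤ κ * (n * (n + a) ^ k * Real.exp (-n * t)
              + s * n ^ k * Real.exp (-n * t)) := by
            unfold greenPos
            rw [abs_mul, abs_neg, abs_of_nonneg hκ]
            gcongr
            refine (abs_sub _ _).trans ?_
            rw [abs_mul, abs_mul, abs_mul, abs_mul, abs_of_nonneg hs, abs_pow, abs_pow, abs_neg,
              abs_neg, Nat.abs_cast, abs_of_nonneg (by positivity : 0 ≤ (n : ℝ) + greenRoot n),
              Real.abs_exp, Real.abs_exp]
            gcongr
        _ ≤ A * Real.exp (-n * t) := by
            rw [← add_mul, ← mul_assoc]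
            gcongr
            have : 0 ≤ κ * (n * a ^ k + s) := by positivity
            simp only [A]; linarith
  refine ⟨A / R ^ n, fun x => ?_⟩
  have hA0 : 0 ≤ A := by positivity
  rcases eq_or_ne x 0 with rfl | hx
  · simp only [radialWeight, norm_zero, zero_pow hn.ne', div_zero, abs_zero]
    positivity
  · have hx' : 0 < ‖x‖ := norm_pos_iff.2 hx
    rw [radialWeight, abs_div, abs_of_pos (pow_pos hx' n), div_le_div_iff₀ (by positivity)
      (by positivity)]
    have h1 : Real.exp (-n * Real.log (R / ‖x‖)) = ‖x‖ ^ n / R ^ n := by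
      rw [neg_mul, Real.exp_neg, mul_comm, Real.exp_mul, Real.exp_log (by positivity),
        Real.rpow_natCast, div_pow, inv_div]
    have h2 := hA (Real.log (R / ‖x‖))
    rw [h1] at h2
    calc _ ≤ A * (‖x‖ ^ n / R ^ n) * R ^ n := by gcongr
      _ = _ := by field_simp

lemma hasFDerivAt_radialWeight_greenDeriv {R : ℝ} (hR : 0 < R) {k : ℕ} (hk : k < 2)
    {x : RSpace n} (hx : x ≠ 0) :
    HasFDerivAt (radialWeight n R (greenDeriv n k))
      ((-(n * radialWeight n R (greenDeriv n k) x + radialWeight n R (greenDeriv n (k + 1)) x)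
        / ‖x‖ ^ 2) • innerSL ℝ x) x := by
  have hx' : 0 < ‖x‖ := norm_pos_iff.2 hx
  have h1 : HasDerivAt (fun r : ℝ => greenDeriv n k (Real.log (R / r)) / r ^ n)
      (-(n * (greenDeriv n k (Real.log (R / ‖x‖)) / ‖x‖ ^ n)
        + greenDeriv n (k + 1) (Real.log (R / ‖x‖)) / ‖x‖ ^ n) / ‖x‖) ‖x‖ := by
    have := ((hasDerivAt_greenDeriv (n := n) hk _).comp ‖x‖ (hasDerivAt_log_div hR hx')).div
      (hasDerivAt_pow n ‖x‖) (pow_pos hx' n).ne'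
    refine this.congr_deriv ?_
    simp only [Function.comp]
    rcases Nat.eq_zero_or_pos n with rfl | hn
    · simp; ring
    · obtain ⟨m, rfl⟩ : ∃ m, n = m + 1 := ⟨n - 1, by omega⟩
      simp only [Nat.add_sub_cancel]
      field_simp
      ring
  have h2 : HasFDerivAt (fun y : RSpace n => ‖y‖) (‖x‖⁻¹ • innerSL ℝ x) x := by
    have := (hasStrictFDerivAt_norm_sq x).hasFDerivAt.sqrt (by positivity)
    refine (this.congr_of_eventuallyEq (.of_forall fun y => by simp)).congr_fderiv ?_
    ext y
    simp [Real.sqrt_sq hx'.le]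
    ring
  refine (h1.comp_hasFDerivAt x h2).congr_fderiv ?_
  ext y
  simp [radialWeight]
  field_simp

lemma fderiv_radialWeight_greenDeriv {R : ℝ} (hR : 0 < R) {k : ℕ} (hk : k < 2)
    {x : RSpace n} (hx : x ≠ 0) (y : RSpace n) :
    fderiv ℝ (radialWeight n R (greenDeriv n k)) x y =
      -(n * radialWeight n R (greenDeriv n k) x + radialWeight n R (greenDeriv n (k + 1)) x)
        / ‖x‖ ^ 2 * inner ℝ x y := by
  rw [(hasFDerivAt_radialWeight_greenDeriv hR hk hx).fderiv]; simp

lemma contDiffAt_one_radialWeight {R : ℝ} (hR : 0 < R) {k : ℕ} (hk : k < 2)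
    {x : RSpace n} (hx : x ≠ 0) : ContDiffAt ℝ 1 (radialWeight n R (greenDeriv n k)) x := by
  have hopen : IsOpen ({0}ᶜ : Set (RSpace n)) := isOpen_compl_singleton
  refine ContDiffOn.contDiffAt (s := {0}ᶜ) ?_ (hopen.mem_nhds hx)
  refine (contDiffOn_succ_iff_fderiv_of_isOpen (n := 0) hopen).2 ⟨fun y hy =>
    (hasFDerivAt_radialWeight_greenDeriv hR hk hy).differentiableAt.differentiableWithinAt,
    by simp, contDiffOn_zero.2 ?_⟩
  have := (((continuousOn_radialWeight (n := n) hR (continuous_greenDeriv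
    (n := n) (k := k) (by omega))).const_mul (n : ℝ)).add (continuousOn_radialWeight hR (continuous_greenDeriv
    (n := n) (k := k + 1) (by omega)))).neg.div (continuous_norm.pow 2).continuousOn
    (fun y hy => pow_ne_zero 2 (norm_ne_zero_iff.2 hy))
  exact (this.smul (innerSL ℝ).continuous.continuousOn).congr fun y hy =>
    (hasFDerivAt_radialWeight_greenDeriv hR hk hy).fderiv

lemma contDiffAt_two_radialWeight {R : ℝ} (hR : 0 < R) {x : RSpace n} (hx : x ≠ 0) :
    ContDiffAt ℝ 2 (radialWeight n R (greenDeriv n 0)) x := by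
  have hopen : IsOpen ({0}ᶜ : Set (RSpace n)) := isOpen_compl_singleton
  refine ContDiffOn.contDiffAt (s := {0}ᶜ) ?_ (hopen.mem_nhds hx)
  refine (contDiffOn_succ_iff_fderiv_of_isOpen (n := 1) hopen).2 ⟨fun y hy =>
    (hasFDerivAt_radialWeight_greenDeriv hR (by norm_num) hy).differentiableAt.differentiableWithinAt,
    by simp, ?_⟩
  intro y hy
  have c := fun k (hk : k < 2) => contDiffAt_one_radialWeight (n := n) hR hk hy
  have := ((contDiffAt_const (c := (n : ℝ))).mul (c 0 (by norm_num))).add (c 1 (by norm_num))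
    |>.neg.div (contDiff_norm_sq ℝ (n := 1)).contDiffAt (pow_ne_zero 2 (norm_ne_zero_iff.2 hy))
  refine ((this.smul (innerSL ℝ).contDiff.contDiffAt).congr_of_eventuallyEq
    ?_).contDiffWithinAt
  filter_upwards [hopen.mem_nhds hy] with z hz
  exact (hasFDerivAt_radialWeight_greenDeriv hR (by norm_num) hz).fderiv

lemma laplacian_radialWeight {R : ℝ} (hR : 0 < R) {x : RSpace n} (hx : x ≠ 0) :
    (Δ (radialWeight n R (greenDeriv n 0))) x =
      (radialWeight n R (greenDeriv n 2) x + (n + 2) * radialWeight n R (greenDeriv n 1) x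
        + 2 * n * radialWeight n R (greenDeriv n 0) x) / ‖x‖ ^ 2 := by
  have hx' : 0 < ‖x‖ := norm_pos_iff.2 hx
  have hopen : IsOpen ({0}ᶜ : Set (RSpace n)) := isOpen_compl_singleton
  have h0 := hasFDerivAt_radialWeight_greenDeriv (n := n) hR (k := 0) (by norm_num) hx
  have h1 := hasFDerivAt_radialWeight_greenDeriv (n := n) hR (k := 1) (by norm_num) hx
  have h2 := (hasStrictFDerivAt_norm_sq x).hasFDerivAt
  set β : RSpace n → ℝ := fun z => -(n * radialWeight n R (greenDeriv n 0) z
    + radialWeight n R (greenDeriv n 1) z) / ‖z‖ ^ 2 with hβ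
  obtain ⟨B, hB, hBx⟩ : ∃ B : RSpace n →L[ℝ] ℝ, HasFDerivAt β B x ∧ B x =
      (n * (n * radialWeight n R (greenDeriv n 0) x + radialWeight n R (greenDeriv n 1) x)
        + (n * radialWeight n R (greenDeriv n 1) x + radialWeight n R (greenDeriv n 2) x)
        + 2 * (n * radialWeight n R (greenDeriv n 0) x + radialWeight n R (greenDeriv n 1) x))
          / ‖x‖ ^ 2 := by
    refine ⟨_, (((h0.const_mul (n : ℝ)).add h1).neg.mul
      ((hasDerivAt_inv (by positivity)).comp_hasFDerivAt x h2)).congr_of_eventuallyEq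
      (.of_forall fun z => by simp [hβ, div_eq_mul_inv]), ?_⟩
    simp
    field_simp
    ring
  set I : RSpace n →L[ℝ] RSpace n →L[ℝ] ℝ := innerSL ℝ with hI
  have h3 : HasFDerivAt (fun z => β z • I z) (β x • I + B.smulRight (I x)) x :=
    hB.smul I.hasFDerivAt
  have h4 : fderiv ℝ (radialWeight n R (greenDeriv n 0)) =ᶠ[𝓝 x] fun z => β z • I z := by
    filter_upwards [hopen.mem_nhds hx] with z hz
    exact (hasFDerivAt_radialWeight_greenDeriv hR (k := 0) (by norm_num) hz).fderiv
  have h5 : bilinTrace (β x • I + B.smulRight (I x)) = n * β x + B x := by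
    have e : ∀ y z, I y z = inner ℝ y z := fun y z => rfl
    rw [bilinTrace_add, bilinTrace_smul, ← sum_apply_single_mul B x]
    simp [bilinTrace, e, mul_comm, EuclideanSpace.inner_single_right]
  rw [laplacian_eq_bilinTrace, h4.fderiv_eq, h3.fderiv, h5, hBx]
  simp only [hβ]
  field_simp
  ring

/-- The Laplacian of a product with the Green weight `γ₀`. -/
lemma laplacian_mul_greenWeight {R : ℝ} (hR : 0 < R) {f : RSpace n → ℝ} {x : RSpace n} (hx : x ≠ 0)
    (hf : ContDiffAt ℝ 2 f x) :
    (Δ (fun y => f y * radialWeight n R (greenDeriv n 0) y)) x =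
      radialWeight n R (greenDeriv n 0) x * (Δ f) x
        - 2 * (n * radialWeight n R (greenDeriv n 0) x + radialWeight n R (greenDeriv n 1) x)
          / ‖x‖ ^ 2 * fderiv ℝ f x x
        + (radialWeight n R (greenDeriv n 2) x + (n + 2) * radialWeight n R (greenDeriv n 1) x
          + 2 * n * radialWeight n R (greenDeriv n 0) x) / ‖x‖ ^ 2 * f x := by
  rw [laplacian_mul hf (contDiffAt_two_radialWeight hR hx), laplacian_radialWeight hR hx]
  have hs : ∑ i, fderiv ℝ f x (EuclideanSpace.single i 1)
      * fderiv ℝ (radialWeight n R (greenDeriv n 0)) x (EuclideanSpace.single i 1) =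
      -(n * radialWeight n R (greenDeriv n 0) x + radialWeight n R (greenDeriv n 1) x)
        / ‖x‖ ^ 2 * fderiv ℝ f x x := by
    rw [← sum_apply_single_mul (fderiv ℝ f x) x, Finset.mul_sum]
    refine Finset.sum_congr rfl fun i _ => ?_
    rw [fderiv_radialWeight_greenDeriv hR (by norm_num) hx]
    simp [EuclideanSpace.inner_single_right]
    ring
  rw [hs]
  ring

/-- The Laplacian at `x` of the product of the weight `γ₀` with a function whose value, Euler
derivative `x · ∇` and Laplacian at `x` are `a`, `p` and `L`. -/
noncomputable def laplaceMulDensity (R : ℝ) (x : RSpace n) (a p L : ℝ) : ℝ :=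
  radialWeight n R (greenDeriv n 0) x * L
    - 2 * (n * radialWeight n R (greenDeriv n 0) x + radialWeight n R (greenDeriv n 1) x)
      / ‖x‖ ^ 2 * p
    + (radialWeight n R (greenDeriv n 2) x + (n + 2) * radialWeight n R (greenDeriv n 1) x
      + 2 * n * radialWeight n R (greenDeriv n 0) x) / ‖x‖ ^ 2 * a

/-- The density `jetDensity` in terms of the Laplacians of `u γ₀` and `(x · ∇u) γ₀`. The second is
`laplaceMulDensity` with `x · ∇u`, `(x · ∇)² u` and `2 Δu` in place of `u`, `x · ∇u` and `Δu`. -/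
lemma jetDensity_eq (hn : 0 < n) (R : ℝ) {x : RSpace n} (hx : x ≠ 0) (a : ℝ) (p : RSpace n →L[ℝ] ℝ)
    (M : RSpace n →L[ℝ] RSpace n →L[ℝ] ℝ) :
    jetDensity R x a p M =
      ((n : ℝ) ^ 2 + n - 2) / n * (bilinTrace M * laplaceMulDensity R x a (p x) (bilinTrace M))
      - ((n : ℝ) ^ 2 - 2) / (2 * n) *
        (bilinTrace M * laplaceMulDensity R x (p x) (M x x + p x) (2 * bilinTrace M)
          + 1 / 2 * radialWeight n R (greenDeriv n 1) x * bilinTrace M ^ 2) := by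
  have hx' : ‖x‖ ≠ 0 := norm_ne_zero_iff.2 hx
  have hn' : (n : ℝ) ≠ 0 := by exact_mod_cast hn.ne'
  unfold jetDensity polarDensity laplaceMulDensity
  field_simp
  ring

end LaplacianOfWeight

end


/-! ### Zero extension and approximation by test functions -/

section

open scoped ContDiff Topology NNReal

section ZeroExtension

variable {E F : Type*} [NormedAddCommGroup E] [NormedSpace ℝ E] [NormedAddCommGroup F]

/-- A Lipschitz function on `s` that vanishes on the frontier stays Lipschitz when extended
by zero. -/
lemma LipschitzOnWith.lipschitzWith_indicator {s : Set E} {f : E → F} {B : ℝ≥0}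
    (hf : LipschitzOnWith B f s) (hs : IsClosed s) (h0 : ∀ x ∈ frontier s, f x = 0) :
    LipschitzWith B (s.indicator f) := by
  have key : ∀ x ∈ s, ∀ y ∉ s, dist (s.indicator f x) (s.indicator f y) ≤ B * dist x y := by
    intro x hx y hy
    obtain ⟨z, hz, hzf⟩ : ∃ z ∈ segment ℝ x y, z ∈ frontier s := by
      by_contra! hcon
      have hx' : x ∈ interior s := by
        by_contra h
        exact hcon x (left_mem_segment ℝ x y) ⟨subset_closure hx, h⟩
      obtain ⟨z, -, hz1, hz2⟩ := (convex_segment (𝕜 := ℝ) x y).isPreconnected _ _ isOpen_interior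
        hs.isOpen_compl (fun z hz => by
          by_cases hzs : z ∈ s
          · by_contra h
            exact hcon z hz ⟨subset_closure hzs, fun h' => h (Or.inl h')⟩
          · exact Or.inr hzs) ⟨x, left_mem_segment ℝ x y, hx'⟩ ⟨y, right_mem_segment ℝ x y, hy⟩
      exact hz2 (interior_subset hz1)
    have hzs : z ∈ s := hs.frontier_subset hzf
    rw [Set.indicator_of_mem hx, Set.indicator_of_notMem hy, ← h0 z hzf]
    refine (hf.dist_le_mul x hx z hzs).trans ?_
    gcongr
    have := dist_add_dist_of_mem_segment hz
    linarith [dist_nonneg (x := z) (y := y)]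
  refine LipschitzWith.of_dist_le_mul fun x y => ?_
  by_cases hx : x ∈ s <;> by_cases hy : y ∈ s
  · rw [Set.indicator_of_mem hx, Set.indicator_of_mem hy]; exact hf.dist_le_mul x hx y hy
  · exact key x hx y hy
  · rw [dist_comm, dist_comm x]; exact key y hy x hx
  · rw [Set.indicator_of_notMem hx, Set.indicator_of_notMem hy, dist_self]; positivity

variable [NormedSpace ℝ F]

lemma hasFDerivAt_indicator {s : Set E} (hs : IsClosed s) {f : E → F}
    (hf : DifferentiableOn ℝ f s) (h0 : ∀ x ∈ frontier s, f x = 0)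
    (h0' : ∀ x ∈ frontier s, fderivWithin ℝ f s x = 0) (x : E) :
    HasFDerivAt (s.indicator f) (s.indicator (fderivWithin ℝ f s) x) x := by
  by_cases hx : x ∈ s
  · rw [Set.indicator_of_mem hx]
    have h1 : HasFDerivWithinAt (s.indicator f) (fderivWithin ℝ f s x) s x :=
      (hf x hx).hasFDerivWithinAt.congr (fun y hy => Set.indicator_of_mem hy f)
        (Set.indicator_of_mem hx f)
    by_cases hxi : x ∈ interior s
    · exact h1.hasFDerivAt (mem_interior_iff_mem_nhds.1 hxi)
    · have hxf : x ∈ frontier s := ⟨subset_closure hx, hxi⟩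
      have h2 : HasFDerivWithinAt (s.indicator f) (fderivWithin ℝ f s x) sᶜ x := by
        rw [h0' x hxf]
        exact (hasFDerivWithinAt_const (0 : F) x sᶜ).congr
          (fun y hy => Set.indicator_of_notMem hy f)
          ((Set.indicator_of_mem hx f).trans (h0 x hxf))
      have h3 := h1.union h2
      rwa [Set.union_compl_self, hasFDerivWithinAt_univ] at h3
  · rw [Set.indicator_of_notMem hx]
    refine (hasFDerivAt_const (0 : F) x).congr_of_eventuallyEq ?_
    filter_upwards [hs.isOpen_compl.mem_nhds hx] with y hy using Set.indicator_of_notMem hy f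

lemma HasFDerivAt.comp_dilation {G : E → F} {x₀ x : E} {l : ℝ} {m : E →L[ℝ] F}
    (h : HasFDerivAt G m (x₀ + l • (x - x₀))) :
    HasFDerivAt (fun y => G (x₀ + l • (y - x₀))) (l • m) x := by
  have h1 : HasFDerivAt (fun y : E => x₀ + l • (y - x₀)) (l • ContinuousLinearMap.id ℝ E) x :=
    (((hasFDerivAt_id x).sub_const x₀).const_smul l).const_add x₀
  refine (h.comp x h1).congr_fderiv ?_
  ext y
  simp

lemma HasFDerivAt.const_smul_comp_dilation {G : E → F} {x₀ x : E} {c l : ℝ} {m : E →L[ℝ] F}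
    (h : HasFDerivAt G m (x₀ + l • (x - x₀))) :
    HasFDerivAt (fun y => c • G (x₀ + l • (y - x₀))) (c • l • m) x :=
  h.comp_dilation.const_smul c

-- Instance search does not find `NormSMulClass` on spaces of bilinear maps directly.
lemma ContinuousLinearMap.norm_smul_eq (c : ℝ) (m : E →L[ℝ] F) : ‖c • m‖ = ‖c‖ * ‖m‖ :=
  norm_smul _ _

lemma ContinuousLinearMap.norm_le_of_tendsto {m : ℕ → E →L[ℝ] F} {m' : E →L[ℝ] F} {B : ℝ}
    (h : Filter.Tendsto m .atTop (𝓝 m')) (hB : ∀ k, ‖m k‖ ≤ B) : ‖m'‖ ≤ B :=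
  le_of_tendsto h.norm (.of_forall hB)

/-- A function that is `C²` up to the boundary of a bounded convex domain, and has vanishing Cauchy
data there, extends by zero to a `C^{1,1}` function. -/
theorem exists_extension_of_cauchy_data_eq_zero [FiniteDimensional ℝ E] {Ω : Set E}
    (hΩ : IsOpen Ω) (hconv : Convex ℝ Ω) (hb : Bornology.IsBounded Ω) (hne : Ω.Nonempty)
    {u : E → ℝ} (hu : ContDiffOn ℝ 2 u (closure Ω)) (h0 : ∀ x ∈ frontier Ω, u x = 0)
    (h0' : ∀ x ∈ frontier Ω, fderivWithin ℝ u (closure Ω) x = 0) :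
    ∃ (U : E → ℝ) (B : ℝ≥0), Differentiable ℝ U ∧ LipschitzWith B (fderiv ℝ U) ∧
      (∀ x ∉ Ω, U x = 0) ∧ Set.EqOn U u Ω := by
  set K := closure Ω with hK
  have hKc : IsCompact K := hb.isCompact_closure
  have hKconv : Convex ℝ K := hconv.closure
  have hint : (interior K).Nonempty := by
    obtain ⟨x, hx⟩ := hne
    exact ⟨x, interior_mono subset_closure (by rwa [hΩ.interior_eq])⟩
  have hud : UniqueDiffOn ℝ K := uniqueDiffOn_convex hKconv hint
  have hfr : frontier K ⊆ frontier Ω := frontier_closure_subset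
  have h1 : ContDiffOn ℝ 1 (fderivWithin ℝ u K) K := hu.fderivWithin hud (by norm_num)
  obtain ⟨B, hB⟩ := hKc.exists_bound_of_continuousOn (h1.continuousOn_fderivWithin hud le_rfl)
  have hlip : LipschitzOnWith B.toNNReal (fderivWithin ℝ u K) K :=
    hKconv.lipschitzOnWith_of_nnnorm_fderivWithin_le (h1.differentiableOn one_ne_zero) fun x hx =>
      NNReal.coe_le_coe.1 (by simpa using Or.inl (hB x hx))
  have hder := hasFDerivAt_indicator isClosed_closure (hu.differentiableOn two_ne_zero)
    (fun x hx => h0 x (hfr hx)) fun x hx => h0' x (hfr hx)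
  refine ⟨K.indicator u, B.toNNReal, fun x => (hder x).differentiableAt, ?_, fun x hx => ?_,
    fun x hx => Set.indicator_of_mem (subset_closure hx) u⟩
  · rw [show fderiv ℝ (K.indicator u) = K.indicator (fderivWithin ℝ u K) from
      funext fun x => (hder x).fderiv]
    exact hlip.lipschitzWith_indicator isClosed_closure fun x hx => h0' x (hfr hx)
  · by_cases hxK : x ∈ K
    · rw [Set.indicator_of_mem hxK]
      exact h0 x ⟨hxK, by rwa [hΩ.interior_eq]⟩
    · exact Set.indicator_of_notMem hxK u

end ZeroExtension

section Mollification

open scoped Convolution Pointwise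
open ContinuousLinearMap (lsmul)

variable {E F : Type*} [NormedAddCommGroup E] [InnerProductSpace ℝ E] [FiniteDimensional ℝ E]
  [MeasurableSpace E] [BorelSpace E] [NormedAddCommGroup F] [NormedSpace ℝ F]

/-- The convolution of `G` with the normalized bump function `φ`. -/
noncomputable def mollify (φ : ContDiffBump (0 : E)) (G : E → F) : E → F :=
  φ.normed volume ⋆[lsmul ℝ ℝ, volume] G

lemma norm_mollify_le (φ : ContDiffBump (0 : E)) {G : E → F} {B : ℝ}
    (hG : ∀ x, ‖G x‖ ≤ B) (x : E) : ‖mollify φ G x‖ ≤ B := by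
  rw [mollify, convolution_def]
  refine (norm_integral_le_of_norm_le (φ.integrable_normed.mul_const B)
    (.of_forall fun y => ?_)).trans_eq ?_
  · rw [ContinuousLinearMap.lsmul_apply, norm_smul, Real.norm_of_nonneg (φ.nonneg_normed y)]
    exact mul_le_mul_of_nonneg_left (hG _) (φ.nonneg_normed y)
  · rw [integral_mul_const, φ.integral_normed, one_mul]

/-- The mollification of a Lipschitz function has the mollified almost everywhere derivative. -/
lemma LipschitzWith.hasFDerivAt_mollify [FiniteDimensional ℝ F]
    (φ : ContDiffBump (0 : E)) {G : E → F} {B : ℝ≥0}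
    (hG : LipschitzWith B G) (x : E) :
    HasFDerivAt (mollify φ G)
      (mollify φ (fderiv ℝ G) x) x := by
  have hc : ∀ z, Continuous fun y => φ.normed volume y • G (z - y) := fun z =>
    φ.continuous_normed.smul (hG.continuous.comp (continuous_const.sub continuous_id))
  have hcs : ∀ z, HasCompactSupport fun y => φ.normed volume y • G (z - y) := fun z =>
    φ.hasCompactSupport_normed.smul_right
  refine (hasFDerivAt_integral_of_dominated_loc_of_lip (μ := volume)
    (F := fun z y => φ.normed volume y • G (z - y)) (s := Set.univ)
    (F' := fun y => φ.normed volume y • fderiv ℝ G (x - y))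
    (bound := fun y => φ.normed volume y * B) Filter.univ_mem
    (.of_forall fun z => (hc z).aestronglyMeasurable)
    ((hc x).integrable_of_hasCompactSupport (hcs x)) ?_ (.of_forall fun y => ?_)
    (φ.integrable_normed.mul_const _) ?_).2
  · exact φ.continuous_normed.aestronglyMeasurable.smul
      ((measurable_fderiv ℝ G).comp (measurable_const.sub measurable_id)).aestronglyMeasurable
  · refine LipschitzOnWith.of_dist_le_mul fun z _ w _ => ?_
    have h1 := φ.nonneg_normed (μ := volume) y
    rw [dist_smul₀, Real.norm_of_nonneg h1, Real.coe_nnabs, abs_of_nonneg (by positivity), mul_assoc]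
    gcongr
    simpa using hG.dist_le_mul (z - y) (w - y)
  · have h1 : ∀ᵐ y : E, DifferentiableAt ℝ G (x - y) :=
      (quasiMeasurePreserving_sub_left volume x).ae (hG.ae_differentiableAt)
    filter_upwards [h1] with y hy
    exact (hy.hasFDerivAt.comp x ((hasFDerivAt_id x).sub_const y)).const_smul _

lemma tendsto_mollify [CompleteSpace F] {φ : ℕ → ContDiffBump (0 : E)}
    (hφ : Filter.Tendsto (fun k => (φ k).rOut) .atTop (𝓝 0)) {z : ℕ → E} {x : E}
    (hz : Filter.Tendsto z .atTop (𝓝 x)) {G : E → F} (hm : AEStronglyMeasurable G volume)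
    (hc : ContinuousAt G x) :
    Filter.Tendsto (fun k => mollify (φ k) G (z k)) .atTop
      (𝓝 (G x)) :=
  ContDiffBump.convolution_tendsto_right (g := fun _ => G) hφ (.of_forall fun _ => hm)
    (hc.tendsto.comp Filter.tendsto_snd) hz

/-- A sequence of test functions on `Ω`, with uniformly bounded second derivatives, that tends to `U`
along with its first two derivatives. -/
structure TestApproximation (Ω : Set E) (U : E → ℝ) where
  V : ℕ → E → ℝ
  C : ℕ → Set E
  bound : ℝ
  contDiff : ∀ k, ContDiff ℝ ∞ (V k)
  isCompact : ∀ k, IsCompact (C k)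
  subset : ∀ k, C k ⊆ Ω
  eq_zero : ∀ k, ∀ x ∉ C k, V k x = 0
  norm_le : ∀ k x, ‖fderiv ℝ (fderiv ℝ (V k)) x‖ ≤ bound
  tendsto : ∀ x, Filter.Tendsto (fun k => V k x) .atTop (𝓝 (U x))
  tendsto_fderiv : ∀ x, Filter.Tendsto (fun k => fderiv ℝ (V k) x) .atTop (𝓝 (fderiv ℝ U x))
  tendsto_fderiv_fderiv : ∀ x ∈ Ω, Filter.Tendsto (fun k => fderiv ℝ (fderiv ℝ (V k)) x) .atTop
    (𝓝 (fderiv ℝ (fderiv ℝ U) x))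

/-- A `C^{1,1}` function that vanishes off a bounded convex domain and is `C²` in it is approximated
by the mollifications of its contractions towards a point of the domain. -/
theorem nonempty_testApproximation {Ω : Set E} (hΩ : IsOpen Ω) (hconv : Convex ℝ Ω)
    (hb : Bornology.IsBounded Ω) (hne : Ω.Nonempty) {U : E → ℝ} {B : ℝ≥0} (hU : Differentiable ℝ U)
    (hL : LipschitzWith B (fderiv ℝ U)) (h0 : ∀ x ∉ Ω, U x = 0) (h2 : ContDiffOn ℝ 2 U Ω) :
    Nonempty (TestApproximation Ω U) := by
  obtain ⟨x₀, hx₀⟩ := hne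
  obtain ⟨ρ, hρ, hball⟩ := Metric.isOpen_iff.1 hΩ x₀ hx₀
  set K := closure Ω with hK
  have hKc : IsCompact K := hb.isCompact_closure
  -- `U` itself is Lipschitz
  have hUcs : HasCompactSupport U := HasCompactSupport.intro hKc fun x hx =>
    h0 x fun h => hx (subset_closure h)
  obtain ⟨B₁, hB₁⟩ := (hUcs.fderiv ℝ).exists_bound_of_continuous hL.continuous
  have hUL : LipschitzWith B₁.toNNReal U := lipschitzWith_of_nnnorm_fderiv_le hU fun x =>
    NNReal.coe_le_coe.1 (by simpa using Or.inl (hB₁ x))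
  set l : ℕ → ℝ := fun k => ((k : ℝ) + 2) / (k + 1) with hl
  have hl1 : ∀ k, 1 ≤ l k := fun k => by
    rw [hl, one_le_div (by positivity)]; linarith
  have hl2 : ∀ k, l k ≤ 2 := fun k => by
    rw [hl, div_le_iff₀ (by positivity)]; linarith [(Nat.cast_nonneg k : (0 : ℝ) ≤ k)]
  have hlt : Filter.Tendsto l .atTop (𝓝 1) := by
    have h := (tendsto_one_div_add_atTop_nhds_zero_nat (𝕜 := ℝ)).const_add 1
    rw [add_zero] at h
    refine h.congr fun k => ?_
    simp only [hl]; field_simp; ring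
  set φ : ℕ → ContDiffBump (0 : E) := fun k =>
    ⟨ρ / (4 * (k + 1)), ρ / (2 * (k + 1)), by positivity, by gcongr; norm_num⟩ with hφ
  have hφt : Filter.Tendsto (fun k => (φ k).rOut) .atTop (𝓝 0) := by
    have h := (tendsto_one_div_add_atTop_nhds_zero_nat (𝕜 := ℝ)).const_mul (ρ / 2)
    rw [mul_zero] at h
    refine h.congr fun k => ?_
    simp only [hφ]; field_simp
  set A : ℕ → E → E := fun k x => x₀ + l k • (x - x₀) with hA
  have hAt : ∀ x, Filter.Tendsto (fun k => A k x) .atTop (𝓝 x) := fun x => by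
    have h := (hlt.smul_const (x - x₀)).const_add x₀
    simpa using h
  set V : ℕ → E → ℝ := fun k x => mollify (φ k) U (A k x) with hV
  have d1 : ∀ k x, HasFDerivAt (V k)
      (l k • mollify (φ k) (fderiv ℝ U) (A k x)) x := fun k x =>
    (hUL.hasFDerivAt_mollify (φ k) _).comp_dilation
  have e1 : ∀ k, fderiv ℝ (V k) = fun x =>
      l k • mollify (φ k) (fderiv ℝ U) (A k x) :=
    fun k => funext fun x => (d1 k x).fderiv
  have e2 : ∀ k x, fderiv ℝ (fderiv ℝ (V k)) x = l k • l k •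
      mollify (φ k) (fderiv ℝ (fderiv ℝ U)) (A k x) := fun k x => by
    rw [e1]
    exact (hL.hasFDerivAt_mollify (φ k) (A k x)).const_smul_comp_dilation.fderiv
  refine ⟨⟨V, fun k => (fun z => x₀ + (l k)⁻¹ • (z - x₀)) '' (K + Metric.closedBall 0 (φ k).rOut),
    2 * (2 * B), fun k => ?_, fun k => ?_, fun k => ?_, fun k x hx => ?_, fun k x => ?_, fun x => ?_,
    fun x => ?_, fun x hx => ?_⟩⟩
  · have h1 : ContDiff ℝ ∞ (mollify (φ k) U) :=
      (φ k).hasCompactSupport_normed.contDiff_convolution_left _ (φ k).contDiff_normed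
        hUL.continuous.locallyIntegrable
    exact h1.comp (by fun_prop)
  · exact (hKc.add (isCompact_closedBall 0 _)).image (by fun_prop)
  · rintro _ ⟨_, ⟨w, hw, e, he, rfl⟩, rfl⟩
    have hk : (0 : ℝ) < k + 1 := by positivity
    have h1 : x₀ + ((k : ℝ) + 1) • e ∈ Ω := hball (by
      rw [mem_closedBall_zero_iff] at he
      rw [Metric.mem_ball, dist_eq_norm, add_sub_cancel_left, norm_smul, Real.norm_of_nonneg hk.le]
      calc (k + 1) * ‖e‖ ≤ (k + 1) * (ρ / (2 * (k + 1))) := by gcongr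
        _ = ρ / 2 := by field_simp
        _ < ρ := by linarith)
    have h3 := hconv.combo_closure_interior_mem_interior hw (by rwa [hΩ.interior_eq] :
      x₀ + ((k : ℝ) + 1) • e ∈ interior Ω) (a := (l k)⁻¹) (b := 1 / (k + 2)) (by positivity)
      (by positivity) (by simp only [hl]; field_simp; ring)
    rw [hΩ.interior_eq] at h3
    convert h3 using 1
    have e3 : (l k)⁻¹ = 1 / ((k : ℝ) + 2) * (k + 1) := by simp only [hl]; field_simp
    have e4 : 1 / ((k : ℝ) + 2) = 1 - (l k)⁻¹ := by simp only [hl]; field_simp; ring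
    rw [smul_add, smul_smul, ← e3, e4]
    module
  · rw [hV]
    simp only [mollify, convolution_def]
    refine integral_eq_zero_of_ae (.of_forall fun y => ?_)
    by_cases hy : y ∈ Metric.ball (0 : E) (φ k).rOut
    · have hz : U (A k x - y) = 0 := h0 _ fun hmem => hx ⟨A k x, ⟨A k x - y, subset_closure hmem, y,
        Metric.ball_subset_closedBall hy, sub_add_cancel _ _⟩, by
          have : l k ≠ 0 := by linarith [hl1 k]
          simp [hA, smul_smul, this]⟩
      simp [hz]
    · have : (φ k).normed volume y = 0 := by
        rw [← Function.notMem_support, (φ k).support_normed_eq]; exact hy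
      simp [this]
  · rw [e2, ContinuousLinearMap.norm_smul_eq, ContinuousLinearMap.norm_smul_eq,
      Real.norm_of_nonneg (by linarith [hl1 k])]
    have h1 := norm_mollify_le (φ k) (G := fderiv ℝ (fderiv ℝ U)) (fun y => norm_fderiv_le_of_lipschitz ℝ hL) (A k x)
    have h3 := hl1 k
    gcongr
    · exact hl2 k
    · exact hl2 k
  · exact tendsto_mollify hφt (hAt x) hUL.continuous.aestronglyMeasurable hUL.continuous.continuousAt
  · simp only [e1]
    simpa using hlt.smul (tendsto_mollify hφt (hAt x) hL.continuous.aestronglyMeasurable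
      hL.continuous.continuousAt)
  · simp only [e2]
    have hc : ContinuousAt (fderiv ℝ (fderiv ℝ U)) x :=
      ((h2.contDiffAt (hΩ.mem_nhds hx)).fderiv_right (m := 1) (by norm_num)).continuousAt_fderiv
        one_ne_zero
    simpa using hlt.smul (hlt.smul (tendsto_mollify hφt (hAt x)
      (measurable_fderiv ℝ _).aestronglyMeasurable hc))

end Mollification

end


/-! ### The polar inequality for functions with vanishing Cauchy data -/

section

open scoped ContDiff Topology NNReal

section Limit

namespace TestApproximation

variable {n : ℕ} {Ω : Set (RSpace n)} {U : RSpace n → ℝ} (T : TestApproximation Ω U)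

lemma fderiv_eq_zero (k : ℕ) {x : RSpace n} (hx : x ∉ T.C k) : fderiv ℝ (T.V k) x = 0 := by
  have h : T.V k =ᶠ[𝓝 x] fun _ => 0 := by
    filter_upwards [(T.isCompact k).isClosed.isOpen_compl.mem_nhds hx] with y hy
      using T.eq_zero k y hy
  rw [h.fderiv_eq]; simp

lemma fderiv_fderiv_eq_zero (k : ℕ) {x : RSpace n} (hx : x ∉ T.C k) :
    fderiv ℝ (fderiv ℝ (T.V k)) x = 0 := by
  have h : fderiv ℝ (T.V k) =ᶠ[𝓝 x] fun _ => 0 := by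
    filter_upwards [(T.isCompact k).isClosed.isOpen_compl.mem_nhds hx] with y hy
      using T.fderiv_eq_zero k hy
  rw [h.fderiv_eq]; simp

lemma contDiff_fderiv (k : ℕ) : ContDiff ℝ ∞ (fderiv ℝ (T.V k)) :=
  (T.contDiff k).fderiv_right (by simp)

lemma bound_nonneg : 0 ≤ T.bound :=
  (ContinuousLinearMap.opNorm_nonneg _).trans (T.norm_le 0 0)

lemma norm_fderiv_le (h0 : (0 : RSpace n) ∉ Ω) (k : ℕ) (x : RSpace n) :
    ‖fderiv ℝ (T.V k) x‖ ≤ T.bound * ‖x‖ := by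
  have h := convex_univ.norm_image_sub_le_of_norm_fderiv_le (𝕜 := ℝ) (f := fderiv ℝ (T.V k))
    (fun y _ => (T.contDiff_fderiv k).differentiable (by simp) y) (fun y _ => T.norm_le k y)
    (Set.mem_univ 0) (Set.mem_univ x)
  rwa [T.fderiv_eq_zero k fun h => h0 (T.subset k h), sub_zero, sub_zero] at h

lemma abs_V_le (h0 : (0 : RSpace n) ∉ Ω) (k : ℕ) (x : RSpace n) :
    |T.V k x| ≤ T.bound * ‖x‖ ^ 2 := by
  have hB := T.bound_nonneg
  have h := (convex_closedBall (0 : RSpace n) ‖x‖).norm_image_sub_le_of_norm_fderiv_le (𝕜 := ℝ)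
    (f := T.V k) (fun y _ => (T.contDiff k).differentiable (by simp) y)
    (fun y hy => (T.norm_fderiv_le h0 k y).trans
      (mul_le_mul_of_nonneg_left (mem_closedBall_zero_iff.1 hy) hB))
    (Metric.mem_closedBall_self (norm_nonneg x)) (mem_closedBall_zero_iff.2 le_rfl)
  rwa [T.eq_zero k 0 fun h => h0 (T.subset k h), sub_zero, sub_zero, Real.norm_eq_abs, mul_assoc,
    ← sq] at h

lemma norm_fderiv_le' (h0 : (0 : RSpace n) ∉ Ω) (x : RSpace n) :
    ‖fderiv ℝ U x‖ ≤ T.bound * ‖x‖ :=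
  le_of_tendsto (T.tendsto_fderiv x).norm (.of_forall fun k => T.norm_fderiv_le h0 k x)

lemma abs_le_of_approximation (h0 : (0 : RSpace n) ∉ Ω) (x : RSpace n) : |U x| ≤ T.bound * ‖x‖ ^ 2 :=
  le_of_tendsto (T.tendsto x).abs (.of_forall fun k => T.abs_V_le h0 k x)

lemma norm_le' {x : RSpace n} (hx : x ∈ Ω) : ‖fderiv ℝ (fderiv ℝ U) x‖ ≤ T.bound :=
  ContinuousLinearMap.norm_le_of_tendsto (T.tendsto_fderiv_fderiv x hx) fun k => T.norm_le k x

/-- `J` is continuous on `Ω`, and bounded on the jets with the bounds that the derivatives of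
`U` obey. -/
structure IsTame (T : TestApproximation Ω U) (J : RSpace n → ℝ → (RSpace n →L[ℝ] ℝ) →
    (RSpace n →L[ℝ] RSpace n →L[ℝ] ℝ) → ℝ) : Prop where
  continuousOn : ContinuousOn (fun q : RSpace n × ℝ × (RSpace n →L[ℝ] ℝ) ×
    (RSpace n →L[ℝ] RSpace n →L[ℝ] ℝ) => J q.1 q.2.1 q.2.2.1 q.2.2.2) (Ω ×ˢ Set.univ)
  bounded : ∃ D, ∀ x ∈ Ω, ∀ a p M, |a| ≤ T.bound * ‖x‖ ^ 2 → ‖p‖ ≤ T.bound * ‖x‖ → ‖M‖ ≤ T.bound →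
    |J x a p M| ≤ D

variable {J : RSpace n → ℝ → (RSpace n →L[ℝ] ℝ) → (RSpace n →L[ℝ] RSpace n →L[ℝ] ℝ) → ℝ}

lemma IsTame.continuousOn_jet (hJ : T.IsTame J) {F : RSpace n → ℝ} (hΩ : IsOpen Ω)
    (hF : ContDiffOn ℝ 2 F Ω) :
    ContinuousOn (fun x => J x (F x) (fderiv ℝ F x) (fderiv ℝ (fderiv ℝ F) x)) Ω := by
  have h1 : ContDiffOn ℝ 1 (fderiv ℝ F) Ω := hF.fderiv_of_isOpen hΩ (by norm_num)
  have h2 : ContinuousOn (fderiv ℝ (fderiv ℝ F)) Ω := h1.continuousOn_fderiv_of_isOpen hΩ le_rfl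
  exact hJ.continuousOn.comp (continuousOn_id.prodMk (hF.continuousOn.prodMk
    (h1.continuousOn.prodMk h2))) fun x hx => ⟨hx, trivial⟩

lemma IsTame.integrableOn (hJ : T.IsTame J) (h0 : (0 : RSpace n) ∉ Ω) (hΩ : IsOpen Ω)
    (hb : Bornology.IsBounded Ω) (hU : ContDiffOn ℝ 2 U Ω) :
    IntegrableOn (fun x => J x (U x) (fderiv ℝ U x) (fderiv ℝ (fderiv ℝ U) x)) Ω := by
  obtain ⟨D, hD⟩ := hJ.bounded
  refine IntegrableOn.of_bound hb.measure_lt_top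
    ((hJ.continuousOn_jet T hΩ hU).aestronglyMeasurable hΩ.measurableSet) D ?_
  filter_upwards [ae_restrict_mem hΩ.measurableSet] with x hx
  exact hD x hx _ _ _ (T.abs_le_of_approximation h0 x) (T.norm_fderiv_le' h0 x) (T.norm_le' hx)

lemma IsTame.tendsto_setIntegral (hJ : T.IsTame J) (h0 : (0 : RSpace n) ∉ Ω) (hΩ : IsOpen Ω)
    (hb : Bornology.IsBounded Ω) :
    Filter.Tendsto (fun k => ∫ x in Ω, J x (T.V k x) (fderiv ℝ (T.V k) x)
      (fderiv ℝ (fderiv ℝ (T.V k)) x)) .atTop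
      (𝓝 (∫ x in Ω, J x (U x) (fderiv ℝ U x) (fderiv ℝ (fderiv ℝ U) x))) := by
  obtain ⟨D, hD⟩ := hJ.bounded
  refine tendsto_integral_of_dominated_convergence (fun _ => D) (fun k =>
    (hJ.continuousOn_jet T hΩ ((T.contDiff k).of_le ENat.LEInfty.out).contDiffOn
      ).aestronglyMeasurable hΩ.measurableSet)
    (by rw [integrable_const_iff]; exact Or.inr ⟨by simpa using hb.measure_lt_top⟩)
    (fun k => ?_) ?_
  · filter_upwards [ae_restrict_mem hΩ.measurableSet] with x hx
    exact hD x hx _ _ _ (T.abs_V_le h0 k x) (T.norm_fderiv_le h0 k x) (T.norm_le k x)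
  · filter_upwards [ae_restrict_mem hΩ.measurableSet] with x hx
    have hc := hJ.continuousOn.continuousAt ((hΩ.prod isOpen_univ).mem_nhds
      (show ((x, U x, fderiv ℝ U x, fderiv ℝ (fderiv ℝ U) x) : _ × _ × _ × _) ∈ Ω ×ˢ Set.univ
        from ⟨hx, trivial⟩))
    exact hc.tendsto.comp (tendsto_const_nhds.prodMk_nhds ((T.tendsto x).prodMk_nhds
      ((T.tendsto_fderiv x).prodMk_nhds (T.tendsto_fderiv_fderiv x hx))))

lemma IsTame.congr {J' : RSpace n → ℝ → (RSpace n →L[ℝ] ℝ) → (RSpace n →L[ℝ] RSpace n →L[ℝ] ℝ) → ℝ}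
    (hJ : T.IsTame J) (h : ∀ x a p M, J' x a p M = J x a p M) : T.IsTame J' := by
  have : J' = J := by ext x a p M; exact h x a p M
  rwa [this]

lemma IsTame.of_continuousOn {h : RSpace n → ℝ} (hc : ContinuousOn h Ω) {D : ℝ}
    (hD : ∀ x ∈ Ω, |h x| ≤ D) : T.IsTame fun x _ _ _ => h x where
  continuousOn := hc.comp continuousOn_fst fun _ hq => hq.1
  bounded := ⟨D, fun x hx _ _ _ _ _ _ => hD x hx⟩

lemma IsTame.comp {m : ℕ} {Q : (Fin m → ℝ) → ℝ} (hQ : Continuous Q)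
    {f : Fin m → RSpace n → ℝ → (RSpace n →L[ℝ] ℝ) → (RSpace n →L[ℝ] RSpace n →L[ℝ] ℝ) → ℝ}
    (hf : ∀ i, T.IsTame (f i)) : T.IsTame fun x a p M => Q fun i => f i x a p M where
  continuousOn := hQ.comp_continuousOn (continuousOn_pi.2 fun i => (hf i).continuousOn)
  bounded := by
    choose D hD using fun i => (hf i).bounded
    obtain ⟨D', hD'⟩ := (isCompact_Icc (a := -D) (b := D)).exists_bound_of_continuousOn
      hQ.continuousOn
    exact ⟨D', fun x hx a p M h1 h2 h3 => hD' _ ⟨fun i => (abs_le.1 (hD i x hx a p M h1 h2 h3)).1,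
      fun i => (abs_le.1 (hD i x hx a p M h1 h2 h3)).2⟩⟩

lemma IsTame.mul {J₁ J₂ : RSpace n → ℝ → (RSpace n →L[ℝ] ℝ) → (RSpace n →L[ℝ] RSpace n →L[ℝ] ℝ) → ℝ}
    (h₁ : T.IsTame J₁) (h₂ : T.IsTame J₂) : T.IsTame fun x a p M => J₁ x a p M * J₂ x a p M :=
  IsTame.comp T (m := 2) (Q := fun y => y 0 * y 1) (f := ![J₁, J₂]) (by fun_prop)
    (Fin.forall_fin_two.2 ⟨h₁, h₂⟩)

lemma IsTame.add {J₁ J₂ : RSpace n → ℝ → (RSpace n →L[ℝ] ℝ) → (RSpace n →L[ℝ] RSpace n →L[ℝ] ℝ) → ℝ}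
    (h₁ : T.IsTame J₁) (h₂ : T.IsTame J₂) : T.IsTame fun x a p M => J₁ x a p M + J₂ x a p M :=
  IsTame.comp T (m := 2) (Q := fun y => y 0 + y 1) (f := ![J₁, J₂]) (by fun_prop)
    (Fin.forall_fin_two.2 ⟨h₁, h₂⟩)

lemma IsTame.sub {J₁ J₂ : RSpace n → ℝ → (RSpace n →L[ℝ] ℝ) → (RSpace n →L[ℝ] RSpace n →L[ℝ] ℝ) → ℝ}
    (h₁ : T.IsTame J₁) (h₂ : T.IsTame J₂) : T.IsTame fun x a p M => J₁ x a p M - J₂ x a p M :=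
  IsTame.comp T (m := 2) (Q := fun y => y 0 - y 1) (f := ![J₁, J₂]) (by fun_prop)
    (Fin.forall_fin_two.2 ⟨h₁, h₂⟩)

lemma isTame_radialWeight (hn : 0 < n) {R : ℝ} (hR : 0 < R) (h0 : (0 : RSpace n) ∉ Ω) {k : ℕ}
    (hk : k < 3) : T.IsTame fun x _ _ _ => radialWeight n R (greenDeriv n k) x :=
  have ⟨_, hG⟩ := exists_bound_radialWeight_greenDeriv hn hR k
  .of_continuousOn T ((continuousOn_radialWeight hR (continuous_greenDeriv hk)).mono
    fun _ hx h => h0 (h ▸ hx)) fun x _ => hG x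

lemma isTame_bilinTrace : T.IsTame fun _ _ _ M => bilinTrace M where
  continuousOn := (continuous_bilinTrace.comp
    (continuous_snd.comp (continuous_snd.comp continuous_snd))).continuousOn
  bounded := ⟨n * T.bound, fun _ _ _ _ M _ _ hM => (abs_bilinTrace_le M).trans (by gcongr)⟩

lemma isTame_div_norm_sq (h0 : (0 : RSpace n) ∉ Ω)
    (hJ : Continuous fun q : RSpace n × ℝ × (RSpace n →L[ℝ] ℝ) ×
      (RSpace n →L[ℝ] RSpace n →L[ℝ] ℝ) => J q.1 q.2.1 q.2.2.1 q.2.2.2)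
    (hD : ∀ x a p M, |a| ≤ T.bound * ‖x‖ ^ 2 → ‖p‖ ≤ T.bound * ‖x‖ → ‖M‖ ≤ T.bound →
      |J x a p M| ≤ T.bound * ‖x‖ ^ 2) :
    T.IsTame fun x a p M => J x a p M / ‖x‖ ^ 2 where
  continuousOn := hJ.continuousOn.div (continuous_fst.norm.pow 2).continuousOn fun q hq =>
    pow_ne_zero 2 (norm_ne_zero_iff.2 fun h => h0 (h ▸ hq.1))
  bounded := ⟨T.bound, fun x hx a p M ha hp hM => by
    have hx0 : 0 < ‖x‖ := norm_pos_iff.2 fun h => h0 (h ▸ hx)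
    rw [abs_div, abs_of_pos (pow_pos hx0 2), div_le_iff₀ (pow_pos hx0 2)]
    exact hD x a p M ha hp hM⟩

lemma isTame_value (h0 : (0 : RSpace n) ∉ Ω) : T.IsTame fun x a _ _ => a / ‖x‖ ^ 2 :=
  T.isTame_div_norm_sq h0 (continuous_fst.comp continuous_snd) fun _ _ _ _ ha _ _ => ha

lemma isTame_euler (h0 : (0 : RSpace n) ∉ Ω) : T.IsTame fun x _ p _ => p x / ‖x‖ ^ 2 :=
  T.isTame_div_norm_sq h0
    ((continuous_fst.comp (continuous_snd.comp continuous_snd)).clm_apply continuous_fst)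
    fun x _ p _ _ hp _ => (p.le_opNorm x).trans (by nlinarith [norm_nonneg x])

lemma isTame_hessian (h0 : (0 : RSpace n) ∉ Ω) : T.IsTame fun x _ _ M => M x x / ‖x‖ ^ 2 :=
  T.isTame_div_norm_sq h0
    (((continuous_snd.comp (continuous_snd.comp continuous_snd)).clm_apply
      continuous_fst).clm_apply continuous_fst)
    fun x _ _ M _ _ hM => (M.le_opNorm₂ x x).trans (by nlinarith [sq_nonneg ‖x‖])

/-- A continuous function of the three weights and of the scale-invariant second-order data of `u`
is tame: this is the form of every integrand built from `Δu`, `u / r²`, `x · ∇u / r²` and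
`∇²u(x, x) / r²`. -/
lemma IsTame.of_coordinates (hn : 0 < n) {R : ℝ} (hR : 0 < R) (h0 : (0 : RSpace n) ∉ Ω)
    {Q : (Fin 7 → ℝ) → ℝ} (hQ : Continuous Q) :
    T.IsTame fun x a p M => Q ![radialWeight n R (greenDeriv n 0) x,
      radialWeight n R (greenDeriv n 1) x, radialWeight n R (greenDeriv n 2) x, bilinTrace M,
      a / ‖x‖ ^ 2, p x / ‖x‖ ^ 2, M x x / ‖x‖ ^ 2] := by
  refine (IsTame.comp T hQ (f := ![fun x _ _ _ => radialWeight n R (greenDeriv n 0) x,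
    fun x _ _ _ => radialWeight n R (greenDeriv n 1) x,
    fun x _ _ _ => radialWeight n R (greenDeriv n 2) x, fun _ _ _ M => bilinTrace M,
    fun x a _ _ => a / ‖x‖ ^ 2, fun x _ p _ => p x / ‖x‖ ^ 2, fun x _ _ M => M x x / ‖x‖ ^ 2])
    fun i => ?_).congr T fun x a p M => ?_
  · fin_cases i
    exacts [T.isTame_radialWeight hn hR h0 (by norm_num), T.isTame_radialWeight hn hR h0
      (by norm_num), T.isTame_radialWeight hn hR h0 (by norm_num), T.isTame_bilinTrace,
      T.isTame_value h0, T.isTame_euler h0, T.isTame_hessian h0]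
  · congr 1
    ext i
    fin_cases i <;> rfl

lemma isTame_jetDensity (hn : 0 < n) {R : ℝ} (hR : 0 < R) (h0 : (0 : RSpace n) ∉ Ω) :
    T.IsTame (jetDensity R) := by
  refine (IsTame.of_coordinates T hn hR h0 (Q := fun y => polarDensity n (y 0) (y 1) (y 2) (y 3)
    (y 4) (y 5 - 2 * y 4) (y 6 - 3 * y 5 + 4 * y 4)) (by unfold polarDensity; fun_prop)).congr T
    fun x a p M => ?_
  simp [jetDensity, sub_div, add_div, mul_div_assoc]

include T in
/-- The polar inequality for functions with vanishing Cauchy data. -/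
theorem half_sphere_integral_le (hn : 2 ≤ n) {R : ℝ} (hR : 0 < R) (hΩ : IsOpen Ω)
    (hb : Bornology.IsBounded Ω) {α : RSpace n} (hα : ‖α‖ = 1) (hΩα : ∀ x ∈ Ω, 0 < inner ℝ α x) :
    1 / 2 * ∫ y : Metric.sphere (0 : RSpace n) 1, (U (R • (y : RSpace n)) / R ^ 2) ^ 2
        ∂(volume : Measure (RSpace n)).toSphere
      ≤ ∫ x in Ω, jetDensity R x (U x) (fderiv ℝ U x) (fderiv ℝ (fderiv ℝ U) x) := by
  have h0 : (0 : RSpace n) ∉ Ω := fun h => by simpa using hΩα 0 h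
  have hB := T.bound_nonneg
  have hlim := (T.isTame_jetDensity (by omega) hR h0).tendsto_setIntegral T h0 hΩ hb
  have hsph : Filter.Tendsto (fun k => 1 / 2 * ∫ y : Metric.sphere (0 : RSpace n) 1,
      (T.V k (R • (y : RSpace n)) / R ^ 2) ^ 2 ∂(volume : Measure (RSpace n)).toSphere) .atTop
      (𝓝 (1 / 2 * ∫ y : Metric.sphere (0 : RSpace n) 1, (U (R • (y : RSpace n)) / R ^ 2) ^ 2
        ∂(volume : Measure (RSpace n)).toSphere)) := by
    refine (tendsto_integral_of_dominated_convergence (fun _ => T.bound ^ 2) (fun k => ?_)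
      (integrable_const _) (fun k => ?_) ?_).const_mul _
    · have := (T.contDiff k).continuous
      exact Continuous.aestronglyMeasurable (by fun_prop)
    · refine .of_forall fun y => ?_
      have h1 := T.abs_V_le h0 k (R • (y : RSpace n))
      have hy : ‖R • (y : RSpace n)‖ = R := by simp [norm_smul, abs_of_pos hR]
      rw [hy] at h1
      rw [norm_pow, norm_div, Real.norm_eq_abs, Real.norm_of_nonneg (by positivity : 0 ≤ R ^ 2)]
      gcongr
      exact div_le_of_le_mul₀ (by positivity) hB h1
    · exact .of_forall fun y => ((T.tendsto _).div_const _).pow 2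
  refine le_of_tendsto_of_tendsto' hsph hlim fun k => ?_
  refine (half_sphere_integral_le_integral_jetDensity hn hR hα (T.isCompact k)
    (fun x hx => hΩα x (T.subset k hx)) (T.contDiff k) (T.eq_zero k)).trans_eq ?_
  refine (setIntegral_eq_of_subset_of_forall_sdiff_eq_zero hΩ.measurableSet (T.subset k)
    fun x hx => ?_).symm
  rw [T.eq_zero k x hx.2, T.fderiv_eq_zero k hx.2, T.fderiv_fderiv_eq_zero k hx.2]
  simp [jetDensity, polarDensity, bilinTrace]

end TestApproximation

end Limit

end


/-! ### Green's identity with the Euler field -/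

section

open scoped ContDiff Topology NNReal

section EulerIdentities

open scoped Laplacian

variable {n : ℕ}

lemma contDiff_of_contDiffOn_of_eq_zero {Ω C : Set (RSpace n)} (hΩ : IsOpen Ω) (hC : IsClosed C)
    (hCΩ : C ⊆ Ω) {m : WithTop ℕ∞} {F : RSpace n → ℝ} (hF : ContDiffOn ℝ m F Ω)
    (h0 : ∀ x ∉ C, F x = 0) : ContDiff ℝ m F := by
  refine contDiff_iff_contDiffAt.2 fun x => ?_
  by_cases hx : x ∈ Ω
  · exact hF.contDiffAt (hΩ.mem_nhds hx)
  · refine (contDiffAt_const (c := (0 : ℝ))).congr_of_eventuallyEq ?_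
    filter_upwards [hC.isOpen_compl.mem_nhds fun h => hx (hCΩ h)] with y hy using h0 y hy

/-- The divergence of a field with compact support integrates to zero. -/
lemma setIntegral_divergence_eq_zero {Ω C : Set (RSpace n)} (hΩ : IsOpen Ω) (hC : IsCompact C)
    (hCΩ : C ⊆ Ω) {G : Fin n → RSpace n → ℝ} (hG : ∀ i, ContDiffOn ℝ 1 (G i) Ω)
    (h0 : ∀ i, ∀ x ∉ C, G i x = 0) :
    ∫ x in Ω, ∑ i, fderiv ℝ (G i) x (EuclideanSpace.single i 1) = 0 := by
  have hs : ∀ i, HasCompactSupport (G i) := fun i => HasCompactSupport.intro hC (h0 i)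
  have hd : ∀ i, ContDiff ℝ 1 (G i) := fun i =>
    contDiff_of_contDiffOn_of_eq_zero hΩ hC.isClosed hCΩ (hG i) (h0 i)
  rw [setIntegral_eq_integral_of_forall_compl_eq_zero, integral_finsetSum]
  · exact Finset.sum_eq_zero fun i _ => integral_fderiv_apply_eq_zero (hd i) (hs i) _
  · intro i _
    exact (((hd i).continuous_fderiv one_ne_zero).clm_apply
      continuous_const).integrable_of_hasCompactSupport
      (((hs i).fderiv ℝ).comp_left (g := fun m : RSpace n →L[ℝ] ℝ => m _) rfl)
  · intro x hx
    refine Finset.sum_eq_zero fun i _ => ?_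
    have h : G i =ᶠ[𝓝 x] fun _ => 0 := by
      filter_upwards [hC.isClosed.isOpen_compl.mem_nhds fun h => hx (hCΩ h)] with y hy
        using h0 i y hy
    rw [h.fderiv_eq]; simp

/-- The commutator of the Laplacian with the Euler field. -/
lemma laplacian_euler {V : RSpace n → ℝ} (hV : ContDiff ℝ ∞ V) (x : RSpace n) :
    (Δ (fun y => fderiv ℝ V y y)) x =
      fderiv ℝ (fun y => bilinTrace (fderiv ℝ (fderiv ℝ V) y)) x x
        + 2 * bilinTrace (fderiv ℝ (fderiv ℝ V) x) := by
  have h1 : ContDiff ℝ ∞ (fderiv ℝ V) := hV.fderiv_right (by simp)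
  have h2 : ContDiff ℝ ∞ (fderiv ℝ (fderiv ℝ V)) := h1.fderiv_right (by simp)
  have c2 : ∀ y, ContDiffAt ℝ 2 V y := fun y => hV.contDiffAt.of_le ENat.LEInfty.out
  have D : HasFDerivAt (fderiv ℝ (fderiv ℝ V)) (fderiv ℝ (fderiv ℝ (fderiv ℝ V)) x) x :=
    (h2.differentiable (by simp) x).hasFDerivAt
  set S := fderiv ℝ (fderiv ℝ (fderiv ℝ V)) x with hS
  have Dap : ∀ v w, HasFDerivAt (fun y => fderiv ℝ (fderiv ℝ V) y v w) ((S.flip v).flip w) x := by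
    intro v w
    have := (D.clm_apply (hasFDerivAt_const v x)).clm_apply (hasFDerivAt_const w x)
    refine this.congr_fderiv ?_
    ext z; simp
  have s1 : ∀ u v w, S u v w = S v u w := fun u v w =>
    congrArg (fun m : RSpace n →L[ℝ] ℝ => m w)
      ((h1.contDiffAt (x := x)).isSymmSndFDerivAt (by simp; exact ENat.LEInfty.out) u v)
  have s2 : ∀ u v w, S u v w = S u w v := fun u v w => by
    have e : (fun y => fderiv ℝ (fderiv ℝ V) y v w) = fun y => fderiv ℝ (fderiv ℝ V) y w v :=
      funext fun y => (hV.contDiffAt (x := y)).isSymmSndFDerivAt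
        (by simp; exact ENat.LEInfty.out) v w
    have := (e ▸ Dap v w).unique (Dap w v)
    exact congrArg (fun m : RSpace n →L[ℝ] ℝ => m u) this
  have hE : fderiv ℝ (fun y => fderiv ℝ V y y) =
      fun y => (fderiv ℝ (fderiv ℝ V) y).flip y + fderiv ℝ V y :=
    funext fun y => (hasFDerivAt_fderiv_apply_self (c2 y)).fderiv
  have hT : fderiv ℝ (fun y => bilinTrace (fderiv ℝ (fderiv ℝ V) y)) x x =
      ∑ i, S x (EuclideanSpace.single i 1) (EuclideanSpace.single i 1) := by
    unfold bilinTrace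
    rw [(HasFDerivAt.fun_sum fun i _ => Dap _ _).fderiv]
    simp
  have hEE : ∀ v w, fderiv ℝ (fderiv ℝ (fun y => fderiv ℝ V y y)) x v w =
      S v w x + fderiv ℝ (fderiv ℝ V) x w v + fderiv ℝ (fderiv ℝ V) x v w := by
    intro v w
    have e1 : HasFDerivAt (fun y => fderiv ℝ (fun y => fderiv ℝ V y y) y w) _ x :=
      ((D.clm_apply (hasFDerivAt_const w x)).clm_apply (hasFDerivAt_id x)).add
        ((h1.differentiable (by simp) x).hasFDerivAt.clm_apply (hasFDerivAt_const w x))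
        |>.congr_of_eventuallyEq (.of_forall fun y => by simp [hE])
    have hd : DifferentiableAt ℝ (fderiv ℝ (fun y => fderiv ℝ V y y)) x :=
      (((h1.clm_apply contDiff_id).fderiv_right (m := ∞) (by simp)).differentiable (by simp)) x
    have e2 := hd.hasFDerivAt.clm_apply (hasFDerivAt_const w x)
    have := congrArg (fun m : RSpace n →L[ℝ] ℝ => m v) (e2.unique e1)
    simpa [add_comm, add_left_comm, add_assoc] using this
  rw [laplacian_eq_bilinTrace, hT]
  simp only [bilinTrace, hEE, Finset.sum_add_distrib]
  have : ∀ i, S (EuclideanSpace.single i 1) (EuclideanSpace.single i 1) x =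
      S x (EuclideanSpace.single i 1) (EuclideanSpace.single i 1) := fun i => by
    rw [s2, s1]
  simp only [this]
  ring

/-- The integrand that remains when Green's identity for `f` and `(x · ∇V) γ₀` is freed from the
third derivatives of `V`, where `V` has derivative `p` and second derivative `M` at `x`. The value
of `V` does not enter; it is an argument only so that the density depends on the full 2-jet. -/
noncomputable def eulerDensity (R : ℝ) (f : RSpace n → ℝ) (x : RSpace n) (_a : ℝ)
    (p : RSpace n →L[ℝ] ℝ) (M : RSpace n →L[ℝ] RSpace n →L[ℝ] ℝ) : ℝ :=
  (Δ f) x * (p x * radialWeight n R (greenDeriv n 0) x)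
    - f x * laplaceMulDensity R x (p x) (M x x + p x) (2 * bilinTrace M)
    + bilinTrace M * (radialWeight n R (greenDeriv n 0) x * fderiv ℝ f x x
      - radialWeight n R (greenDeriv n 1) x * f x)

/-- Green's second identity for `f` and `(x · ∇V) γ₀`; the third derivatives of `V` are integrated
by parts against the Euler field. -/
theorem setIntegral_eulerDensity_eq_zero {R : ℝ} (hR : 0 < R) {Ω C : Set (RSpace n)}
    (hΩ : IsOpen Ω) (h0 : (0 : RSpace n) ∉ Ω) (hC : IsCompact C) (hCΩ : C ⊆ Ω)
    {f V : RSpace n → ℝ} (hf : ContDiffOn ℝ 2 f Ω) (hV : ContDiff ℝ ∞ V)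
    (hVC : ∀ x ∉ C, V x = 0) :
    ∫ x in Ω, eulerDensity R f x (V x) (fderiv ℝ V x) (fderiv ℝ (fderiv ℝ V) x) = 0 := by
  have h1 : ContDiff ℝ ∞ (fderiv ℝ V) := hV.fderiv_right (by simp)
  have h2 : ContDiff ℝ ∞ (fderiv ℝ (fderiv ℝ V)) := h1.fderiv_right (by simp)
  have hne : ∀ x ∈ Ω, x ≠ 0 := fun x hx h => h0 (h ▸ hx)
  have z1 : ∀ x ∉ C, fderiv ℝ V x = 0 := fun x hx => by
    have h : V =ᶠ[𝓝 x] fun _ => 0 := by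
      filter_upwards [hC.isClosed.isOpen_compl.mem_nhds hx] with y hy using hVC y hy
    rw [h.fderiv_eq]; simp
  have z2 : ∀ x ∉ C, fderiv ℝ (fderiv ℝ V) x = 0 := fun x hx => by
    have h : fderiv ℝ V =ᶠ[𝓝 x] fun _ => 0 := by
      filter_upwards [hC.isClosed.isOpen_compl.mem_nhds hx] with y hy using z1 y hy
    rw [h.fderiv_eq]; simp
  set γ : RSpace n → ℝ := radialWeight n R (greenDeriv n 0) with hγ
  set L : RSpace n → ℝ := fun y => bilinTrace (fderiv ℝ (fderiv ℝ V) y) with hL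
  set EV : RSpace n → ℝ := fun y => fderiv ℝ V y y with hEV
  set h : RSpace n → ℝ := fun y => EV y * γ y with hh
  set q : RSpace n → ℝ := fun y => f y * γ y * L y with hq
  have cγ : ∀ x ∈ Ω, ContDiffAt ℝ 2 γ x := fun x hx => contDiffAt_two_radialWeight hR (hne x hx)
  have cEV : ContDiff ℝ ∞ EV := h1.clm_apply contDiff_id
  have cL : ContDiff ℝ ∞ L := by
    simp only [hL, bilinTrace]
    fun_prop
  have cf : ∀ x ∈ Ω, ContDiffAt ℝ 2 f x := fun x hx => hf.contDiffAt (hΩ.mem_nhds hx)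
  have ch : ∀ x ∈ Ω, ContDiffAt ℝ 2 h x := fun x hx =>
    (cEV.contDiffAt.of_le ENat.LEInfty.out).mul (cγ x hx)
  have cq : ∀ x ∈ Ω, ContDiffAt ℝ 1 q x := fun x hx =>
    ((((cf x hx).mul (cγ x hx)).of_le (by norm_num)).mul
      (cL.contDiffAt.of_le (by norm_cast)))
  have cd : ∀ {F : RSpace n → ℝ} {x}, ContDiffAt ℝ 2 F x → ∀ e : RSpace n,
      ContDiffAt ℝ 1 (fun y => fderiv ℝ F y e) x := fun hF e =>
    (hF.fderiv_right (m := 1) (by norm_num)).clm_apply contDiffAt_const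
  have dd : ∀ {F : RSpace n → ℝ} {x}, ContDiffAt ℝ 2 F x → ∀ e : RSpace n,
      fderiv ℝ (fun y => fderiv ℝ F y e) x e = fderiv ℝ (fderiv ℝ F) x e e := fun hF e => by
    rw [fderiv_clm_apply ((hF.fderiv_right (m := 1) (by norm_num)).differentiableAt one_ne_zero)
      (differentiableAt_const _)]
    simp
  set G : Fin n → RSpace n → ℝ := fun i y =>
    h y * fderiv ℝ f y (EuclideanSpace.single i 1) - f y * fderiv ℝ h y (EuclideanSpace.single i 1)
      + y i * q y with hG
  have zh : ∀ x ∉ C, h x = 0 := fun x hx => by simp [hh, hEV, z1 x hx]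
  have zh' : ∀ x ∉ C, fderiv ℝ h x = 0 := fun x hx => by
    have e : h =ᶠ[𝓝 x] fun _ => 0 := by
      filter_upwards [hC.isClosed.isOpen_compl.mem_nhds hx] with y hy using zh y hy
    rw [e.fderiv_eq]; simp
  have cG : ∀ i, ∀ x ∈ Ω, ContDiffAt ℝ 1 (G i) x := fun i x hx =>
    ((((ch x hx).of_le (by norm_num)).mul (cd (cf x hx) _)).sub
      (((cf x hx).of_le (by norm_num)).mul (cd (ch x hx) _))).add
      (ContDiffAt.mul (by fun_prop) (cq x hx))
  have key := setIntegral_divergence_eq_zero hΩ hC hCΩ (G := G)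
    (fun i x hx => (cG i x hx).contDiffWithinAt) fun i x hx => by
      simp [hG, zh x hx, zh' x hx, hq, hL, z2 x hx, bilinTrace]
  rw [← key]
  refine setIntegral_congr_fun hΩ.measurableSet fun x hx => ?_
  have hdG : ∀ i, fderiv ℝ (G i) x (EuclideanSpace.single i 1) =
      h x * fderiv ℝ (fderiv ℝ f) x (EuclideanSpace.single i 1) (EuclideanSpace.single i 1)
      - f x * fderiv ℝ (fderiv ℝ h) x (EuclideanSpace.single i 1) (EuclideanSpace.single i 1)
      + (q x + x i * fderiv ℝ q x (EuclideanSpace.single i 1)) := by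
    intro i
    have f1 := ((ch x hx).differentiableAt two_ne_zero).hasFDerivAt.mul
      ((cd (cf x hx) (EuclideanSpace.single i 1)).differentiableAt one_ne_zero).hasFDerivAt
    have f2 := ((cf x hx).differentiableAt two_ne_zero).hasFDerivAt.mul
      ((cd (ch x hx) (EuclideanSpace.single i 1)).differentiableAt one_ne_zero).hasFDerivAt
    have f3 := (EuclideanSpace.proj (𝕜 := ℝ) i : RSpace n →L[ℝ] ℝ).hasFDerivAt (x := x) |>.mul
      ((cq x hx).differentiableAt one_ne_zero).hasFDerivAt
    have f4 : HasFDerivAt (G i) _ x := (f1.sub f2).add f3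
    rw [f4.fderiv]
    simp only [add_apply, sub_apply, smul_apply, smul_eq_mul, dd (cf x hx), dd (ch x hx)]
    simp
    ring
  simp only [hdG, Finset.sum_add_distrib, Finset.sum_sub_distrib, ← Finset.mul_sum,
    sum_apply_single_mul]
  have e1 : ∑ i, fderiv ℝ (fderiv ℝ f) x (EuclideanSpace.single i 1) (EuclideanSpace.single i 1) =
      (Δ f) x := (laplacian_eq_bilinTrace f x).symm
  have e2 : ∑ i, fderiv ℝ (fderiv ℝ h) x (EuclideanSpace.single i 1) (EuclideanSpace.single i 1) =
      (Δ h) x := (laplacian_eq_bilinTrace h x).symm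
  have e3 : fderiv ℝ EV x x = fderiv ℝ (fderiv ℝ V) x x x + fderiv ℝ V x x := by
    rw [(hasFDerivAt_fderiv_apply_self (hV.contDiffAt.of_le ENat.LEInfty.out)).fderiv]
    simp
  have e4 : fderiv ℝ q x x = f x * γ x * fderiv ℝ L x x + (f x * (-(n * γ x
      + radialWeight n R (greenDeriv n 1) x)) + γ x * fderiv ℝ f x x) * L x := by
    have := (((cf x hx).differentiableAt two_ne_zero).hasFDerivAt.mul
      (hasFDerivAt_radialWeight_greenDeriv hR (k := 0) (by norm_num) (hne x hx))).mul
      (cL.differentiable (by simp) x).hasFDerivAt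
    rw [show fderiv ℝ q x = _ from HasFDerivAt.fderiv this]
    have hx0 : ‖x‖ ≠ 0 := norm_ne_zero_iff.2 (hne x hx)
    simp
    field_simp
    simp [hγ]
    ring
  rw [e1, e2, hh, laplacian_mul_greenWeight hR (hne x hx) (cEV.contDiffAt.of_le ENat.LEInfty.out),
    laplacian_euler hV, e3, e4]
  simp only [eulerDensity, laplaceMulDensity, hq, hL, hEV, hγ, Finset.sum_const, Finset.card_univ,
    Fintype.card_fin, nsmul_eq_mul]
  ring

end EulerIdentities

end


/-! ### Star-shaped domains -/

section

open scoped ContDiff Topology NNReal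

section StarShaped

open scoped Laplacian

variable {n : ℕ} {Ω : Set (RSpace n)}

/-- On a domain that is star-shaped about the origin, the flux of `F x` through the boundary is
nonnegative for `F ≥ 0`: the integral of `F` over `s Ω` increases with `s`. -/
theorem setIntegral_euler_divergence_nonneg (hΩ : IsOpen Ω) (hb : Bornology.IsBounded Ω)
    (hstar : ∀ x ∈ Ω, ∀ s : ℝ, 0 < s → s ≤ 1 → s • x ∈ Ω) {F : RSpace n → ℝ}
    (hF : ContDiffOn ℝ 1 F Ω) (hF0 : ∀ x ∈ Ω, 0 ≤ F x) {D D' : ℝ} (hD : ∀ x ∈ Ω, |F x| ≤ D)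
    (hD' : ∀ x ∈ Ω, |n * F x + fderiv ℝ F x x| ≤ D') :
    0 ≤ ∫ x in Ω, (n * F x + fderiv ℝ F x x) := by
  have hfin : IsFiniteMeasure (volume.restrict Ω) := ⟨by simpa using hb.measure_lt_top⟩
  set s : ℕ → ℝ := fun k => 1 - 1 / ((k : ℝ) + 2) with hs
  have hk : ∀ k : ℕ, 0 < 1 / ((k : ℝ) + 2) ∧ 1 / ((k : ℝ) + 2) < 1 := fun k =>
    ⟨by positivity, by rw [div_lt_one (by positivity)]; linarith [(Nat.cast_nonneg k : (0:ℝ) ≤ k)]⟩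
  have hs0 : ∀ k, 0 < s k := fun k => by have := (hk k).2; simp only [hs]; linarith
  have hs1 : ∀ k, s k < 1 := fun k => by have := (hk k).1; simp only [hs]; linarith
  have hst : Filter.Tendsto s .atTop (𝓝 1) := by
    have h := ((tendsto_one_div_add_atTop_nhds_zero_nat (𝕜 := ℝ)).comp
      (Filter.tendsto_add_atTop_nat 1)).const_sub 1
    rw [sub_zero] at h
    refine h.congr fun k => ?_
    simp only [hs, Function.comp]; push_cast; ring
  have hder : ∀ x ∈ Ω, ∀ t : ℝ, 0 < t → t ≤ 1 → HasDerivAt (fun t : ℝ => t ^ n * F (t • x))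
      (t ^ n / t * (n * F (t • x) + fderiv ℝ F (t • x) (t • x))) t := by
    intro x hx t ht ht1
    have h1 : HasFDerivAt F (fderiv ℝ F (t • x)) (t • x) :=
      ((hF.contDiffAt (hΩ.mem_nhds (hstar x hx t ht ht1))).differentiableAt one_ne_zero).hasFDerivAt
    have h2 : HasDerivAt (fun t : ℝ => t • x) x t := by simpa using (hasDerivAt_id t).smul_const x
    refine ((hasDerivAt_pow n t).mul (h1.comp_hasDerivAt t h2)).congr_deriv ?_
    simp only [Function.comp, map_smul, smul_eq_mul]
    rcases Nat.eq_zero_or_pos n with rfl | hn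
    · simp; field_simp
    · obtain ⟨m, rfl⟩ : ∃ m, n = m + 1 := ⟨n - 1, by omega⟩
      simp only [Nat.add_sub_cancel]
      field_simp
      ring
  have hcF : ∀ t : ℝ, 0 < t → t ≤ 1 → ContinuousOn (fun x => F (t • x)) Ω := fun t h1 h2 =>
    hF.continuousOn.comp (by fun_prop) fun x hx => hstar x hx t h1 h2
  have hlim : Filter.Tendsto (fun k => ∫ x in Ω, (s k - 1)⁻¹ * (s k ^ n * F (s k • x) - F x)) .atTop
      (𝓝 (∫ x in Ω, (n * F x + fderiv ℝ F x x))) := by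
    refine tendsto_integral_of_dominated_convergence (fun _ => 2 * D') (fun k => ?_)
      (integrable_const _) (fun k => ?_) ?_
    · exact (continuousOn_const.mul ((continuousOn_const.mul (hcF _ (hs0 k) (hs1 k).le)).sub
        hF.continuousOn)).aestronglyMeasurable hΩ.measurableSet
    · filter_upwards [ae_restrict_mem hΩ.measurableSet] with x hx
      have hs2 : 1 / 2 ≤ s k := by
        have : 1 / ((k : ℝ) + 2) ≤ 1 / 2 := by
          gcongr; linarith [(Nat.cast_nonneg k : (0 : ℝ) ≤ k)]
        simp only [hs]; linarith
      have h1 := (convex_Icc (s k) 1).norm_image_sub_le_of_norm_hasDerivWithin_le (C := 2 * D')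
        (fun t ht => (hder x hx t ((hs0 k).trans_le ht.1) ht.2).hasDerivWithinAt)
        (fun t ht => by
          have ht0 : 0 < t := (hs0 k).trans_le ht.1
          rw [norm_mul, Real.norm_of_nonneg (by positivity)]
          refine mul_le_mul ?_ (hD' _ (hstar x hx t ht0 ht.2)) (norm_nonneg _) zero_le_two
          rw [div_le_iff₀ ht0]
          linarith [pow_le_one₀ (n := n) ht0.le ht.2, ht.1])
        (Set.right_mem_Icc.2 (hs1 k).le) (Set.left_mem_Icc.2 (hs1 k).le)
      simp only [one_pow, one_smul, one_mul] at h1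
      have h2 : s k - 1 ≠ 0 := by linarith [hs1 k]
      rw [norm_mul, norm_inv, inv_mul_le_iff₀ (norm_pos_iff.2 h2), mul_comm ‖s k - 1‖]
      exact h1
    · filter_upwards [ae_restrict_mem hΩ.measurableSet] with x hx
      have h1 := (hasDerivAt_iff_tendsto_slope.1 (hder x hx 1 one_pos le_rfl)).comp
        (tendsto_nhdsWithin_iff.2 ⟨hst, .of_forall fun k => (hs1 k).ne⟩)
      simp only [one_pow, one_smul, div_one, one_mul] at h1
      refine h1.congr fun k => ?_
      simp [slope_def_field, div_eq_inv_mul]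
  refine ge_of_tendsto' hlim fun k => ?_
  rw [integral_const_mul]
  refine mul_nonneg_of_nonpos_of_nonpos (inv_nonpos.2 (by linarith [hs1 k])) ?_
  have hFi : IntegrableOn F Ω := IntegrableOn.of_bound hb.measure_lt_top
    (hF.continuousOn.aestronglyMeasurable hΩ.measurableSet) D (by
      filter_upwards [ae_restrict_mem hΩ.measurableSet] with x hx using hD x hx)
  have hFs : IntegrableOn (fun x => F (s k • x)) Ω := IntegrableOn.of_bound hb.measure_lt_top
    ((hcF _ (hs0 k) (hs1 k).le).aestronglyMeasurable hΩ.measurableSet) D (by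
      filter_upwards [ae_restrict_mem hΩ.measurableSet] with x hx
        using hD _ (hstar x hx _ (hs0 k) (hs1 k).le))
  rw [integral_sub (hFs.const_mul _) hFi, integral_const_mul, sub_nonpos]
  have hchange := Measure.setIntegral_comp_smul_of_pos volume F Ω (hs0 k)
  rw [hchange, finrank_euclideanSpace_fin, smul_eq_mul, ← mul_assoc,
    mul_inv_cancel₀ (pow_pos (hs0 k) n).ne', one_mul]
  exact setIntegral_mono_set hFi (by
    filter_upwards [ae_restrict_mem hΩ.measurableSet] with x hx using hF0 x hx)
    (Filter.Eventually.of_forall (by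
      rintro _ ⟨x, hx, rfl⟩
      exact hstar x hx _ (hs0 k) (hs1 k).le))

open TestApproximation

/-- The term with the derivatives of order four of `u` is at most a quadratic form in the
derivatives of order two. -/
theorem TestApproximation.setIntegral_laplacian_laplacian_le {U : RSpace n → ℝ}
    (T : TestApproximation Ω U) (hn : 0 < n) {R : ℝ} (hR : 0 < R) (hΩ : IsOpen Ω)
    (hb : Bornology.IsBounded Ω) (h0 : (0 : RSpace n) ∉ Ω)
    (hstar : ∀ x ∈ Ω, ∀ s : ℝ, 0 < s → s ≤ 1 → s • x ∈ Ω) (hU : ContDiffOn ℝ 4 U Ω)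
    {D₀ D₁ D₂ : ℝ} (hD₀ : ∀ x ∈ Ω, |(Δ U) x| ≤ D₀) (hD₁ : ∀ x ∈ Ω, |fderiv ℝ (Δ U) x x| ≤ D₁)
    (hD₂ : ∀ x ∈ Ω, |(Δ (Δ U)) x| ≤ D₂) :
    IntegrableOn
      (fun x => (Δ (Δ U)) x * (fderiv ℝ U x x * radialWeight n R (greenDeriv n 0) x)) Ω ∧
    ∫ x in Ω, (Δ (Δ U)) x * (fderiv ℝ U x x * radialWeight n R (greenDeriv n 0) x) ≤
      ∫ x in Ω, ((Δ U) x * laplaceMulDensity R x (fderiv ℝ U x x)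
          (fderiv ℝ (fderiv ℝ U) x x x + fderiv ℝ U x x) (2 * (Δ U) x)
        + 1 / 2 * radialWeight n R (greenDeriv n 1) x * (Δ U) x ^ 2) := by
  have hΔ : ContDiffOn ℝ 2 (Δ U) Ω := by
    rw [show Δ U = fun x => bilinTrace (fderiv ℝ (fderiv ℝ U) x) from
      funext fun x => laplacian_eq_bilinTrace U x]
    have h1 : ContDiffOn ℝ 2 (fderiv ℝ (fderiv ℝ U)) Ω :=
      (hU.fderiv_of_isOpen (m := 3) hΩ (by norm_num)).fderiv_of_isOpen hΩ (by norm_num)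
    simp only [bilinTrace]
    fun_prop
  have hΔ' : ContDiffOn ℝ 1 (fderiv ℝ (Δ U)) Ω := hΔ.fderiv_of_isOpen hΩ (by norm_num)
  have hΔ'' : ContinuousOn (Δ (Δ U)) Ω := by
    rw [show Δ (Δ U) = fun x => bilinTrace (fderiv ℝ (fderiv ℝ (Δ U)) x) from
      funext fun x => laplacian_eq_bilinTrace _ x]
    exact continuous_bilinTrace.comp_continuousOn
      (hΔ'.continuousOn_fderiv_of_isOpen hΩ le_rfl)
  have hEΔ : ContinuousOn (fun x => fderiv ℝ (Δ U) x x) Ω :=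
    hΔ'.continuousOn.clm_apply continuousOn_id
  have hU2 : ContDiffOn ℝ 2 U Ω := hU.of_le (by norm_num)
  -- the ingredients as functions on jets
  have t0 := T.isTame_radialWeight hn hR h0 (k := 0) (by norm_num)
  have t1 := T.isTame_radialWeight hn hR h0 (k := 1) (by norm_num)
  have tf := IsTame.of_continuousOn T hΔ.continuousOn hD₀
  have tEf := IsTame.of_continuousOn T hEΔ hD₁
  have tΔf := IsTame.of_continuousOn T hΔ'' hD₂
  have tp : T.IsTame fun x _ p _ => p x := by
    obtain ⟨r, hr⟩ := hb.exists_norm_le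
    refine ((IsTame.of_continuousOn T (h := fun x => ‖x‖ ^ 2) (by fun_prop) (D := r ^ 2)
      fun x hx => ?_).mul T (T.isTame_euler h0)).congr T fun x a p M => ?_
    · rw [abs_of_nonneg (by positivity)]
      have := hr x hx
      gcongr
    · rcases eq_or_ne x 0 with rfl | hx
      · simp
      · have := norm_ne_zero_iff.2 hx
        field_simp
  have tl : T.IsTame fun x _ p M => laplaceMulDensity R x (p x) (M x x + p x) (2 * bilinTrace M) := by
    refine (IsTame.of_coordinates T hn hR h0 (Q := fun y => y 0 * (2 * y 3)
      - 2 * (n * y 0 + y 1) * (y 6 + y 5) + (y 2 + (n + 2) * y 1 + 2 * n * y 0) * y 5)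
      (by fun_prop)).congr T fun x a p M => ?_
    simp [laplaceMulDensity]
    ring
  have tI2 := tΔf.mul T (tp.mul T t0)
  have tJ : T.IsTame (eulerDensity R (Δ U)) := by
    exact (tI2.sub T (tf.mul T tl)).add T
      (T.isTame_bilinTrace.mul T ((t0.mul T tEf).sub T (t1.mul T tf)))
  have hzero : ∫ x in Ω, eulerDensity R (Δ U) x (U x) (fderiv ℝ U x) (fderiv ℝ (fderiv ℝ U) x) = 0 := by
    refine tendsto_nhds_unique (tJ.tendsto_setIntegral T h0 hΩ hb) ?_
    simp only [fun k => setIntegral_eulerDensity_eq_zero hR hΩ h0 (T.isCompact k) (T.subset k) hΔ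
      (T.contDiff k) (T.eq_zero k)]
    exact tendsto_const_nhds
  -- the square of the Laplacian, with the weight, on the star-shaped domain
  set F : RSpace n → ℝ := fun x => (Δ U) x ^ 2 * radialWeight n R (greenDeriv n 0) x with hF
  have hne : ∀ x ∈ Ω, x ≠ 0 := fun x hx h => h0 (h ▸ hx)
  have hFd : ∀ x ∈ Ω, n * F x + fderiv ℝ F x x = 2 * (radialWeight n R (greenDeriv n 0) x * (Δ U) x
      * fderiv ℝ (Δ U) x x) - radialWeight n R (greenDeriv n 1) x * (Δ U) x ^ 2 := fun x hx => by
    have h1 := ((hΔ.contDiffAt (hΩ.mem_nhds hx)).differentiableAt two_ne_zero).hasFDerivAt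
    have h2 := (h1.pow 2).mul (hasFDerivAt_radialWeight_greenDeriv hR (k := 0) (by norm_num)
      (hne x hx))
    have hx0 : ‖x‖ ≠ 0 := norm_ne_zero_iff.2 (hne x hx)
    rw [show fderiv ℝ F x = _ from HasFDerivAt.fderiv h2]
    simp [hF]
    field_simp
    ring
  obtain ⟨G₀, hG₀⟩ := exists_bound_radialWeight_greenDeriv hn hR 0
  obtain ⟨G₁, hG₁⟩ := exists_bound_radialWeight_greenDeriv hn hR 1
  have hpos := setIntegral_euler_divergence_nonneg hΩ hb hstar (F := F) (D := D₀ ^ 2 * G₀)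
    (D' := 2 * (G₀ * D₀ * D₁) + G₁ * D₀ ^ 2)
    (fun x hx => ((((hΔ.contDiffAt (hΩ.mem_nhds hx)).of_le (by norm_num)).pow 2).mul
      (contDiffAt_one_radialWeight hR (by norm_num) (hne x hx))).contDiffWithinAt)
    (fun x _ => mul_nonneg (sq_nonneg _) (div_nonneg (greenDeriv_zero_nonneg hn _) (by positivity)))
    (fun x hx => by
      rw [hF, abs_mul, abs_pow]
      have := hD₀ x hx
      have := hG₀ x
      gcongr)
    (fun x hx => by
      rw [hFd x hx]
      have h1 := hD₀ x hx
      have h2 := hG₀ x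
      have h3 := hG₁ x
      have h4 := hD₁ x hx
      have h5 := (abs_nonneg _).trans h1
      have h6 := (abs_nonneg _).trans h2
      have h7 := (abs_nonneg _).trans h3
      refine (abs_sub _ _).trans ?_
      rw [abs_mul, abs_mul, abs_mul, abs_mul, abs_pow, abs_two]
      gcongr)
  rw [setIntegral_congr_fun hΩ.measurableSet hFd] at hpos
  have i0 := IsTame.integrableOn T tJ h0 hΩ hb hU2
  have i1 := IsTame.integrableOn T tI2 h0 hΩ hb hU2
  have i2 : IntegrableOn (fun x => (Δ U) x * laplaceMulDensity R x (fderiv ℝ U x x)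
      (fderiv ℝ (fderiv ℝ U) x x x + fderiv ℝ U x x) (2 * (Δ U) x)
        + 1 / 2 * radialWeight n R (greenDeriv n 1) x * (Δ U) x ^ 2) Ω := by
    have th := IsTame.of_continuousOn T (h := fun _ => (1 / 2 : ℝ)) continuousOn_const
      (D := 1 / 2) fun _ _ => by norm_num
    refine (IsTame.integrableOn T ((tf.mul T tl).add T ((th.mul T t1).mul T (tf.mul T tf))) h0 hΩ hb
      hU2).congr (.of_forall fun x => ?_)
    simp only [laplacian_eq_bilinTrace U x]
    ring
  refine ⟨i1, ?_⟩
  have e := integral_add (i2.sub i1) i0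
  simp only [Pi.sub_apply] at e
  rw [hzero, add_zero, integral_sub i2 i1] at e
  rw [← sub_nonneg, ← e]
  refine (mul_nonneg (by norm_num : (0 : ℝ) ≤ 1 / 2) hpos).trans_eq ?_
  rw [← integral_const_mul]
  refine integral_congr_ae (.of_forall fun x => ?_)
  simp only [eulerDensity, ← laplacian_eq_bilinTrace U x]
  ring

end StarShaped

end


/-! ### Reduction to the extension -/

section DomainAndSlice

open scoped Laplacian

variable {n : ℕ} {Ω : Set (RSpace n)}

lemma eqOn_fderiv_fderivWithin {E F : Type*} [NormedAddCommGroup E] [NormedSpace ℝ E]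
    [NormedAddCommGroup F] [NormedSpace ℝ F] {Ω K : Set E} (hΩ : IsOpen Ω) (hK : Ω ⊆ K)
    {f g : E → F} (h : Set.EqOn g f Ω) : Set.EqOn (fderiv ℝ g) (fderivWithin ℝ f K) Ω := by
  intro x hx
  rw [fderivWithin_of_mem_nhds (Filter.mem_of_superset (hΩ.mem_nhds hx) hK)]
  exact (h.eventuallyEq_of_mem (hΩ.mem_nhds hx)).fderiv_eq

/-- The Laplacian extends to the closure of the domain. -/
lemma exists_eqOn_laplacian {K : Set (RSpace n)} (hΩ : IsOpen Ω) (hΩK : Ω ⊆ K)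
    (hK : UniqueDiffOn ℝ K) {m : ℕ} {f g : RSpace n → ℝ} (hf : ContDiffOn ℝ (m + 2 : ℕ) f K)
    (h : Set.EqOn g f Ω) : ∃ f', ContDiffOn ℝ m f' K ∧ Set.EqOn (Δ g) f' Ω := by
  have h1 : ContDiffOn ℝ (m + 1 : ℕ) (fderivWithin ℝ f K) K :=
    hf.fderivWithin hK (by norm_cast)
  have h2 : ContDiffOn ℝ m (fderivWithin ℝ (fderivWithin ℝ f K) K) K :=
    h1.fderivWithin hK (by norm_cast)
  refine ⟨fun x => bilinTrace (fderivWithin ℝ (fderivWithin ℝ f K) K x), ?_, fun x hx => ?_⟩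
  · simp only [bilinTrace]
    exact ContDiffOn.sum fun i _ => (h2.clm_apply contDiffOn_const).clm_apply contDiffOn_const
  · rw [laplacian_eq_bilinTrace,
      eqOn_fderiv_fderivWithin hΩ hΩK (eqOn_fderiv_fderivWithin hΩ hΩK h) hx]

lemma exists_unit_inner_pos (hΩ : IsOpen Ω) (hconv : Convex ℝ Ω) (hne : Ω.Nonempty)
    (h0 : (0 : RSpace n) ∉ Ω) : ∃ α : RSpace n, ‖α‖ = 1 ∧ ∀ x ∈ Ω, 0 < inner ℝ α x := by
  obtain ⟨f, hf⟩ := geometric_hahn_banach_point_open hconv hΩ h0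
  simp only [map_zero] at hf
  set a := (InnerProductSpace.toDual ℝ (RSpace n)).symm f with ha
  have hax : ∀ x, inner ℝ a x = f x := fun x => InnerProductSpace.toDual_symm_apply
  have ha0 : a ≠ 0 := by
    obtain ⟨x, hx⟩ := hne
    intro h
    have := hf x hx
    rw [← hax, h, inner_zero_left] at this
    exact this.false
  refine ⟨‖a‖⁻¹ • a, norm_smul_inv_norm ha0, fun x hx => ?_⟩
  rw [real_inner_smul_left, hax]
  exact mul_pos (inv_pos.2 (norm_pos_iff.2 ha0)) (hf x hx)

lemma mem_sphereSlice_iff (h0 : (0 : RSpace n) ∉ Ω) {τ : ℝ}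
    {y : Metric.sphere (0 : RSpace n) 1} :
    y ∈ sphereSlice Ω τ ↔ Real.exp (-τ) • (y : RSpace n) ∈ Ω := by
  have hy : ((τ, (y : RSpace n)) : ℝ × RSpace n) ∈ (logPolar n).target := by
    change ‖(y : RSpace n)‖ = 1; simp
  have hs : (logPolar n).symm (τ, (y : RSpace n)) = Real.exp (-τ) • (y : RSpace n) := rfl
  constructor
  · intro h
    obtain ⟨x, hx, hxy⟩ := (Set.mem_image (logPolar n) Ω (τ, (y : RSpace n))).1 h
    have h1 : (logPolar n).symm (logPolar n x) = x :=
      (logPolar n).left_inv (show x ∈ (logPolar n).source from fun h => h0 (h ▸ hx))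
    rw [hxy, hs] at h1
    rwa [h1]
  · intro h
    rw [← hs] at h
    exact (Set.mem_image (logPolar n) Ω (τ, (y : RSpace n))).2
      ⟨(logPolar n).symm (τ, (y : RSpace n)), h, (logPolar n).right_inv hy⟩

end DomainAndSlice

open scoped Laplacian Gradient
theorem lemma3p3 (n : ℕ) (hn : 2 ≤ n)
    (Ω : Set (RSpace n)) (hΩ_open : IsOpen Ω) (hΩ_convex : Convex ℝ Ω)
    (hΩ_bdd : Bornology.IsBounded Ω) (h0 : (0 : RSpace n) ∈ frontier Ω)
    (u : RSpace n → ℝ) (hu : ContDiffOn ℝ 4 u (closure Ω))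
    (hu_bdry : ∀ x ∈ frontier Ω, u x = 0)
    (hgrad_bdry : ∀ x ∈ frontier Ω, gradientWithin u (closure Ω) x = 0)
    (ξ : RSpace n) (hξ : ξ ∈ Ω) (τ : ℝ) (hτ : τ = Real.log ‖ξ‖⁻¹) :
    IntegrableOn (fun ω : Metric.sphere (0 : RSpace n) 1 =>
        logPolarTransform u (τ, (ω : RSpace n)) ^ 2)
      (sphereSlice Ω τ) (volume : Measure (RSpace n)).toSphere ∧
    IntegrableOn (fun x => (Δ u) x * (Δ (fun y => u y * greenWeight ξ y)) x) Ω volume ∧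
    IntegrableOn (fun x => (Δ (Δ u)) x * (inner ℝ x (∇ u x) * greenWeight ξ x)) Ω volume ∧
    (1 / 2 : ℝ) * (∫ ω in sphereSlice Ω τ, logPolarTransform u (τ, (ω : RSpace n)) ^ 2
        ∂(volume : Measure (RSpace n)).toSphere) ≤
      (((n : ℝ) ^ 2 + n - 2) / n) *
          (∫ x in Ω, (Δ u) x * (Δ (fun y => u y * greenWeight ξ y)) x) -
        (((n : ℝ) ^ 2 - 2) / (2 * n)) *
          (∫ x in Ω, (Δ (Δ u)) x * (inner ℝ x (∇ u x) * greenWeight ξ x)) := by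
  have hn0 : 0 < n := by omega
  have h0c : (0 : RSpace n) ∈ closure Ω := h0.1
  have h0Ω : (0 : RSpace n) ∉ Ω := fun h => h0.2 (by rwa [hΩ_open.interior_eq])
  have hξ0 : ξ ≠ 0 := fun h => h0Ω (h ▸ hξ)
  have hR : 0 < ‖ξ‖ := norm_pos_iff.2 hξ0
  have hne : Ω.Nonempty := ⟨ξ, hξ⟩
  have hmeas := hΩ_open.measurableSet
  have hKc : IsCompact (closure Ω) := hΩ_bdd.isCompact_closure
  have hK : UniqueDiffOn ℝ (closure Ω) := uniqueDiffOn_convex hΩ_convex.closure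
    ⟨ξ, interior_mono subset_closure (by rwa [hΩ_open.interior_eq])⟩
  have hstar : ∀ x ∈ Ω, ∀ s : ℝ, 0 < s → s ≤ 1 → s • x ∈ Ω := fun x hx s hs hs1 => by
    have := hΩ_convex.combo_closure_interior_mem_interior h0c
      (by rwa [hΩ_open.interior_eq] : x ∈ interior Ω) (sub_nonneg.2 hs1) hs (by ring)
    rwa [smul_zero, zero_add, hΩ_open.interior_eq] at this
  obtain ⟨U, B, hUd, hUL, hU0, hUu⟩ := exists_extension_of_cauchy_data_eq_zero hΩ_open hΩ_convex
    hΩ_bdd hne (hu.of_le (by norm_num)) hu_bdry fun x hx => by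
      simpa [gradientWithin] using hgrad_bdry x hx
  have hU4 : ContDiffOn ℝ 4 U Ω := (hu.mono subset_closure).congr hUu
  have hU2 : ContDiffOn ℝ 2 U Ω := hU4.of_le (by norm_num)
  obtain ⟨T⟩ := nonempty_testApproximation hΩ_open hΩ_convex hΩ_bdd hne hUd hUL hU0 hU2
  obtain ⟨α, hα, hΩα⟩ := exists_unit_inner_pos hΩ_open hΩ_convex hne h0Ω
  -- bounds for the derivatives of order up to four
  obtain ⟨f, hf, hΔf⟩ := exists_eqOn_laplacian hΩ_open subset_closure hK (m := 2) hu hUu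
  obtain ⟨f', hf', hΔf'⟩ := exists_eqOn_laplacian hΩ_open subset_closure hK (m := 0) hf hΔf
  have hEf : Set.EqOn (fun x => fderiv ℝ (Δ U) x x)
      (fun x => fderivWithin ℝ f (closure Ω) x x) Ω := fun x hx => by
    simp only [eqOn_fderiv_fderivWithin hΩ_open subset_closure hΔf hx]
  obtain ⟨D₀, hD₀⟩ := hKc.exists_bound_of_continuousOn hf.continuousOn
  obtain ⟨D₁, hD₁⟩ := hKc.exists_bound_of_continuousOn
    ((hf.continuousOn_fderivWithin hK (by norm_num)).clm_apply continuousOn_id)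
  obtain ⟨D₂, hD₂⟩ := hKc.exists_bound_of_continuousOn hf'.continuousOn
  obtain ⟨hint₂, hle₂⟩ := T.setIntegral_laplacian_laplacian_le hn0 hR hΩ_open hΩ_bdd h0Ω hstar hU4
    (fun x hx => by rw [hΔf hx]; exact hD₀ x (subset_closure hx))
    (fun x hx => by
      have := hEf hx
      simp only at this
      rw [this]; exact hD₁ x (subset_closure hx))
    (fun x hx => by rw [hΔf' hx]; exact hD₂ x (subset_closure hx))
  have hpolar := T.half_sphere_integral_le hn hR hΩ_open hΩ_bdd hα hΩα
  have hintJ := TestApproximation.IsTame.integrableOn T (T.isTame_jetDensity hn0 hR h0Ω) h0Ω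
    hΩ_open hΩ_bdd hU2
  have tI₁ : T.IsTame fun x a p M =>
      bilinTrace M * laplaceMulDensity ‖ξ‖ x a (p x) (bilinTrace M) := by
    refine (TestApproximation.IsTame.of_coordinates T hn0 hR h0Ω (Q := fun y => y 3 * (y 0 * y 3
      - 2 * (n * y 0 + y 1) * y 5 + (y 2 + (n + 2) * y 1 + 2 * n * y 0) * y 4))
      (by fun_prop)).congr T fun x a p M => ?_
    simp only [laplaceMulDensity, Matrix.cons_val]
    ring
  have hint₁ := TestApproximation.IsTame.integrableOn T tI₁ h0Ω hΩ_open hΩ_bdd hU2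
  -- the integrands in terms of the extension
  have hne0 : ∀ x ∈ Ω, x ≠ 0 := fun x hx h => h0Ω (h ▸ hx)
  have hw : ∀ x, greenWeight ξ x = radialWeight n ‖ξ‖ (greenDeriv n 0) x := fun x => by
    rw [greenDeriv_zero]; rfl
  have hev : ∀ x ∈ Ω, u =ᶠ[nhds x] U := fun x hx =>
    (hUu.eventuallyEq_of_mem (hΩ_open.mem_nhds hx)).symm
  have hΔ : ∀ x ∈ Ω, (Δ u) x = (Δ U) x := fun x hx =>
    (InnerProductSpace.laplacian_congr_nhds (hev x hx)).self_of_nhds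
  have e₁ : ∀ x ∈ Ω, (Δ u) x * (Δ (fun y => u y * greenWeight ξ y)) x =
      bilinTrace (fderiv ℝ (fderiv ℝ U) x) * laplaceMulDensity ‖ξ‖ x (U x) (fderiv ℝ U x x)
        (bilinTrace (fderiv ℝ (fderiv ℝ U) x)) := fun x hx => by
    have h1 : (fun y => u y * greenWeight ξ y) =ᶠ[nhds x]
        fun y => U y * radialWeight n ‖ξ‖ (greenDeriv n 0) y := by
      filter_upwards [hev x hx] with y hy
      rw [hy, hw]
    rw [(InnerProductSpace.laplacian_congr_nhds h1).self_of_nhds, hΔ x hx,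
      laplacian_mul_greenWeight hR (hne0 x hx) (hU2.contDiffAt (hΩ_open.mem_nhds hx)),
      laplacian_eq_bilinTrace, laplaceMulDensity]
  have e₂ : ∀ x ∈ Ω, (Δ (Δ u)) x * (inner ℝ x (∇ u x) * greenWeight ξ x) =
      (Δ (Δ U)) x * (fderiv ℝ U x x * radialWeight n ‖ξ‖ (greenDeriv n 0) x) := fun x hx => by
    have h1 : Δ u =ᶠ[nhds x] Δ U := by
      filter_upwards [hΩ_open.mem_nhds hx] with y hy using hΔ y hy
    rw [(InnerProductSpace.laplacian_congr_nhds h1).self_of_nhds, hw, real_inner_comm, gradient,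
      InnerProductSpace.toDual_symm_apply, (hev x hx).fderiv_eq]
  have hτR : Real.exp (-τ) = ‖ξ‖ := by
    rw [hτ, Real.log_inv, neg_neg, Real.exp_log hR]
  have e₀ : ∀ y ∈ sphereSlice Ω τ, logPolarTransform u (τ, (y : RSpace n)) ^ 2 =
      (U (‖ξ‖ • (y : RSpace n)) / ‖ξ‖ ^ 2) ^ 2 := fun y hy => by
    rw [mem_sphereSlice_iff h0Ω] at hy
    have h1 : logPolarTransform u (τ, (y : RSpace n)) =
      Real.exp (2 * τ) * u (Real.exp (-τ) • (y : RSpace n)) := rfl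
    have h2 : Real.exp (2 * τ) = (‖ξ‖ ^ 2)⁻¹ := by
      rw [← hτR, ← Real.exp_nat_mul, ← Real.exp_neg]; congr 1; push_cast; ring
    rw [h1, ← hUu hy, h2, hτR, div_eq_inv_mul]
  have hslice : MeasurableSet (sphereSlice Ω τ) := by
    have : sphereSlice Ω τ = (fun y : Metric.sphere (0 : RSpace n) 1 =>
        Real.exp (-τ) • (y : RSpace n)) ⁻¹' Ω := Set.ext fun y => mem_sphereSlice_iff h0Ω
    rw [this]
    exact (hΩ_open.preimage (by fun_prop)).measurableSet
  have hsph : Integrable (fun y : Metric.sphere (0 : RSpace n) 1 =>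
      (U (‖ξ‖ • (y : RSpace n)) / ‖ξ‖ ^ 2) ^ 2) (volume : Measure (RSpace n)).toSphere := by
    have := hUd.continuous
    exact Continuous.integrable_of_hasCompactSupport (by fun_prop) (HasCompactSupport.of_compactSpace _)
  refine ⟨hsph.integrableOn.congr_fun (fun y hy => (e₀ y hy).symm) hslice,
    hint₁.congr_fun (fun x hx => (e₁ x hx).symm) hmeas,
    hint₂.congr_fun (fun x hx => (e₂ x hx).symm) hmeas, ?_⟩
  rw [setIntegral_congr_fun hslice e₀, setIntegral_congr_fun hmeas e₁,
    setIntegral_congr_fun hmeas e₂, setIntegral_eq_integral_of_forall_compl_eq_zero fun y hy => by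
      rw [mem_sphereSlice_iff h0Ω, hτR] at hy
      rw [hU0 _ hy]; simp]
  refine hpolar.trans ?_
  have hnR : (2 : ℝ) ≤ n := by exact_mod_cast hn
  have hc : 0 ≤ ((n : ℝ) ^ 2 - 2) / (2 * n) := div_nonneg (by nlinarith) (by positivity)
  refine le_trans (le_of_eq ?_) (sub_le_sub_left (mul_le_mul_of_nonneg_left hle₂ hc) _)
  rw [← integral_const_mul, ← integral_const_mul, eq_sub_iff_add_eq, ← integral_add hintJ]
  · refine setIntegral_congr_fun hmeas fun x hx => ?_
    simp only [jetDensity_eq hn0 ‖ξ‖ (hne0 x hx), laplacian_eq_bilinTrace U]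
    ring
  · refine IntegrableOn.congr_fun (f := _ - _)
      ((hint₁.const_mul (((n : ℝ) ^ 2 + n - 2) / n)).sub hintJ) (fun x hx => ?_) hmeas
    simp only [Pi.sub_apply, jetDensity_eq hn0 ‖ξ‖ (hne0 x hx), laplacian_eq_bilinTrace U]
    ring
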